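/- Let $\mathfrak g_{\mathbb R}$ be a (finite-dimensional) real semisimple Lie algebra, $G_{\mathbb R}$ the identity component of $\mathrm{Aut}(\mathfrak g_{\mathbb R})$, $K_{\mathbb R}\subset G_{\mathbb R}$ a maximal compact subgroup with Lie algebra $\mathfrak k_{\mathbb R}$, and $\theta$ the Cartan involution of $\mathfrak g_{\mathbb R}$ whose fixed point set is $\mathfrak k_{\mathbb R}$. Let $B$ be a symmetric bilinear form on $\mathfrak g_{\mathbb R}$ that is invariant under $G_{\mathbb R}$ and $\theta$ and negative definite on $\mathfrak k_{\mathbb R}$ (for example the Killing form). Then $(x,y)=-B(x,\theta y)$ is an inner product on $\mathfrak g_{\mathbb R}$; let $\|\cdot\|$ be its norm. For $\zeta\in\mathfrak g_{\mathbb R}\setminus\{0\}$ let $m(\zeta)\in\mathfrak g_{\mathbb R}$ be the vector determined by $$(m(\zeta),\eta)=\frac1{2\|\zeta\|^2}\,\frac{d}{dt}\Big|_{t=0}\|\mathrm{Ad}(\exp t\eta)\,\zeta\|^2\qquad\text{for all }\eta\in\mathfrak g_{\mathbb R}.$$ Let $\mathcal O\subset\mathfrak g_{\mathbb R}\setminus\{0\}$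 be a nilpotent $G_{\mathbb R}$-orbit, i.e. the $G_{\mathbb R}$-orbit of a nonzero nilpotent element. Then: 1. A point $\zeta\in\mathcal O$ is a critical point of the function $\zeta\mapsto\|m(\zeta)\|^2$ on $\mathcal O$ if and only if there exists a real number $a<0$ such that $$[[\zeta,\theta\zeta],\zeta]=a\,\zeta\quad\text{and}\quad[[\zeta,\theta\zeta],\theta\zeta]=-a\,\theta\zeta .$$ 2. The set of critical points is non-empty and consists of a single $K_{\mathbb R}\times\mathbb R^+$-orbit, where $K_{\mathbb R}$ acts on $\mathfrak g_{\mathbb R}$ by automorphisms and $\mathbb R^+$ by scaling. 3. The function $\|m\|^2$ on $\mathcal O$ assumes its minimum value exactly on the critical set. -/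

import Mathlib

open scoped ContDiff

namespace NilpotentOrbit

section Groups

variable (L : Type*) [LieRing L] [LieAlgebra ℝ L]

/-- The canonical topology on `End(L)`: the module topology, which for finite-dimensional `L` is the
unique Hausdorff vector space topology. -/
@[reducible] def endTopology : TopologicalSpace (Module.End ℝ L) :=
  moduleTopology ℝ (Module.End ℝ L)

attribute [local instance] endTopology

theorem endTopology_isTopologicalRing [FiniteDimensional ℝ L] :
    IsTopologicalRing (Module.End ℝ L) :=
  haveI : IsModuleTopology ℝ (Module.End ℝ L) := ⟨rfl⟩
  IsModuleTopology.isTopologicalRing ℝ (Module.End ℝ L)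

attribute [local instance] endTopology_isTopologicalRing

/-- The usual topology on `GL(L)`, as a subspace of `End(L)`. -/
@[reducible] def glTopology : TopologicalSpace (L ≃ₗ[ℝ] L) :=
  TopologicalSpace.induced (fun g => (g : Module.End ℝ L)) (endTopology L)

attribute [local instance] glTopology

/-- `Aut(L)`, the group of Lie algebra automorphisms, as a subgroup of `GL(L)`. -/
def autGroup : Subgroup (L ≃ₗ[ℝ] L) where
  carrier := {g | ∀ x y : L, g ⁅x, y⁆ = ⁅g x, g y⁆}
  mul_mem' {g h} hg hh x y := by
    simp only [LinearEquiv.mul_apply]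
    rw [hh, hg]
  one_mem' _ _ := rfl
  inv_mem' {g} hg x y := by
    apply g.injective
    rw [hg]
    change g (g.symm ⁅x, y⁆) = ⁅g (g.symm x), g (g.symm y)⁆
    simp

/-- The identity component `G_ℝ` of `Aut(L)`. -/
def adjointGroup : Set (L ≃ₗ[ℝ] L) :=
  connectedComponentIn (autGroup L : Set (L ≃ₗ[ℝ] L)) 1

variable {L}

/-- `Ad(exp η) = exp(ad η)`, as an endomorphism of `L`. -/
noncomputable def adExp [FiniteDimensional ℝ L] (η : L) : Module.End ℝ L :=
  NormedSpace.exp (LieAlgebra.ad ℝ L η)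

/-- `K` is a maximal compact subgroup of `G_ℝ`. -/
structure IsMaximalCompact (K : Subgroup (L ≃ₗ[ℝ] L)) : Prop where
  le : (K : Set (L ≃ₗ[ℝ] L)) ⊆ adjointGroup L
  compact : IsCompact (K : Set (L ≃ₗ[ℝ] L))
  maximal : ∀ K' : Subgroup (L ≃ₗ[ℝ] L), (K' : Set (L ≃ₗ[ℝ] L)) ⊆ adjointGroup L →
    IsCompact (K' : Set (L ≃ₗ[ℝ] L)) → K ≤ K' → K' = K

/-- The Lie algebra of the subgroup `K`, viewed inside `L ≅ ad(L)`: all `x` whose one-parameter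
group `exp(t ad x)` lies in `K`. -/
def lieAlgebraOf [FiniteDimensional ℝ L] (K : Subgroup (L ≃ₗ[ℝ] L)) : Set L :=
  {x | ∀ t : ℝ, ∃ k ∈ K, (k : Module.End ℝ L) = adExp (t • x)}

/-- `θ` is a Cartan involution of `L`: an involutive automorphism such that
`(x, y) ↦ -κ(x, θ y)` is positive definite, where `κ` is the Killing form in the strict sense. -/
structure IsCartanInvolution (θ : L ≃ₗ⁅ℝ⁆ L) : Prop where
  involutive : ∀ x, θ (θ x) = x
  pos : ∀ x, x ≠ 0 → 0 < -(killingForm ℝ L x (θ x))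

/-- `B` is a "Killing form" in the loose sense: a `G_ℝ`-invariant symmetric bilinear form which is
negative definite on the `(+1)`-eigenspace of `θ`. Invariance of `B` under `θ` says that the
form `(x, y) ↦ -B(x, θ y)` is symmetric. -/
structure IsLooseKillingForm (θ : L ≃ₗ⁅ℝ⁆ L) (B : LinearMap.BilinForm ℝ L) : Prop where
  symm : ∀ x y, B x y = B y x
  invariant : ∀ g ∈ adjointGroup L, ∀ x y, B (g x) (g y) = B x y
  theta_invariant : ∀ x y, B (θ x) (θ y) = B x y
  neg : ∀ x, θ x = x → x ≠ 0 → B x x < 0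

/-- `O` is the `G_ℝ`-orbit of a nonzero nilpotent element. -/
def IsNonzeroNilpotentOrbit (O : Set L) : Prop :=
  ∃ ζ₀ : L, ζ₀ ≠ 0 ∧ IsNilpotent (LieAlgebra.ad ℝ L ζ₀) ∧
    O = {ζ | ∃ g ∈ adjointGroup L, ζ = g ζ₀}

end Groups

section Moment

variable {L : Type*} [LieRing L] [LieAlgebra ℝ L]

/-- The inner product `(x, y) = -B(x, θ y)`. -/
def ip (θ : L ≃ₗ⁅ℝ⁆ L) (B : LinearMap.BilinForm ℝ L) (x y : L) : ℝ := -(B x (θ y))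

/-- The squared norm of the inner product `ip`. -/
def normSq (θ : L ≃ₗ⁅ℝ⁆ L) (B : LinearMap.BilinForm ℝ L) (x : L) : ℝ := ip θ B x x

/-- The moment map: for `ζ ≠ 0`, `m ζ` is the vector determined by
`(m ζ, η) = (1 / (2 ‖ζ‖²)) * d/dt ‖Ad(exp(t η)) ζ‖² |_{t = 0}` for all `η`. -/
noncomputable def moment [FiniteDimensional ℝ L] (θ : L ≃ₗ⁅ℝ⁆ L) (B : LinearMap.BilinForm ℝ L)
    (ζ : L) : L :=
  Classical.epsilon fun m : L => ∀ η : L,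
    ip θ B m η =
      1 / (2 * normSq θ B ζ) * deriv (fun t : ℝ => normSq θ B (adExp (t • η) ζ)) 0

/-- The function `ζ ↦ ‖m ζ‖²`. -/
noncomputable def momentSq [FiniteDimensional ℝ L] (θ : L ≃ₗ⁅ℝ⁆ L)
    (B : LinearMap.BilinForm ℝ L) (ζ : L) : ℝ :=
  normSq θ B (moment θ B ζ)

/-- `ζ` is a critical point of the restriction of `f` to the submanifold `O` of `L`: the derivative
of `f` at `ζ` vanishes along every smooth curve in `O` through `ζ`. (A curve in the
finite-dimensional space `L` is smooth if its composite with each linear functional is.) -/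
def IsCriticalOn (f : L → ℝ) (O : Set L) (ζ : L) : Prop :=
  ζ ∈ O ∧ ∀ γ : ℝ → L, (∀ φ : Module.Dual ℝ L, ContDiff ℝ ∞ fun t => φ (γ t)) →
    (∀ t, γ t ∈ O) → γ 0 = ζ → HasDerivAt (fun t => f (γ t)) 0 0

end Moment

end NilpotentOrbit

/-!
The moment map is `m(ζ) = -⁅ζ, θ ζ⁆ / ‖ζ‖²`, so everything is a statement about the element
`⁅ζ, θ ζ⁆` of the `(-1)`-eigenspace of `θ`.

*Critical points solve the equation.* The gradient of `‖m‖²` at `ζ` is a linear combination of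
`⁅ζ, ⁅ζ, θ ζ⁆⁆` and `ζ`. It lies in the tangent space `[L, ζ]`, since `ζ = ⁅h, ζ⁆ / 2` for an
`sl₂`-triple (`exists_sl2_triple`), and at a critical point it is orthogonal to `[L, ζ]`; so it
vanishes (`exists_eq_smul_of_isCriticalOn`).

*Solutions exist.* Take an `sl₂`-triple `h, e, f` with `e` in the orbit. The element `h` is
diagonalizable over `ℝ`, hence conjugate to an element with `θ h = -h`
(`exists_unipotent_conj_anti`). The orbit of the pair `(e, f)` under the centralizer of `h` is
closed (`IsNilpotentTriple.isClosed_pairOrbit`), so it contains a pair of minimal length. The first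
variation there gives `⁅e, θ e⁆ + ⁅f, θ f⁆ = 0`, which forces `f = -θ e`
(`IsNilpotentTriple.theta_eq_of_moment_eq_zero`) and thus the equation (`exists_adapted`).

*Solutions are minima.* Let `e` be a solution and `h` the multiple of `⁅e, θ e⁆` with
`⁅h, e⁆ = 2 e`. For `ζ = g e`, the element `g h` is conjugate to an `h''` with `θ h'' = -h''` by
an element unipotent for the eigenspace filtration of `g h`, so that `‖h''‖ = ‖h‖` and `ζ` lies in
the sum of the eigenspaces of `ad h''` for eigenvalues at least `2`. Hence `(m(ζ), h'') ≥ 2` and, by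
Cauchy–Schwarz, `‖m(ζ)‖² ≥ 4 / ‖h‖² = ‖m(e)‖²` (`IsSolution.momentSq_le`). A minimum is critical,
which closes the circle.

*Solutions are unique up to `K_ℝ × ℝ⁺`.* In the case of equality, some `g'` in the group maps `e` to
`ζ` and `h` to a multiple of `m(ζ)`. In the polar decomposition `g' = k exp(ad x)` (`exists_polar`)
the element `x` commutes with `h`, and strict convexity of `t ↦ ‖exp(t ad x) e‖²` shows that
`exp(ad x)` only rescales `e` (`IsSolution.exists_smul_eq`). The group `K_ℝ` enters through its
description as the centralizer of `θ` (`eq_thetaFixer`).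
-/

namespace NilpotentOrbit

open Module Module.End

/-! ### Representations of `sl₂` -/

section Sl2

variable {V : Type*} [AddCommGroup V] [Module ℝ V] {E H Z F : Module.End ℝ V}

theorem weight_apply_pow (hHE : ∀ v, H (E v) = E (H v) + (2 : ℝ) • E v) (k : ℕ) (x : V) :
    H ((E ^ k) x) = (E ^ k) (H x) + (2 * k : ℝ) • (E ^ k) x := by
  induction k generalizing x with
  | zero => simp
  | succ k ih =>
    rw [pow_succ, Module.End.mul_apply, ih, hHE, map_add, map_smul, Module.End.mul_apply]
    push_cast
    module

/-- The commutation rule `E ^ (k + 1) Z = Z E ^ (k + 1) + (k + 1) E ^ k (H + k)`. Only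
`⁅H, E⁆ = 2 E` and `⁅E, Z⁆ = H` are assumed; nothing is required of `⁅H, Z⁆`. -/
theorem pow_succ_apply_lowering (hHE : ∀ v, H (E v) = E (H v) + (2 : ℝ) • E v)
    (hEZ : ∀ v, E (Z v) = Z (E v) + H v) (k : ℕ) (x : V) :
    (E ^ (k + 1)) (Z x) = Z ((E ^ (k + 1)) x) + ((k : ℝ) + 1) • (E ^ k) (H x) +
      (((k : ℝ) + 1) * k) • (E ^ k) x := by
  induction k generalizing x with
  | zero => simp [hEZ]
  | succ k ih =>
    rw [pow_succ E (k + 1), Module.End.mul_apply, hEZ, map_add, ih, hHE, map_add, map_smul,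
      Module.End.mul_apply]
    simp only [pow_succ, Module.End.mul_apply, Nat.cast_add, Nat.cast_one]
    module

/-- On `ker E`, the operator `H - k` maps `im E ^ k` into `im E ^ (k + 1)`. -/
theorem weight_sub_mem_range_pow (hHE : ∀ v, H (E v) = E (H v) + (2 : ℝ) • E v)
    (hEZ : ∀ v, E (Z v) = Z (E v) + H v) {k : ℕ} {v : V} (hv : E v = 0)
    (hk : v ∈ LinearMap.range (E ^ k)) :
    H v - (k : ℝ) • v ∈ LinearMap.range (E ^ (k + 1)) := by
  obtain ⟨x, rfl⟩ := hk
  refine ⟨((k : ℝ) + 1)⁻¹ • Z x, ?_⟩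
  have h0 : (E ^ (k + 1)) x = 0 := by rw [pow_succ', Module.End.mul_apply, hv]
  have hk1 : ((k : ℝ) + 1) ≠ 0 := by positivity
  rw [map_smul, pow_succ_apply_lowering hHE hEZ, h0, map_zero, weight_apply_pow hHE]
  match_scalars <;> field_simp
  ring

theorem apply_weight_eq_zero (hHE : ∀ v, H (E v) = E (H v) + (2 : ℝ) • E v) {v : V}
    (hv : E v = 0) : E (H v) = 0 := by
  have := hHE v
  rw [hv] at this
  simpa using this.symm

/-- `H` has no negative eigenvalues on `ker E`. -/
theorem eq_zero_of_neg_weight (hE : IsNilpotent E)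
    (hHE : ∀ v, H (E v) = E (H v) + (2 : ℝ) • E v)
    (hEZ : ∀ v, E (Z v) = Z (E v) + H v) {c : ℝ} (hc : c < 0) {v : V} (hv : E v = 0)
    (hHv : H v = c • v) : v = 0 := by
  obtain ⟨n, hn⟩ := hE
  have key : ∀ k : ℕ, v ∈ LinearMap.range (E ^ k) := by
    intro k
    induction k with
    | zero => exact ⟨v, by simp⟩
    | succ k ih =>
      have h1 := weight_sub_mem_range_pow hHE hEZ hv ih
      have hck : c - k ≠ 0 := by
        have : (0 : ℝ) ≤ k := k.cast_nonneg
        linarith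
      rw [hHv, ← sub_smul] at h1
      exact (Submodule.smul_mem_iff _ hck).1 h1
  obtain ⟨x, hx⟩ := key n
  rw [← hx, hn, LinearMap.zero_apply]

/-- `H - c` maps `ker E` onto itself for `c < 0`. -/
theorem exists_mem_ker_weight_sub_eq [FiniteDimensional ℝ V] (hE : IsNilpotent E)
    (hHE : ∀ v, H (E v) = E (H v) + (2 : ℝ) • E v)
    (hEZ : ∀ v, E (Z v) = Z (E v) + H v) {c : ℝ} (hc : c < 0) {w : V} (hw : E w = 0) :
    ∃ v, E v = 0 ∧ H v - c • v = w := by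
  let T : Module.End ℝ V := H - c • 1
  have hT : ∀ v ∈ LinearMap.ker E, T v ∈ LinearMap.ker E := by
    intro v hv
    rw [LinearMap.mem_ker] at hv ⊢
    simp [T, hv, apply_weight_eq_zero hHE hv]
  have hinj : Function.Injective (T.restrict hT) := by
    rw [← LinearMap.ker_eq_bot, LinearMap.ker_eq_bot']
    intro v hv
    have h1 : T v = 0 := congrArg Subtype.val hv
    have h2 : H v = c • (v : V) := by
      simpa [T, sub_eq_zero] using h1
    exact Subtype.ext (eq_zero_of_neg_weight hE hHE hEZ hc (LinearMap.mem_ker.1 v.2) h2)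
  obtain ⟨v, hv⟩ := LinearMap.injective_iff_surjective.1 hinj ⟨w, hw⟩
  refine ⟨v, v.2, ?_⟩
  simpa [T] using congrArg Subtype.val hv

/-- `ker E` is spanned by eigenvectors of `H` with nonnegative integer eigenvalues, those in
`im E ^ k` having eigenvalue at least `k`. -/
theorem ker_inf_range_pow_le (hE : IsNilpotent E)
    (hHE : ∀ v, H (E v) = E (H v) + (2 : ℝ) • E v)
    (hEZ : ∀ v, E (Z v) = Z (E v) + H v) (k : ℕ) :
    LinearMap.ker E ⊓ LinearMap.range (E ^ k) ≤ ⨆ j : {j : ℕ // k ≤ j}, H.eigenspace (j : ℝ) := by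
  obtain ⟨n, hn⟩ := hE
  obtain hkn | hkn := le_total n k
  · rw [show E ^ k = 0 from pow_eq_zero_of_le hkn hn]
    simp
  induction hkn using Nat.decreasingInduction with
  | self => rw [hn]; simp
  | of_succ k hk ih =>
    rintro v ⟨hv, hvk⟩
    rw [SetLike.mem_coe, LinearMap.mem_ker] at hv
    have h1 := weight_sub_mem_range_pow hHE hEZ hv hvk
    have h2 : E (H v - (k : ℝ) • v) = 0 := by simp [hv, apply_weight_eq_zero hHE hv]
    have h3 := ih ⟨h2, h1⟩
    have h4 : (⨆ j : {j : ℕ // k + 1 ≤ j}, H.eigenspace (j : ℝ)) ≤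
        (⨆ j : {j : ℕ // k + 1 ≤ j}, H.eigenspace (j : ℝ)).map (H - (k : ℝ) • 1) := by
      refine iSup_le fun j x hx => ?_
      have hjk : ((j : ℕ) : ℝ) - k ≠ 0 := by
        have : ((k + 1 : ℕ) : ℝ) ≤ (j : ℕ) := Nat.cast_le.2 j.2
        push_cast at this
        linarith
      refine ⟨(((j : ℕ) : ℝ) - k)⁻¹ • x, Submodule.smul_mem _ _
        (Submodule.mem_iSup_of_mem j hx), ?_⟩
      rw [Module.End.mem_eigenspace_iff] at hx
      simp only [map_smul, LinearMap.sub_apply, hx, LinearMap.smul_apply, Module.End.one_apply,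
        ← sub_smul, smul_smul, inv_mul_cancel₀ hjk, one_smul]
    obtain ⟨w, hw, hwv⟩ := h4 h3
    have h5 : (⨆ j : {j : ℕ // k + 1 ≤ j}, H.eigenspace (j : ℝ)) ≤
        ⨆ j : {j : ℕ // k ≤ j}, H.eigenspace (j : ℝ) :=
      iSup_le fun j => le_iSup (fun j : {j : ℕ // k ≤ j} => H.eigenspace ((j : ℕ) : ℝ))
        ⟨j, by have := j.2; omega⟩
    have h6 : v - w ∈ H.eigenspace (k : ℝ) := by
      rw [Module.End.mem_eigenspace_iff]
      have : H w - (k : ℝ) • w = H v - (k : ℝ) • v := by simpa using hwv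
      rw [map_sub, smul_sub, sub_eq_sub_iff_sub_eq_sub]
      exact this.symm
    have h7 : v - w ∈ ⨆ j : {j : ℕ // k ≤ j}, H.eigenspace ((j : ℕ) : ℝ) :=
      Submodule.mem_iSup_of_mem (p := fun j : {j : ℕ // k ≤ j} => H.eigenspace ((j : ℕ) : ℝ))
        ⟨k, le_rfl⟩ h6
    have := add_mem h7 (h5 hw)
    simpa using this

/-- `E F` is injective on vectors of positive weight. -/
theorem eq_zero_of_pos_weight (hE : IsNilpotent E)
    (hHE : ∀ v, H (E v) = E (H v) + (2 : ℝ) • E v)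
    (hEF : ∀ v, E (F v) = F (E v) + H v) {c : ℝ} (hc : 0 < c) {v : V} (hHv : H v = c • v)
    (hv : E (F v) = 0) : v = 0 := by
  obtain ⟨n, hn⟩ := hE
  -- `F E` acts on `E ^ k v` by a negative scalar, so `E ^ (k + 1) v = 0` forces `E ^ k v = 0`.
  have key : ∀ k : ℕ, ∃ α : ℝ, 0 < α ∧ F (E ((E ^ k) v)) = -(α • (E ^ k) v) := by
    intro k
    induction k with
    | zero =>
      refine ⟨c, hc, ?_⟩
      have := hEF v
      rw [hv, hHv] at this
      simpa [eq_neg_iff_add_eq_zero] using this.symm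
    | succ k ih =>
      obtain ⟨α, hα, h⟩ := ih
      refine ⟨α + c + 2 * (k + 1), by positivity, ?_⟩
      have h1 := hEF (E ((E ^ k) v))
      have h2 := weight_apply_pow hHE (k + 1) v
      rw [pow_succ', Module.End.mul_apply] at h2 ⊢
      rw [h, h2, hHv, map_neg, map_smul, map_smul] at h1
      rw [Module.End.mul_apply] at h1
      push_cast at h1
      rw [← sub_eq_iff_eq_add] at h1
      rw [← h1]
      module
  have h0 : ∀ k : ℕ, k ≤ n → (E ^ k) v = 0 := by
    intro k hk
    induction hk using Nat.decreasingInduction with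
    | self => rw [hn, LinearMap.zero_apply]
    | of_succ k _ ih =>
      obtain ⟨α, hα, h⟩ := key k
      rw [pow_succ', Module.End.mul_apply] at ih
      rw [ih, map_zero, eq_comm, neg_eq_zero, smul_eq_zero] at h
      exact h.resolve_left hα.ne'
  simpa using h0 0 n.zero_le

/-- `E` maps the weight space of weight `c - 2` onto that of weight `c`, for `c > 0`. -/
theorem exists_weight_preimage_of_pos [FiniteDimensional ℝ V] (hE : IsNilpotent E)
    (hHE : ∀ v, H (E v) = E (H v) + (2 : ℝ) • E v)
    (hEF : ∀ v, E (F v) = F (E v) + H v) (hHF : ∀ v, H (F v) = F (H v) - (2 : ℝ) • F v)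
    {c : ℝ} (hc : 0 < c) {v : V} (hHv : H v = c • v) :
    ∃ w, H w = (c - 2) • w ∧ E w = v := by
  have hT : ∀ v ∈ H.eigenspace c, (E * F) v ∈ H.eigenspace c := by
    intro v hv
    rw [Module.End.mem_eigenspace_iff] at hv ⊢
    rw [Module.End.mul_apply, hHE, hHF, hv, map_sub, map_smul, map_smul, map_smul]
    module
  have hinj : Function.Injective ((E * F).restrict hT) := by
    rw [← LinearMap.ker_eq_bot, LinearMap.ker_eq_bot']
    intro v hv
    have h1 : E (F v) = 0 := congrArg Subtype.val hv
    exact Subtype.ext (eq_zero_of_pos_weight hE hHE hEF hc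
      (Module.End.mem_eigenspace_iff.1 v.2) h1)
  obtain ⟨u, hu⟩ := LinearMap.injective_iff_surjective.1 hinj
    ⟨v, Module.End.mem_eigenspace_iff.2 hHv⟩
  refine ⟨F u, ?_, congrArg Subtype.val hu⟩
  rw [hHF, Module.End.mem_eigenspace_iff.1 u.2, map_smul, sub_smul]

/-- In a finite-dimensional real representation of `sl₂` in which `E` is nilpotent, `H` is
diagonalizable over `ℝ`. -/
theorem iSup_eigenspace_weight_eq_top [FiniteDimensional ℝ V] (hE : IsNilpotent E)
    (hHE : ∀ v, H (E v) = E (H v) + (2 : ℝ) • E v)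
    (hEF : ∀ v, E (F v) = F (E v) + H v) (hHF : ∀ v, H (F v) = F (H v) - (2 : ℝ) • F v) :
    ⨆ c, H.eigenspace c = ⊤ := by
  have hker : LinearMap.ker E ≤ ⨆ c, H.eigenspace c := by
    have := ker_inf_range_pow_le hE hHE hEF 0
    rw [pow_zero, Module.End.one_eq_id, LinearMap.range_id, inf_top_eq] at this
    exact this.trans (iSup_le fun j => le_iSup (fun c => H.eigenspace c) _)
  -- Each weight vector in the image of `E` is the image of a weight vector.
  have hrange : LinearMap.range E ⊓ (⨆ c, H.eigenspace c) ≤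
      (⨆ c, H.eigenspace c).map E := by
    have hinv : ∀ x ∈ LinearMap.range E, H x ∈ LinearMap.range E := by
      rintro _ ⟨x, rfl⟩
      exact ⟨H x + (2 : ℝ) • x, by rw [hHE, map_add, map_smul]⟩
    have h1 := Submodule.inf_iSup_genEigenspace hinv 1
    change LinearMap.range E ⊓ (⨆ c, H.eigenspace c) =
      ⨆ c, LinearMap.range E ⊓ H.eigenspace c at h1
    rw [h1]
    refine iSup_le fun c => ?_
    rintro _ ⟨⟨x, rfl⟩, hx⟩
    rw [SetLike.mem_coe, Module.End.mem_eigenspace_iff] at hx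
    obtain hc | hc := lt_or_ge 0 c
    · obtain ⟨w, hw, hwx⟩ := exists_weight_preimage_of_pos hE hHE hEF hHF hc hx
      exact ⟨w, Submodule.mem_iSup_of_mem (c - 2) (Module.End.mem_eigenspace_iff.2 hw), hwx⟩
    · have h2 : E (H x - (c - 2) • x) = 0 := by
        have := hHE x
        rw [hx, ← sub_eq_iff_eq_add] at this
        rw [map_sub, map_smul, ← this]
        module
      obtain ⟨v, hv, hvw⟩ := exists_mem_ker_weight_sub_eq hE hHE hEF
        (show c - 2 < 0 by linarith) h2
      refine ⟨x - v, Submodule.mem_iSup_of_mem (c - 2) (Module.End.mem_eigenspace_iff.2 ?_), ?_⟩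
      · rw [map_sub, smul_sub, sub_eq_sub_iff_sub_eq_sub]
        exact hvw.symm
      · rw [map_sub, hv, sub_zero]
  have hpow : ∀ (k : ℕ) (v : V), (E ^ k) v = 0 → v ∈ ⨆ c, H.eigenspace c := by
    intro k
    induction k with
    | zero => intro v hv; rw [pow_zero, Module.End.one_apply] at hv; simp [hv]
    | succ k ih =>
      intro v hv
      rw [pow_succ, Module.End.mul_apply] at hv
      obtain ⟨w, hw, hwv⟩ := hrange ⟨⟨v, rfl⟩, ih _ hv⟩
      have h1 : v - w ∈ LinearMap.ker E := by rw [LinearMap.mem_ker, map_sub, hwv, sub_self]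
      simpa using add_mem (hker h1) hw
  obtain ⟨n, hn⟩ := hE
  exact eq_top_iff.2 fun v _ => hpow n v (by rw [hn, LinearMap.zero_apply])

end Sl2

/-! ### Jacobson's lemma and the Jacobson–Morozov theorem -/

section Trace

attribute [local instance] LieRing.ofAssociativeRing

variable {V : Type*} [AddCommGroup V] [Module ℝ V] {A Z D : Module.End ℝ V}

theorem ad_pow_succ_mul (hD : ⁅A, Z⁆ = D) (hAD : ⁅A, D⁆ = 0) (k : ℕ) (Y : Module.End ℝ V) :
    ((LieAlgebra.ad ℝ (Module.End ℝ V) A) ^ (k + 1)) (Z * Y) =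
      Z * ((LieAlgebra.ad ℝ (Module.End ℝ V) A) ^ (k + 1)) Y +
        ((k : ℝ) + 1) • (D * ((LieAlgebra.ad ℝ (Module.End ℝ V) A) ^ k) Y) := by
  have hmul : ∀ X Y : Module.End ℝ V, ⁅A, X * Y⁆ = ⁅A, X⁆ * Y + X * ⁅A, Y⁆ := by
    intro X Y
    simp only [Ring.lie_def]
    noncomm_ring
  induction k with
  | zero => simp [hmul, hD, add_comm]
  | succ k ih =>
    rw [pow_succ', Module.End.mul_apply, ih, map_add, map_smul]
    simp only [LieAlgebra.ad_apply, hmul, hD, hAD, zero_mul, zero_add]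
    simp only [pow_succ' _ k, Module.End.mul_apply, LieAlgebra.ad_apply]
    push_cast
    module

/-- Jacobson's lemma: a commutator `⁅A, Z⁆` that commutes with the nilpotent `A` is nilpotent. -/
theorem isNilpotent_lie_of_commute (hA : IsNilpotent A) (hD : ⁅A, Z⁆ = D) (hAD : ⁅A, D⁆ = 0) :
    IsNilpotent D := by
  -- The derivation `δ = ad A` satisfies `δ ^ n (Z ^ n) = n! D ^ n`, and `δ` is nilpotent.
  have key : ∀ n : ℕ, ((LieAlgebra.ad ℝ (Module.End ℝ V) A) ^ n) (Z ^ n) =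
      (n.factorial : ℝ) • D ^ n ∧ ((LieAlgebra.ad ℝ (Module.End ℝ V) A) ^ (n + 1)) (Z ^ n) = 0 := by
    intro n
    induction n with
    | zero => simp [Ring.lie_def]
    | succ n ih =>
      rw [pow_succ' Z, ad_pow_succ_mul hD hAD, ad_pow_succ_mul hD hAD, pow_succ' _ (n + 1),
        Module.End.mul_apply, ih.2, ih.1]
      refine ⟨?_, by simp⟩
      rw [mul_zero, zero_add, mul_smul_comm, smul_smul, ← pow_succ', Nat.factorial_succ]
      push_cast
      rfl
  obtain ⟨n, hn⟩ := LieAlgebra.ad_nilpotent_of_nilpotent (R := ℝ) hA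
  refine ⟨n, ?_⟩
  have h1 := (key n).1
  rw [hn, LinearMap.zero_apply, eq_comm, smul_eq_zero] at h1
  exact h1.resolve_left (by positivity)

/-- If `A` is nilpotent and commutes with `⁅A, Z⁆` then `A Z` is nilpotent: on
`ker A ^ (j + 1) / ker A ^ j` it acts as a multiple of the nilpotent operator `⁅A, Z⁆`. -/
theorem isNilpotent_mul_of_commute_lie (hA : IsNilpotent A) (hD : ⁅A, Z⁆ = D)
    (hAD : ⁅A, D⁆ = 0) : IsNilpotent (A * Z) := by
  obtain ⟨m, hm⟩ := isNilpotent_lie_of_commute hA hD hAD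
  have hAD' : Commute A D := by rwa [commute_iff_lie_eq]
  have hpow : ∀ (k : ℕ) (x : V),
      (A ^ (k + 1)) (Z x) = Z ((A ^ (k + 1)) x) + ((k : ℝ) + 1) • D ((A ^ k) x) := by
    intro k x
    have hAZ : ∀ x, A (Z x) = Z (A x) + D x := by
      intro x
      rw [← hD, Ring.lie_def]
      simp
    have hADk : ∀ (k : ℕ) x, (A ^ k) (D x) = D ((A ^ k) x) := fun k x =>
      LinearMap.congr_fun (hAD'.pow_left k).eq x
    induction k generalizing x with
    | zero => simp [hAZ]
    | succ k ih =>
      rw [pow_succ A (k + 1), Module.End.mul_apply, hAZ, map_add, ih, hADk]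
      simp only [pow_succ, Module.End.mul_apply]
      push_cast
      module
  have hstable : ∀ (j : ℕ) (x : V), (A ^ j) x = 0 → (A ^ j) (A (Z x)) = 0 := by
    intro j x hx
    have := hpow j x
    rwa [pow_succ' A j, Module.End.mul_apply A (A ^ j) x, hx, map_zero, map_zero, map_zero,
      smul_zero, add_zero, ← pow_succ', pow_succ, Module.End.mul_apply] at this
  have hstep : ∀ (j i : ℕ) (x : V), (A ^ (j + 1)) x = 0 →
      (A ^ j) (((A * Z) ^ i) x - ((j : ℝ) + 1) ^ i • (D ^ i) x) = 0 := by
    intro j i x hx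
    induction i with
    | zero => simp
    | succ i ih =>
      have h1 := hstable j _ ih
      have h2 : (A ^ (j + 1)) ((D ^ i) x) = 0 := by
        have := LinearMap.congr_fun (hAD'.pow_pow (j + 1) i).eq x
        rw [Module.End.mul_apply, Module.End.mul_apply] at this
        rw [this, hx, map_zero]
      have h3 := hpow j ((D ^ i) x)
      rw [h2, map_zero, zero_add, pow_succ, Module.End.mul_apply] at h3
      have h4 : (A ^ j) (D ((D ^ i) x)) = D ((A ^ j) ((D ^ i) x)) :=
        LinearMap.congr_fun (hAD'.pow_left j).eq _
      rw [map_sub, map_sub, map_sub, map_smul, map_smul, map_smul, h3, sub_eq_zero] at h1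
      rw [map_sub, map_smul, pow_succ' (A * Z), pow_succ' D, Module.End.mul_apply,
        Module.End.mul_apply, Module.End.mul_apply, h1, h4]
      module
  have key : ∀ j : ℕ, ∃ N : ℕ, ∀ x, (A ^ j) x = 0 → ((A * Z) ^ N) x = 0 := by
    intro j
    induction j with
    | zero => exact ⟨0, fun x hx => by simpa using hx⟩
    | succ j ih =>
      obtain ⟨N, hN⟩ := ih
      refine ⟨N + m, fun x hx => ?_⟩
      rw [pow_add, Module.End.mul_apply]
      apply hN
      have := hstep j m x hx
      rwa [hm, LinearMap.zero_apply, smul_zero, sub_zero] at this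
  obtain ⟨n, hn⟩ := hA
  obtain ⟨N, hN⟩ := key n
  exact ⟨N, LinearMap.ext fun x => hN x (by rw [hn, LinearMap.zero_apply])⟩

end Trace

section JacobsonMorozov

attribute [local instance] LieRing.ofAssociativeRing

variable {L : Type*} [LieRing L] [LieAlgebra ℝ L]

/-- The image of an operator is the annihilator of the kernel of its adjoint. -/
theorem mem_range_of_forall_ker {V : Type*} [AddCommGroup V] [Module ℝ V] [FiniteDimensional ℝ V]
    {β : LinearMap.BilinForm ℝ V} (hβ : β.Nondegenerate) (hβs : β.IsSymm) {T T' : Module.End ℝ V}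
    (hT : ∀ x y, β (T x) y = β x (T' y)) {v : V} (hv : ∀ z, T' z = 0 → β v z = 0) :
    v ∈ LinearMap.range T := by
  rw [← LinearMap.BilinForm.orthogonal_orthogonal hβ hβs.isRefl (LinearMap.range T)]
  intro z hz
  have h1 : T' z = 0 := by
    refine hβ.2 _ fun x => ?_
    rw [← hT]
    exact hz _ ⟨x, rfl⟩
  rw [← hv z h1]
  exact hβs.eq z v

theorem killingForm_lie (x y z : L) :
    killingForm ℝ L ⁅x, y⁆ z = -killingForm ℝ L y ⁅x, z⁆ := by
  rw [← lie_skew, map_neg, LinearMap.neg_apply]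
  congr 1
  exact LieModule.traceForm_apply_lie_apply ℝ L L y x z

theorem killingForm_comm (x y : L) : killingForm ℝ L x y = killingForm ℝ L y x :=
  LieModule.traceForm_comm ℝ L L x y

theorem isNilpotent_ad_pow [FiniteDimensional ℝ L] {e : L}
    (he : IsNilpotent (LieAlgebra.ad ℝ L e)) :
    LieAlgebra.ad ℝ L e ^ finrank ℝ L = 0 :=
  LinearMap.isNilpotent_iff_charpoly _ |>.1 he |> fun h => by
    have := LinearMap.aeval_self_charpoly (LieAlgebra.ad ℝ L e)
    rwa [h, map_pow, Polynomial.aeval_X] at this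

/-- The Jacobson–Morozov theorem. -/
theorem exists_sl2_triple [FiniteDimensional ℝ L] [LieAlgebra.IsKilling ℝ L] {e : L}
    (he : IsNilpotent (LieAlgebra.ad ℝ L e)) :
    ∃ h f : L, ⁅h, e⁆ = (2 : ℝ) • e ∧ ⁅h, f⁆ = -((2 : ℝ) • f) ∧ ⁅e, f⁆ = h := by
  -- `e` lies in the image of `(ad e)²`, since it is Killing-orthogonal to its kernel.
  have h1 : e ∈ LinearMap.range (LieAlgebra.ad ℝ L e * LieAlgebra.ad ℝ L e) := by
    refine mem_range_of_forall_ker (LieAlgebra.IsKilling.killingForm_nondegenerate ℝ L)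
      ⟨fun x y => killingForm_comm x y⟩ (T' := LieAlgebra.ad ℝ L e * LieAlgebra.ad ℝ L e) ?_ ?_
    · intro x y
      simp only [Module.End.mul_apply, LieAlgebra.ad_apply, killingForm_lie, neg_neg]
    · intro z hz
      rw [Module.End.mul_apply, LieAlgebra.ad_apply, LieAlgebra.ad_apply] at hz
      rw [killingForm_apply_apply]
      have h2 := isNilpotent_mul_of_commute_lie (A := LieAlgebra.ad ℝ L e)
        (Z := LieAlgebra.ad ℝ L z) he (D := LieAlgebra.ad ℝ L ⁅e, z⁆) (LieHom.map_lie _ _ _).symm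
        (by rw [← LieHom.map_lie, hz, map_zero])
      exact (LinearMap.isNilpotent_trace_of_isNilpotent h2).eq_zero
  obtain ⟨z, hz⟩ := h1
  rw [Module.End.mul_apply, LieAlgebra.ad_apply, LieAlgebra.ad_apply] at hz
  set z' : L := (-2 : ℝ) • z with hz'
  set h : L := ⁅e, z'⁆ with hh
  have hhe : ⁅h, e⁆ = (2 : ℝ) • e := by
    rw [← lie_skew, hh, hz', lie_smul, lie_smul, hz]
    module
  have hHE : ∀ v, LieAlgebra.ad ℝ L h (LieAlgebra.ad ℝ L e v) =
      LieAlgebra.ad ℝ L e (LieAlgebra.ad ℝ L h v) + (2 : ℝ) • LieAlgebra.ad ℝ L e v := by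
    intro v
    simp only [LieAlgebra.ad_apply]
    rw [leibniz_lie, hhe, smul_lie, add_comm]
  have hEZ : ∀ v, LieAlgebra.ad ℝ L e (LieAlgebra.ad ℝ L z' v) =
      LieAlgebra.ad ℝ L z' (LieAlgebra.ad ℝ L e v) + LieAlgebra.ad ℝ L h v := by
    intro v
    simp only [LieAlgebra.ad_apply]
    rw [leibniz_lie, add_comm]
  -- Correct `z'` by an element of `ker (ad e)`, on which `ad h + 2` is invertible.
  have hw : LieAlgebra.ad ℝ L e (⁅h, z'⁆ + (2 : ℝ) • z') = 0 := by
    rw [map_add, map_smul, LieAlgebra.ad_apply, LieAlgebra.ad_apply, leibniz_lie, ← hh, lie_self,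
      add_zero, ← lie_skew e h, hhe, neg_lie, smul_lie, ← hh, neg_add_cancel]
  obtain ⟨w, hw1, hw2⟩ := exists_mem_ker_weight_sub_eq he hHE hEZ (c := -2) (by norm_num) hw
  rw [LieAlgebra.ad_apply] at hw1 hw2
  refine ⟨h, z' - w, hhe, ?_, by rw [lie_sub, hw1, sub_zero]⟩
  rw [lie_sub, sub_eq_iff_eq_add.1 hw2]
  module

end JacobsonMorozov

/-! ### The exponential of an endomorphism -/

section Norm

variable (L : Type*) [LieRing L] [LieAlgebra ℝ L] [FiniteDimensional ℝ L]

/-- A norm on `L`, coming from a choice of basis. All norms on `L` are equivalent. -/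
noncomputable abbrev basisNorm : NormedAddCommGroup L :=
  NormedAddCommGroup.induced L (Fin (finrank ℝ L) → ℝ) (finBasis ℝ L).equivFun
    (finBasis ℝ L).equivFun.injective

attribute [local instance] basisNorm

/-- The scalar multiplication is compatible with `basisNorm`. -/
noncomputable abbrev basisNormedSpace : NormedSpace ℝ L :=
  NormedSpace.induced ℝ L (Fin (finrank ℝ L) → ℝ) (finBasis ℝ L).equivFun

end Norm

section Exp

attribute [local instance] endTopology endTopology_isTopologicalRing
attribute [local instance] basisNorm basisNormedSpace

variable {L : Type*} [LieRing L] [LieAlgebra ℝ L] [FiniteDimensional ℝ L]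

variable (L) in
/-- The identification of endomorphisms with continuous linear maps, as a homeomorphism. It is
multiplicative, so it carries the exponential of `Module.End ℝ L`, whose topology is not given by a
norm, to that of a Banach algebra. -/
noncomputable def endEquiv : Module.End ℝ L ≃L[ℝ] (L →L[ℝ] L) :=
  have : IsModuleTopology ℝ (Module.End ℝ L) := ⟨rfl⟩
  have : ContinuousAdd (Module.End ℝ L) := IsModuleTopology.toContinuousAdd ℝ _
  { (Module.End.toContinuousLinearMap L).toLinearEquiv with
    continuous_toFun := IsModuleTopology.continuous_of_linearMap _
    continuous_invFun := LinearMap.continuous_of_finiteDimensional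
      ((Module.End.toContinuousLinearMap L).toLinearEquiv.symm.toLinearMap) }

@[simp] theorem endEquiv_apply (A : Module.End ℝ L) (v : L) : endEquiv L A v = A v := rfl

theorem endEquiv_mul (A B : Module.End ℝ L) :
    endEquiv L (A * B) = endEquiv L A * endEquiv L B := rfl

theorem endEquiv_pow (A : Module.End ℝ L) (n : ℕ) : endEquiv L (A ^ n) = endEquiv L A ^ n := by
  induction n with
  | zero => rfl
  | succ n ih => rw [pow_succ, pow_succ, endEquiv_mul, ih]

/-- The exponential of an endomorphism, so that `adExp x = expEnd (ad x)`. -/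
noncomputable def expEnd (A : Module.End ℝ L) : Module.End ℝ L := NormedSpace.exp A

theorem adExp_eq (x : L) : adExp x = expEnd (LieAlgebra.ad ℝ L x) := rfl

theorem endEquiv_expEnd (A : Module.End ℝ L) :
    endEquiv L (expEnd A) = NormedSpace.exp (endEquiv L A) := by
  have h1 := (NormedSpace.exp_series_hasSum_exp' (𝕂 := ℝ) (endEquiv L A))
  have h2 := h1.mapL ((endEquiv L).symm : (L →L[ℝ] L) →L[ℝ] Module.End ℝ L)
  have := (endEquiv L).symm.toHomeomorph.t2Space
  rw [← (endEquiv L).symm.injective.eq_iff, ContinuousLinearEquiv.symm_apply_apply, expEnd,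
    NormedSpace.exp_eq_tsum ℝ]
  refine Eq.trans ?_ h2.tsum_eq
  refine tsum_congr fun n => ?_
  rw [← endEquiv_pow, ← map_smul]
  exact ((endEquiv L).symm_apply_apply _).symm

theorem exp_smul_endEquiv (A : Module.End ℝ L) (t : ℝ) :
    NormedSpace.exp (t • endEquiv L A) = endEquiv L (expEnd (t • A)) := by
  rw [endEquiv_expEnd, map_smul]

theorem hasSum_expEnd_apply (A : Module.End ℝ L) (v : L) :
    HasSum (fun n : ℕ => (n.factorial : ℝ)⁻¹ • (A ^ n) v) (expEnd A v) := by
  have h1 := NormedSpace.exp_series_hasSum_exp' (𝕂 := ℝ) (endEquiv L A)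
  rw [← endEquiv_expEnd] at h1
  have h2 := h1.mapL (ContinuousLinearMap.apply ℝ L v)
  simpa [← endEquiv_pow] using h2

theorem expEnd_zero : expEnd (0 : Module.End ℝ L) = 1 := by
  rw [expEnd, NormedSpace.exp_zero]

theorem expEnd_add {A B : Module.End ℝ L} (h : Commute A B) :
    expEnd (A + B) = expEnd A * expEnd B := by
  apply (endEquiv L).injective
  have h' : Commute (endEquiv L A) (endEquiv L B) := by
    rw [Commute, SemiconjBy, ← endEquiv_mul, h.eq, endEquiv_mul]
  let _ : NormedAlgebra ℚ (L →L[ℝ] L) := NormedAlgebra.restrictScalars ℚ ℝ _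
  rw [endEquiv_mul, endEquiv_expEnd, endEquiv_expEnd, endEquiv_expEnd, map_add,
    NormedSpace.exp_add_of_commute h']

theorem expEnd_mul_expEnd_neg (A : Module.End ℝ L) : expEnd A * expEnd (-A) = 1 := by
  rw [← expEnd_add (Commute.neg_right (Commute.refl A)), add_neg_cancel, expEnd_zero]

theorem expEnd_neg_mul_expEnd (A : Module.End ℝ L) : expEnd (-A) * expEnd A = 1 := by
  rw [← expEnd_add (Commute.neg_left (Commute.refl A)), neg_add_cancel, expEnd_zero]

theorem expEnd_semiconj {A B T : Module.End ℝ L} (h : T * A = B * T) :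
    T * expEnd A = expEnd B * T := by
  apply (endEquiv L).injective
  have h' : SemiconjBy (endEquiv L T) (endEquiv L A) (endEquiv L B) := by
    rw [SemiconjBy, ← endEquiv_mul, h, endEquiv_mul]
  let _ : NormedAlgebra ℚ (L →L[ℝ] L) := NormedAlgebra.restrictScalars ℚ ℝ _
  rw [endEquiv_mul, endEquiv_mul, endEquiv_expEnd, endEquiv_expEnd]
  exact h'.exp_right

theorem expEnd_sub_mem {A : Module.End ℝ L} {W : Submodule ℝ L} (hW : ∀ w ∈ W, A w ∈ W) {v : L}
    (hv : A v ∈ W) : expEnd A v - v ∈ W := by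
  have h1 := (hasSum_nat_add_iff' 1).2 (hasSum_expEnd_apply A v)
  simp only [Finset.range_one, Finset.sum_singleton, Nat.factorial_zero, Nat.cast_one, inv_one,
    pow_zero, Module.End.one_apply, one_smul] at h1
  have h2 : ∀ n : ℕ, (A ^ (n + 1)) v ∈ W := by
    intro n
    induction n with
    | zero => simpa using hv
    | succ n ih =>
      rw [pow_succ', Module.End.mul_apply]
      exact hW _ ih
  exact (W.closed_of_finiteDimensional).mem_of_tendsto h1
    (Filter.Eventually.of_forall fun s => Submodule.sum_mem _ fun n _ => W.smul_mem _ (h2 n))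

theorem expEnd_mem {A : Module.End ℝ L} {W : Submodule ℝ L} (hW : ∀ w ∈ W, A w ∈ W) {v : L}
    (hv : v ∈ W) : expEnd A v ∈ W := by
  simpa using add_mem (expEnd_sub_mem hW (hW v hv)) hv

theorem expEnd_apply_of_sq {A : Module.End ℝ L} {v : L} (h : A (A v) = 0) :
    expEnd A v = v + A v := by
  have h1 : ∀ n ∉ Finset.range 2, (n.factorial : ℝ)⁻¹ • (A ^ n) v = 0 := by
    intro n hn
    rw [Finset.mem_range, not_lt] at hn
    obtain ⟨k, rfl⟩ := Nat.exists_eq_add_of_le' hn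
    rw [pow_add, pow_two, Module.End.mul_apply, Module.End.mul_apply, h, map_zero, smul_zero]
  have h2 := (hasSum_expEnd_apply A v).unique (hasSum_sum_of_ne_finset_zero h1)
  simpa [Finset.sum_range_succ] using h2

theorem expEnd_apply_of_eigen {A : Module.End ℝ L} {v : L} {c : ℝ} (h : A v = c • v) :
    expEnd A v = Real.exp c • v := by
  have h1 : ∀ n : ℕ, (A ^ n) v = c ^ n • v := by
    intro n
    induction n with
    | zero => simp
    | succ n ih => rw [pow_succ', Module.End.mul_apply, ih, map_smul, h, smul_smul, pow_succ]
  have h2 := hasSum_expEnd_apply A v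
  have h3 := (NormedSpace.expSeries_div_hasSum_exp c).smul_const v
  rw [← Real.exp_eq_exp_ℝ] at h3
  refine h2.unique ?_
  convert! h3 using 2 with n
  rw [h1, smul_smul, div_eq_inv_mul]

theorem hasDerivAt_expEnd_smul_apply (A : Module.End ℝ L) (v : L) (t : ℝ) :
    HasDerivAt (fun t : ℝ => expEnd (t • A) v) (expEnd (t • A) (A v)) t := by
  have h1 := hasDerivAt_exp_smul_const (𝕂 := ℝ) (endEquiv L A) t
  have h2 := (ContinuousLinearMap.apply ℝ L v).hasFDerivAt.comp_hasDerivAt t h1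
  simp only [Function.comp_def, exp_smul_endEquiv] at h2
  exact h2

theorem contDiff_expEnd_smul_apply (A : Module.End ℝ L) (v : L) :
    ContDiff ℝ ∞ (fun t : ℝ => expEnd (t • A) v) := by
  have h1 : ContDiff ℝ ∞ (NormedSpace.exp : (L →L[ℝ] L) → (L →L[ℝ] L)) :=
    AnalyticOnNhd.contDiff fun x _ => NormedSpace.exp_analytic (𝕂 := ℝ) x
  have h2 : ContDiff ℝ ∞ fun t : ℝ => NormedSpace.exp (t • endEquiv L A) :=
    h1.comp (contDiff_id.smul contDiff_const)
  have h3 := (ContinuousLinearMap.apply ℝ L v).contDiff.comp (n := ∞) h2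
  simp only [Function.comp_def, exp_smul_endEquiv] at h3
  exact h3

theorem continuous_expEnd_smul (A : Module.End ℝ L) : Continuous fun t : ℝ => expEnd (t • A) := by
  let _ : NormedAlgebra ℚ (L →L[ℝ] L) := NormedAlgebra.restrictScalars ℚ ℝ _
  have h1 : Continuous fun t : ℝ => (endEquiv L).symm (NormedSpace.exp (t • endEquiv L A)) :=
    (endEquiv L).symm.continuous.comp
      (NormedSpace.exp_continuous.comp (continuous_id.smul continuous_const))
  simpa only [exp_smul_endEquiv, ContinuousLinearEquiv.symm_apply_apply] using h1

theorem hasStrictFDerivAt_expEnd_apply (T : L →ₗ[ℝ] Module.End ℝ L) (v : L) :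
    HasStrictFDerivAt (fun x : L => expEnd (T x) v)
      (LinearMap.toContinuousLinearMap (T.flip v)) 0 := by
  let T' : L →L[ℝ] (L →L[ℝ] L) :=
    LinearMap.toContinuousLinearMap ((endEquiv L).toLinearEquiv.toLinearMap ∘ₗ T)
  have h0 : T' 0 = 0 := map_zero _
  have h1 : HasStrictFDerivAt (NormedSpace.exp : (L →L[ℝ] L) → (L →L[ℝ] L))
      (1 : (L →L[ℝ] L) →L[ℝ] (L →L[ℝ] L)) (T' 0) := by
    rw [h0]
    exact hasStrictFDerivAt_exp_zero
  have h2 := (ContinuousLinearMap.apply ℝ L v).hasStrictFDerivAt.comp 0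
    (h1.comp 0 T'.hasStrictFDerivAt)
  convert! h2 using 1
  ext x
  rw [ContinuousLinearMap.apply_apply, show T' x = endEquiv L (T x) from rfl, ← endEquiv_expEnd,
    endEquiv_apply]

/-- A bilinear map on finite-dimensional spaces, evaluated along differentiable curves. -/
theorem hasDerivAt_bilin {M : Type*} [NormedAddCommGroup M] [NormedSpace ℝ M]
    (β : L →ₗ[ℝ] L →ₗ[ℝ] M) {c d : ℝ → L} {c' d' : L} {t : ℝ}
    (hc : HasDerivAt c c' t) (hd : HasDerivAt d d' t) :
    HasDerivAt (fun t => β (c t) (d t)) (β c' (d t) + β (c t) d') t := by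
  let β' : L →L[ℝ] L →L[ℝ] M := LinearMap.toContinuousLinearMap
    ((LinearMap.toContinuousLinearMap : (L →ₗ[ℝ] M) ≃ₗ[ℝ] _).toLinearMap ∘ₗ β)
  exact (β'.hasFDerivAt.comp_hasDerivAt t hc).clm_apply hd

theorem hasDerivAt_bilin_expEnd (β : LinearMap.BilinForm ℝ L) (A A' : Module.End ℝ L) (v w : L) :
    HasDerivAt (fun t : ℝ => β (expEnd (t • A) v) (expEnd (t • A') w)) (β (A v) w + β v (A' w))
      0 := by
  have := hasDerivAt_bilin β (hasDerivAt_expEnd_smul_apply A v 0)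
    (hasDerivAt_expEnd_smul_apply A' w 0)
  simpa only [zero_smul, expEnd_zero, Module.End.one_apply] using this

/-- `exp(ad x)` is an automorphism of the Lie algebra. -/
theorem expEnd_ad_lie (x y z : L) :
    expEnd (LieAlgebra.ad ℝ L x) ⁅y, z⁆ =
      ⁅expEnd (LieAlgebra.ad ℝ L x) y, expEnd (LieAlgebra.ad ℝ L x) z⁆ := by
  set A := LieAlgebra.ad ℝ L x
  -- `exp(tA) [exp((1-t)A) y, exp((1-t)A) z]` is constant in `t`.
  have hc : ∀ (v : L) (t : ℝ), HasDerivAt (fun t : ℝ => expEnd ((1 - t) • A) v)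
      (-expEnd ((1 - t) • A) (A v)) t := by
    intro v t
    have := (hasDerivAt_expEnd_smul_apply A v (1 - t)).scomp t
      ((hasDerivAt_id t).const_sub 1)
    simpa [Function.comp_def] using this
  have hcomm : ∀ (s : ℝ) v, expEnd (s • A) (A v) = A (expEnd (s • A) v) := fun s v =>
    LinearMap.congr_fun (expEnd_semiconj (A := s • A) (B := s • A) (T := A) (by simp)).symm v
  have hl : ∀ t : ℝ, HasDerivAt
      (fun t : ℝ => (⁅expEnd ((1 - t) • A) y, expEnd ((1 - t) • A) z⁆ : L))
      (-A ⁅expEnd ((1 - t) • A) y, expEnd ((1 - t) • A) z⁆) t := by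
    intro t
    have := hasDerivAt_bilin (LieModule.toEnd ℝ L L : L →ₗ[ℝ] Module.End ℝ L) (hc y t) (hc z t)
    convert! this using 1
    simp only [hcomm, map_neg, LinearMap.neg_apply, LieHom.coe_toLinearMap,
      LieModule.toEnd_apply_apply]
    simp only [A, LieAlgebra.ad_apply, lie_lie]
    rw [leibniz_lie x, lie_lie]
    abel
  have hd : ∀ t : ℝ, HasDerivAt (fun t : ℝ => expEnd (t • A)
      ⁅expEnd ((1 - t) • A) y, expEnd ((1 - t) • A) z⁆) 0 t := by
    intro t
    have h1 := hasDerivAt_exp_smul_const (𝕂 := ℝ) (endEquiv L A) t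
    have h2 := h1.clm_apply (hl t)
    simp only [exp_smul_endEquiv, endEquiv_apply] at h2
    convert! h2 using 1
    rw [mul_apply_eq_comp, endEquiv_apply, endEquiv_apply, map_neg, add_neg_cancel]
  have := is_const_of_deriv_eq_zero (fun t => (hd t).differentiableAt) (fun t => (hd t).deriv) 1 0
  simpa [expEnd_zero] using this

end Exp

/-! ### The adjoint group -/

section Group

attribute [local instance] endTopology endTopology_isTopologicalRing glTopology
attribute [local instance] basisNorm basisNormedSpace

variable {L : Type*} [LieRing L] [LieAlgebra ℝ L]

theorem adjointGroup_subset : adjointGroup L ⊆ autGroup L := connectedComponentIn_subset _ _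

variable [FiniteDimensional ℝ L]

/-- The exponential `exp(ad x)` as an invertible linear map. -/
noncomputable def expEquiv (x : L) : L ≃ₗ[ℝ] L :=
  LinearEquiv.ofLinearMap (expEnd (LieAlgebra.ad ℝ L x)) (expEnd (-LieAlgebra.ad ℝ L x))
    (expEnd_mul_expEnd_neg _) (expEnd_neg_mul_expEnd _)

theorem expEquiv_apply (x v : L) : expEquiv x v = expEnd (LieAlgebra.ad ℝ L x) v := rfl

theorem coe_expEquiv (x : L) : (expEquiv x : Module.End ℝ L) = expEnd (LieAlgebra.ad ℝ L x) := rfl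

theorem expEquiv_zero : expEquiv (0 : L) = 1 := by
  ext v
  rw [expEquiv_apply, map_zero, expEnd_zero]
  rfl

theorem expEquiv_inv (x : L) : (expEquiv x)⁻¹ = expEquiv (-x) := by
  ext v
  rw [expEquiv_apply, map_neg]
  rfl

theorem expEquiv_neg_apply_expEquiv (x v : L) : expEquiv (-x) (expEquiv x v) = v := by
  rw [← expEquiv_inv]
  exact (expEquiv x).symm_apply_apply v

theorem expEquiv_add_of_lie_eq_zero {x y : L} (h : ⁅x, y⁆ = 0) (v : L) :
    expEquiv (x + y) v = expEquiv x (expEquiv y v) := by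
  have hc : Commute (LieAlgebra.ad ℝ L x) (LieAlgebra.ad ℝ L y) := by
    ext z
    simp only [Module.End.mul_apply, LieAlgebra.ad_apply]
    rw [leibniz_lie, h, zero_lie, zero_add]
  rw [expEquiv_apply, map_add, expEnd_add hc]
  rfl

theorem expEquiv_lie (x y z : L) : expEquiv x ⁅y, z⁆ = ⁅expEquiv x y, expEquiv x z⁆ :=
  expEnd_ad_lie x y z

theorem continuous_mul_left (g : L ≃ₗ[ℝ] L) : Continuous fun h : L ≃ₗ[ℝ] L => g * h := by
  refine continuous_induced_rng.2 ?_
  change Continuous fun h : L ≃ₗ[ℝ] L => (g : Module.End ℝ L) * (h : Module.End ℝ L)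
  exact continuous_const.mul continuous_induced_dom

theorem one_mem_adjointGroup : (1 : L ≃ₗ[ℝ] L) ∈ adjointGroup L :=
  mem_connectedComponentIn (autGroup L).one_mem

theorem mul_mem_adjointGroup {g h : L ≃ₗ[ℝ] L} (hg : g ∈ adjointGroup L)
    (hh : h ∈ adjointGroup L) : g * h ∈ adjointGroup L := by
  have h1 : IsPreconnected ((fun h : L ≃ₗ[ℝ] L => g * h) '' adjointGroup L) :=
    isPreconnected_connectedComponentIn.image _ (continuous_mul_left g).continuousOn
  have h2 : (fun h : L ≃ₗ[ℝ] L => g * h) '' adjointGroup L ⊆ autGroup L := by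
    rintro _ ⟨k, hk, rfl⟩
    exact (autGroup L).mul_mem (adjointGroup_subset hg) (adjointGroup_subset hk)
  have h3 := h1.subset_connectedComponentIn (x := g) ⟨1, one_mem_adjointGroup, mul_one g⟩ h2
  rw [← connectedComponentIn_eq hg] at h3
  exact h3 ⟨h, hh, rfl⟩

theorem inv_mem_adjointGroup {g : L ≃ₗ[ℝ] L} (hg : g ∈ adjointGroup L) :
    g⁻¹ ∈ adjointGroup L := by
  have h1 : IsPreconnected ((fun h : L ≃ₗ[ℝ] L => g⁻¹ * h) '' adjointGroup L) :=
    isPreconnected_connectedComponentIn.image _ (continuous_mul_left _).continuousOn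
  have h2 : (fun h : L ≃ₗ[ℝ] L => g⁻¹ * h) '' adjointGroup L ⊆ autGroup L := by
    rintro _ ⟨k, hk, rfl⟩
    exact (autGroup L).mul_mem ((autGroup L).inv_mem (adjointGroup_subset hg))
      (adjointGroup_subset hk)
  have h3 := h1.subset_connectedComponentIn (x := 1) ⟨g, hg, inv_mul_cancel g⟩ h2
  exact h3 ⟨1, one_mem_adjointGroup, mul_one _⟩

theorem expEquiv_mem (x : L) : expEquiv x ∈ adjointGroup L := by
  have h0 : Continuous fun t : ℝ => expEquiv (t • x) := by
    refine continuous_induced_rng.2 ?_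
    have := continuous_expEnd_smul (LieAlgebra.ad ℝ L x)
    simpa only [Function.comp_def, coe_expEquiv, map_smul] using this
  have h1 : IsPreconnected (Set.range fun t : ℝ => expEquiv (t • x)) := isPreconnected_range h0
  have h2 : Set.range (fun t : ℝ => expEquiv (t • x)) ⊆ autGroup L := by
    rintro _ ⟨t, rfl⟩
    exact fun y z => expEquiv_lie _ y z
  have h3 := h1.subset_connectedComponentIn (x := 1) ⟨0, by simp [expEquiv_zero]⟩ h2
  exact h3 ⟨1, by simp⟩

theorem apply_expEquiv {g : L ≃ₗ[ℝ] L} (hg : g ∈ autGroup L) (x v : L) :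
    g (expEquiv x v) = expEquiv (g x) (g v) := by
  refine LinearMap.congr_fun (expEnd_semiconj (T := (g : Module.End ℝ L))
    (A := LieAlgebra.ad ℝ L x) (B := LieAlgebra.ad ℝ L (g x)) ?_) v
  ext y
  exact hg x y

theorem killingForm_autGroup {g : L ≃ₗ[ℝ] L} (hg : g ∈ autGroup L) (x y : L) :
    killingForm ℝ L (g x) (g y) = killingForm ℝ L x y :=
  LieAlgebra.killingForm_of_equiv_apply
    (e := { g with map_lie' := fun {x y} => hg x y : L ≃ₗ⁅ℝ⁆ L}) x y

theorem expEquiv_of_lie_eq_smul {x v : L} {c : ℝ} (h : ⁅x, v⁆ = c • v) :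
    expEquiv x v = Real.exp c • v :=
  expEnd_apply_of_eigen h

theorem expEquiv_of_lie_eq_zero {x v : L} (h : ⁅x, v⁆ = 0) : expEquiv x v = v := by
  have := expEquiv_of_lie_eq_smul (x := x) (v := v) (c := 0) (by rw [h, zero_smul])
  rwa [Real.exp_zero, one_smul] at this

theorem expEquiv_of_lie_lie_eq_zero {x v : L} (h : ⁅x, ⁅x, v⁆⁆ = 0) :
    expEquiv x v = v + ⁅x, v⁆ :=
  expEnd_apply_of_sq h

end Group

/-! ### Diagonalization of symmetric operators -/

section Diagonal

variable {V : Type*} [AddCommGroup V] [Module ℝ V]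

/-- An operator which is symmetric for a positive definite form is diagonalizable. -/
theorem iSup_eigenspace_eq_top_of_symm [FiniteDimensional ℝ V] {β : LinearMap.BilinForm ℝ V}
    (hs : ∀ x y, β x y = β y x) (hp : ∀ x, x ≠ 0 → 0 < β x x) {T : Module.End ℝ V}
    (hT : ∀ x y, β (T x) y = β x (T y)) : ⨆ c, T.eigenspace c = ⊤ := by
  let core : InnerProductSpace.Core ℝ V :=
    { inner := fun x y => β x y
      conj_inner_symm := fun x y => hs y x
      re_inner_nonneg := fun x => by
        by_cases hx : x = 0
        · simp [hx]
        · exact (hp x hx).le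
      add_left := fun x y z => by simp
      smul_left := fun x y r => by simp
      definite := fun x hx => by
        by_contra h
        exact (hp x h).ne' hx }
  let _ : NormedAddCommGroup V := core.toNormedAddCommGroup
  let _ : InnerProductSpace ℝ V := InnerProductSpace.ofCore core.toCore
  have hsym : T.IsSymmetric := hT
  have := hsym.orthogonalComplement_iSup_eigenspaces_eq_bot
  rwa [Submodule.orthogonal_eq_bot_iff] at this

theorem eq_zero_of_eq_neg {v : V} (h : v = -v) : v = 0 := by
  have h1 : (2 : ℝ) • v = 0 := by rw [two_smul, add_eq_zero_iff_eq_neg, ← h]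
  exact (smul_eq_zero.1 h1).resolve_left two_ne_zero

theorem bilin_sum_sum_of_orthogonal (β : LinearMap.BilinForm ℝ V) (s : Finset ℝ) (f g : ℝ → V)
    (h : ∀ a b, a ≠ b → β (f a) (g b) = 0) :
    β (∑ a ∈ s, f a) (∑ b ∈ s, g b) = ∑ a ∈ s, β (f a) (g a) := by
  rw [LinearMap.BilinForm.sum_left]
  refine Finset.sum_congr rfl fun a ha => ?_
  rw [LinearMap.BilinForm.sum_right]
  exact Finset.sum_eq_single_of_mem a ha fun b _ hb => h a b hb.symm

theorem exists_eq_sum_of_mem_iSup {ι : Type*} {p : ι → Submodule ℝ V} {x : V}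
    (hx : x ∈ ⨆ i, p i) : ∃ (s : Finset ι) (f : ι → V), (∀ i, f i ∈ p i) ∧ x = ∑ i ∈ s, f i := by
  obtain ⟨f, hf, rfl⟩ := (Submodule.mem_iSup_iff_exists_finsupp p x).1 hx
  exact ⟨f.support, f, hf, rfl⟩

end Diagonal

/-! ### Invariant forms and the inner product -/

section Cartan

attribute [local instance] basisNorm basisNormedSpace

variable {L : Type*} [LieRing L] [LieAlgebra ℝ L]
  {θ : L ≃ₗ⁅ℝ⁆ L} {B : LinearMap.BilinForm ℝ L}

/-- The inner product `(x, y) = -B(x, θ y)` as a bilinear form. -/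
def ipForm (θ : L ≃ₗ⁅ℝ⁆ L) (B : LinearMap.BilinForm ℝ L) : LinearMap.BilinForm ℝ L :=
  -(B.compl₂ (θ.toLinearEquiv : L →ₗ[ℝ] L))

@[simp] theorem ipForm_apply (x y : L) : ipForm θ B x y = ip θ B x y := rfl

theorem ip_comm (hθ : ∀ x, θ (θ x) = x) (hB : IsLooseKillingForm θ B) (x y : L) :
    ip θ B x y = ip θ B y x := by
  rw [ip, ip, ← hB.theta_invariant, hθ, hB.symm]

theorem ip_theta (hB : IsLooseKillingForm θ B) (x y : L) :
    ip θ B (θ x) (θ y) = ip θ B x y := by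
  rw [ip, ip, hB.theta_invariant]

theorem IsCartanInvolution.isKilling (hθ : IsCartanInvolution θ) : LieAlgebra.IsKilling ℝ L := by
  refine ⟨(LieSubmodule.eq_bot_iff _).2 fun x hx => ?_⟩
  by_contra h
  have h1 := hθ.pos x h
  rw [LieIdeal.mem_killingCompl] at hx
  have h2 := hx (θ x) trivial
  rw [killingForm_comm] at h2
  linarith

variable [FiniteDimensional ℝ L]

theorem IsLooseKillingForm.lie (hB : IsLooseKillingForm θ B) (x y z : L) :
    B ⁅x, y⁆ z = -B y ⁅x, z⁆ := by
  have h1 := hasDerivAt_bilin_expEnd B (LieAlgebra.ad ℝ L x) (LieAlgebra.ad ℝ L x) y z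
  have h2 : (fun t : ℝ => B (expEnd (t • LieAlgebra.ad ℝ L x) y)
      (expEnd (t • LieAlgebra.ad ℝ L x) z)) = fun _ => B y z := by
    funext t
    rw [← map_smul]
    exact hB.invariant _ (expEquiv_mem (t • x)) y z
  rw [h2] at h1
  exact eq_neg_of_add_eq_zero_left (h1.unique (hasDerivAt_const 0 _))

theorem ip_lie_left (hθ : ∀ x, θ (θ x) = x) (hB : IsLooseKillingForm θ B) (x y z : L) :
    ip θ B ⁅x, y⁆ z = -ip θ B y ⁅θ x, z⁆ := by
  rw [ip, ip, hB.lie, LieEquiv.map_lie, hθ]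

/-- `ad x` is symmetric for `x` in the `(-1)`-eigenspace of `θ`. -/
theorem ip_lie_symm (hθ : ∀ x, θ (θ x) = x) (hB : IsLooseKillingForm θ B) {x : L}
    (hx : θ x = -x) (y z : L) : ip θ B ⁅x, y⁆ z = ip θ B y ⁅x, z⁆ := by
  rw [ip_lie_left hθ hB, hx, neg_lie, ip, ip, map_neg, map_neg, neg_neg]

theorem IsCartanInvolution.isLooseKillingForm (hθ : IsCartanInvolution θ) :
    IsLooseKillingForm θ (killingForm ℝ L) where
  symm := killingForm_comm
  invariant g hg x y := killingForm_autGroup (adjointGroup_subset hg) x y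
  theta_invariant x y := LieAlgebra.killingForm_of_equiv_apply θ x y
  neg x hx hx0 := by
    have := hθ.pos x hx0
    rw [hx] at this
    linarith

/-- The form `ip θ B` is positive definite. On the `(+1)`-eigenspace of `θ` this is assumed; on the
`(-1)`-eigenspace it holds because an eigenspace of the operator representing `B` with nonpositive
eigenvalue would be an abelian ideal. -/
theorem ip_pos (hθ : IsCartanInvolution θ) (hB : IsLooseKillingForm θ B) {x : L} (hx : x ≠ 0) :
    0 < ip θ B x x := by
  have hkill := hθ.isKilling
  have hκ := hθ.isLooseKillingForm
  have hnd := LieAlgebra.IsKilling.killingForm_nondegenerate ℝ L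
  -- `B` is represented by an operator `T` commuting with `L` and with `θ`.
  let T : Module.End ℝ L := ((killingForm ℝ L).toDual hnd).symm.toLinearMap ∘ₗ B
  have hT : ∀ x y, killingForm ℝ L (T x) y = B x y := fun x y =>
    LinearMap.BilinForm.apply_toDual_symm_apply (hB := hnd) (B x) y
  have hext : ∀ x y, (∀ z, killingForm ℝ L x z = killingForm ℝ L y z) → x = y := by
    intro x y h
    rw [← sub_eq_zero]
    refine hnd.1 _ fun z => ?_
    rw [map_sub, LinearMap.sub_apply, h, sub_self]
  have hTlie : ∀ x y : L, T ⁅x, y⁆ = ⁅x, T y⁆ := by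
    intro x y
    refine hext _ _ fun z => ?_
    rw [hT, hB.lie, killingForm_lie, hT]
  have hTθ : ∀ x, T (θ x) = θ (T x) := by
    intro x
    refine hext _ _ fun z => ?_
    rw [hT, ← hB.theta_invariant, hθ.involutive, ← hT, ← hκ.theta_invariant, hθ.involutive]
  have hsymm : ∀ x y, ipForm θ (killingForm ℝ L) (T x) y = ipForm θ (killingForm ℝ L) x (T y) := by
    intro x y
    rw [ipForm_apply, ipForm_apply, ip_comm hθ.involutive hκ x, ip, ip, hT, hT,
      ← hB.theta_invariant, hθ.involutive, hB.symm]
  have hdiag := iSup_eigenspace_eq_top_of_symm (β := ipForm θ (killingForm ℝ L))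
    (ip_comm hθ.involutive hκ) (fun x hx => hθ.pos x hx) hsymm
  -- A nonpositive eigenvalue would give an ideal on which `θ = -1`, hence an abelian one.
  have hpos : ∀ c : ℝ, c ≤ 0 → ∀ x, T x = c • x → x = 0 := by
    intro c hc
    have hI : ∀ x, T x = c • x → θ x = -x := by
      intro x hx
      have h1 : T (x + θ x) = c • (x + θ x) := by
        rw [map_add, hTθ, hx, map_smul, smul_add]
      have h2 : θ (x + θ x) = x + θ x := by rw [map_add, hθ.involutive, add_comm]
      by_contra h
      have h3 : x + θ x ≠ 0 := fun h0 => h (eq_neg_of_add_eq_zero_right h0)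
      have h4 := hB.neg _ h2 h3
      have h5 := hκ.neg _ h2 h3
      rw [← hT, h1, map_smul, LinearMap.smul_apply, smul_eq_mul] at h4
      nlinarith
    have hlie : ∀ x y : L, T x = c • x → T ⁅y, x⁆ = c • ⁅y, x⁆ := by
      intro x y hx
      rw [hTlie, hx, lie_smul]
    have habel : ∀ x y : L, T x = c • x → T y = c • y → ⁅x, y⁆ = 0 := by
      intro x y hx hy
      have h1 := hI _ (hlie y x hy)
      rw [LieEquiv.map_lie, hI x hx, hI y hy, neg_lie, lie_neg, neg_neg] at h1
      exact eq_zero_of_eq_neg h1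
    intro x hx
    by_contra h
    have h1 := hθ.pos x h
    rw [hI x hx, map_neg, neg_neg, killingForm_apply_apply] at h1
    have h2 : LieAlgebra.ad ℝ L x ∘ₗ LieAlgebra.ad ℝ L x = 0 := by
      ext y
      refine habel x ⁅x, y⁆ hx ?_
      rw [← lie_skew, map_neg, hlie x y hx, smul_neg]
    rw [h2, map_zero] at h1
    exact lt_irrefl _ h1
  obtain ⟨s, f, hf, hxs⟩ := exists_eq_sum_of_mem_iSup (hdiag ▸ Submodule.mem_top : x ∈ _)
  simp only [Module.End.mem_eigenspace_iff] at hf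
  have horth : ∀ a b, a ≠ b → ipForm θ B (f a) (f b) = 0 := by
    intro a b hab
    have h1 := hsymm (f a) (f b)
    rw [hf, hf, map_smul, map_smul, LinearMap.smul_apply, smul_eq_mul, smul_eq_mul,
      ← sub_eq_zero, ← sub_mul, mul_eq_zero] at h1
    have h2 := h1.resolve_left (sub_ne_zero.2 hab)
    rw [ipForm_apply, ip] at h2 ⊢
    rw [← hT, hf, map_smul, LinearMap.smul_apply, smul_eq_mul, ← mul_neg, h2, mul_zero]
  have hterm : ∀ a, 0 ≤ ipForm θ B (f a) (f a) ∧ (f a ≠ 0 → 0 < ipForm θ B (f a) (f a)) := by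
    intro a
    by_cases hfa : f a = 0
    · simp [hfa]
    · have ha : 0 < a := by
        by_contra h
        exact hfa (hpos a (not_lt.1 h) _ (hf a))
      have h1 : 0 < ipForm θ B (f a) (f a) := by
        rw [ipForm_apply, ip, ← hT, hf, map_smul, LinearMap.smul_apply, smul_eq_mul, ← mul_neg]
        exact mul_pos ha (hθ.pos _ hfa)
      exact ⟨h1.le, fun _ => h1⟩
  rw [← ipForm_apply, hxs, bilin_sum_sum_of_orthogonal _ _ _ _ horth]
  obtain ⟨a, ha, hfa⟩ : ∃ a ∈ s, f a ≠ 0 := by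
    by_contra! h
    exact hx (by rw [hxs, Finset.sum_eq_zero h])
  exact Finset.sum_pos' (fun a _ => (hterm a).1) ⟨a, ha, (hterm a).2 hfa⟩

theorem ip_self_nonneg (hθ : IsCartanInvolution θ) (hB : IsLooseKillingForm θ B) (x : L) :
    0 ≤ ip θ B x x := by
  by_cases hx : x = 0
  · simp [hx, ip]
  · exact (ip_pos hθ hB hx).le

theorem ip_self_eq_zero (hθ : IsCartanInvolution θ) (hB : IsLooseKillingForm θ B) {x : L}
    (h : ip θ B x x = 0) : x = 0 := by
  by_contra hx
  exact (ip_pos hθ hB hx).ne' h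

end Cartan

/-! ### The maximal compact subgroup -/

section Compact

attribute [local instance] endTopology endTopology_isTopologicalRing glTopology
attribute [local instance] basisNorm basisNormedSpace

variable {L : Type*} [LieRing L] [LieAlgebra ℝ L] [FiniteDimensional ℝ L]
  {θ : L ≃ₗ⁅ℝ⁆ L} {B : LinearMap.BilinForm ℝ L}

theorem continuous_bilin {M : Type*} [NormedAddCommGroup M] [NormedSpace ℝ M]
    (β : L →ₗ[ℝ] L →ₗ[ℝ] M) : Continuous fun p : L × L => β p.1 p.2 := by
  let β' : L →L[ℝ] L →L[ℝ] M := LinearMap.toContinuousLinearMap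
    ((LinearMap.toContinuousLinearMap : (L →ₗ[ℝ] M) ≃ₗ[ℝ] _).toLinearMap ∘ₗ β)
  exact (β'.continuous.comp continuous_fst).clm_apply continuous_snd

theorem continuous_lie' : Continuous fun p : L × L => ⁅p.1, p.2⁆ :=
  continuous_bilin (LieModule.toEnd ℝ L L : L →ₗ[ℝ] Module.End ℝ L)

theorem continuous_theta (θ : L ≃ₗ⁅ℝ⁆ L) : Continuous θ :=
  LinearMap.continuous_of_finiteDimensional (θ.toLinearEquiv : L →ₗ[ℝ] L)

theorem continuous_ip : Continuous fun p : L × L => ip θ B p.1 p.2 :=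
  continuous_bilin (ipForm θ B)

/-- The inner product controls the norm. -/
theorem exists_norm_sq_le_ip (hθ : IsCartanInvolution θ) (hB : IsLooseKillingForm θ B) :
    ∃ c : ℝ, 0 < c ∧ ∀ v, c * ‖v‖ ^ 2 ≤ ip θ B v v := by
  have : ProperSpace L := FiniteDimensional.proper ℝ L
  have hcont : Continuous fun v : L => ip θ B v v :=
    continuous_ip.comp (continuous_id.prodMk continuous_id)
  obtain hne | hne := (Metric.sphere (0 : L) 1).eq_empty_or_nonempty
  · refine ⟨1, one_pos, fun v => ?_⟩
    have hv : v = 0 := by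
      by_contra hv
      have : ‖v‖⁻¹ • v ∈ Metric.sphere (0 : L) 1 := by
        rw [mem_sphere_zero_iff_norm, norm_smul, norm_inv, norm_norm,
          inv_mul_cancel₀ (norm_ne_zero_iff.2 hv)]
      rw [hne] at this
      exact this
    simp [hv, ip]
  · obtain ⟨u, hu, hmin⟩ := (isCompact_sphere (0 : L) 1).exists_isMinOn hne hcont.continuousOn
    have hu0 : u ≠ 0 := by
      rintro rfl
      simp at hu
    refine ⟨ip θ B u u, ip_pos hθ hB hu0, fun v => ?_⟩
    by_cases hv : v = 0
    · simp [hv, ip]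
    · have h1 : ‖v‖⁻¹ • v ∈ Metric.sphere (0 : L) 1 := by
        rw [mem_sphere_zero_iff_norm, norm_smul, norm_inv, norm_norm,
          inv_mul_cancel₀ (norm_ne_zero_iff.2 hv)]
      have h2 := hmin h1
      have h3 : ip θ B (‖v‖⁻¹ • v) (‖v‖⁻¹ • v) = (‖v‖ ^ 2)⁻¹ * ip θ B v v := by
        rw [← ipForm_apply, ← ipForm_apply, map_smul, map_smul, LinearMap.smul_apply, smul_eq_mul,
          smul_eq_mul, ← mul_assoc, sq, mul_inv]
      have h4 : 0 < ‖v‖ ^ 2 := by positivity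
      simp only [Set.mem_ofPred_eq, h3] at h2
      rwa [inv_mul_eq_div, le_div_iff₀ h4] at h2

theorem exists_ip_le_norm_sq : ∃ C : ℝ, ∀ v, ip θ B v v ≤ C * ‖v‖ ^ 2 := by
  let β' : L →L[ℝ] L →L[ℝ] ℝ := LinearMap.toContinuousLinearMap
    ((LinearMap.toContinuousLinearMap : (L →ₗ[ℝ] ℝ) ≃ₗ[ℝ] _).toLinearMap ∘ₗ ipForm θ B)
  refine ⟨‖β'‖, fun v => ?_⟩
  have := (Real.le_norm_self _).trans (β'.le_opNorm₂ v v)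
  rwa [mul_assoc, ← sq] at this

theorem isCompact_autGroup_commuting (hθ : IsCartanInvolution θ) :
    IsCompact {g : L ≃ₗ[ℝ] L | g ∈ autGroup L ∧ ∀ x, g (θ x) = θ (g x)} := by
  have hκ := hθ.isLooseKillingForm
  have hind : Topology.IsInducing (fun g : L ≃ₗ[ℝ] L => (g : Module.End ℝ L)) := ⟨rfl⟩
  rw [hind.isCompact_iff, ← (endEquiv L).toHomeomorph.isCompact_image, Set.image_image]
  have himage : (fun g : L ≃ₗ[ℝ] L => (endEquiv L).toHomeomorph (g : Module.End ℝ L)) ''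
      {g : L ≃ₗ[ℝ] L | g ∈ autGroup L ∧ ∀ x, g (θ x) = θ (g x)} =
      {A : L →L[ℝ] L | (∀ x y, A ⁅x, y⁆ = ⁅A x, A y⁆) ∧ (∀ x, A (θ x) = θ (A x)) ∧
        ∀ x y, ip θ (killingForm ℝ L) (A x) (A y) = ip θ (killingForm ℝ L) x y} := by
    ext A
    constructor
    · rintro ⟨g, ⟨hg, hgθ⟩, rfl⟩
      refine ⟨hg, hgθ, fun x y => ?_⟩
      change -(killingForm ℝ L (g x) (θ (g y))) = _
      rw [← hgθ, killingForm_autGroup hg]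
      rfl
    · rintro ⟨hlie, hAθ, hip⟩
      have hinj : Function.Injective (A : L →ₗ[ℝ] L) := by
        rw [← LinearMap.ker_eq_bot, LinearMap.ker_eq_bot']
        intro x hx
        refine ip_self_eq_zero hθ hκ ?_
        rw [← hip, show A x = 0 from hx]
        simp [ip]
      refine ⟨LinearEquiv.ofInjectiveEndo (A : L →ₗ[ℝ] L) hinj, ⟨hlie, hAθ⟩, ?_⟩
      ext x
      rfl
  rw [himage]
  have : ProperSpace (L →L[ℝ] L) := FiniteDimensional.proper ℝ _
  have hev : ∀ x : L, Continuous fun A : L →L[ℝ] L => A x := fun x =>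
    (ContinuousLinearMap.apply ℝ L x).continuous
  refine Metric.isCompact_of_isClosed_isBounded ?_ ?_
  · simp only [Set.ofPred_and, Set.ofPred_forall]
    refine IsClosed.inter ?_ (IsClosed.inter ?_ ?_)
    · exact isClosed_iInter fun x => isClosed_iInter fun y =>
        isClosed_eq (hev _) (continuous_lie'.comp ((hev x).prodMk (hev y)))
    · exact isClosed_iInter fun x => isClosed_eq (hev _) ((continuous_theta θ).comp (hev x))
    · exact isClosed_iInter fun x => isClosed_iInter fun y =>
        isClosed_eq (continuous_ip.comp ((hev x).prodMk (hev y))) continuous_const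
  · obtain ⟨c, hc, hcle⟩ := exists_norm_sq_le_ip hθ hκ
    obtain ⟨C, hCle⟩ := exists_ip_le_norm_sq (θ := θ) (B := killingForm ℝ L)
    refine (Metric.isBounded_closedBall (x := (0 : L →L[ℝ] L)) (r := √(C / c))).subset ?_
    rintro A ⟨-, -, hip⟩
    rw [mem_closedBall_zero_iff]
    refine A.opNorm_le_bound (Real.sqrt_nonneg _) fun v => ?_
    have h1 : ‖A v‖ ^ 2 ≤ C / c * ‖v‖ ^ 2 := by
      have h2 := hcle (A v)
      rw [hip] at h2
      have h3 := h2.trans (hCle v)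
      rw [div_mul_eq_mul_div, le_div_iff₀ hc, mul_comm]
      exact h3
    rw [← Real.sqrt_sq (norm_nonneg (A v)), ← Real.sqrt_sq (norm_nonneg v),
      ← Real.sqrt_mul' _ (sq_nonneg _)]
    exact Real.sqrt_le_sqrt (by simpa using h1)

/-- The elements of `G_ℝ` commuting with `θ`. -/
def thetaFixer (θ : L ≃ₗ⁅ℝ⁆ L) : Subgroup (L ≃ₗ[ℝ] L) where
  carrier := {g | g ∈ adjointGroup L ∧ ∀ x, g (θ x) = θ (g x)}
  mul_mem' {g h} hg hh := ⟨mul_mem_adjointGroup hg.1 hh.1, fun x => by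
    rw [LinearEquiv.mul_apply, LinearEquiv.mul_apply, hh.2, hg.2]⟩
  one_mem' := ⟨one_mem_adjointGroup, fun _ => rfl⟩
  inv_mem' {g} hg := ⟨inv_mem_adjointGroup hg.1, fun x => by
    apply g.injective
    rw [hg.2]
    change g (g.symm (θ x)) = θ (g (g.symm x))
    simp⟩

theorem isCompact_thetaFixer (hθ : IsCartanInvolution θ) :
    IsCompact (thetaFixer θ : Set (L ≃ₗ[ℝ] L)) := by
  obtain ⟨C, hC, hCeq⟩ := isClosed_induced_iff.1
    (isClosed_connectedComponent
      (x := (⟨1, (autGroup L).one_mem⟩ : (autGroup L : Set (L ≃ₗ[ℝ] L)))))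
  have h1 := (isCompact_autGroup_commuting hθ).inter_right hC
  convert h1 using 1
  have h2 : adjointGroup L = {g | g ∈ autGroup L ∧ g ∈ C} := by
    rw [adjointGroup, connectedComponentIn_eq_image (autGroup L).one_mem, ← hCeq]
    ext g
    simp
    tauto
  ext g
  change (g ∈ adjointGroup L ∧ _) ↔ _
  rw [h2]
  simp only [Set.mem_ofPred_eq, Set.mem_inter_iff]
  tauto

/-- The maximal compact subgroup with Lie algebra the fixed points of `θ` is the centralizer of
`θ` in `G_ℝ`. -/
theorem eq_thetaFixer (hθ : IsCartanInvolution θ) {K : Subgroup (L ≃ₗ[ℝ] L)}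
    (hK : IsMaximalCompact K) (hKθ : lieAlgebraOf K = {x : L | θ x = x}) : K = thetaFixer θ := by
  have hκ := hθ.isLooseKillingForm
  refine (hK.maximal (thetaFixer θ) (fun g hg => hg.1) (isCompact_thetaFixer hθ) ?_).symm
  -- An element of `K` normalizes `lieAlgebraOf K`, hence preserves both eigenspaces of `θ`.
  have hfix : ∀ k ∈ K, ∀ x, θ x = x → θ (k x) = k x := by
    intro k hk x hx
    have hx' : x ∈ lieAlgebraOf K := by rw [hKθ]; exact hx
    have : k x ∈ lieAlgebraOf K := by
      intro t
      obtain ⟨k', hk', hk'x⟩ := hx' t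
      refine ⟨k * k' * k⁻¹, K.mul_mem (K.mul_mem hk hk') (K.inv_mem hk), ?_⟩
      ext v
      have h1 : k' (k.symm v) = expEquiv (t • x) (k.symm v) := LinearMap.congr_fun hk'x _
      change k (k' (k.symm v)) = expEquiv (t • k x) v
      rw [h1, apply_expEquiv (adjointGroup_subset (hK.le hk)), map_smul,
        LinearEquiv.apply_symm_apply]
    rw [hKθ] at this
    exact this
  have hanti : ∀ k ∈ K, ∀ x, θ x = -x → θ (k x) = -k x := by
    intro k hk x hx
    have haut := adjointGroup_subset (hK.le hk)
    have horth : ∀ y, θ y = y → ip θ (killingForm ℝ L) (k x) y = 0 := by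
      intro y hy
      have h1 := hfix _ (K.inv_mem hk) y hy
      set z := k⁻¹ y
      have h2 : k z = y := k.apply_symm_apply y
      have h3 : ip θ (killingForm ℝ L) (k x) y = ip θ (killingForm ℝ L) x z := by
        rw [ip, ip, hy, h1, ← h2, killingForm_autGroup haut]
      have h4 := ip_theta hκ x z
      rw [hx, h1] at h4
      rw [h3]
      have h5 : ip θ (killingForm ℝ L) (-x) z = -ip θ (killingForm ℝ L) x z := by simp [ip]
      exact eq_zero_of_eq_neg (h4.symm.trans h5)
    have h1 : θ (k x + θ (k x)) = k x + θ (k x) := by rw [map_add, hθ.involutive, add_comm]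
    have h2 := horth _ h1
    have h3 : ip θ (killingForm ℝ L) (θ (k x)) (k x + θ (k x)) = 0 := by
      rw [← h1, ip_theta hκ, h2]
    have h4 : k x + θ (k x) = 0 := by
      refine ip_self_eq_zero hθ hκ ?_
      rw [← ipForm_apply] at h2 h3 ⊢
      rw [LinearMap.map_add₂, h2, h3, add_zero]
    exact eq_neg_of_add_eq_zero_right h4
  intro k hk
  refine ⟨hK.le hk, fun x => ?_⟩
  have h1 := hfix k hk (x + θ x) (by rw [map_add, hθ.involutive, add_comm])
  have h2 := hanti k hk (x - θ x) (by rw [map_sub, hθ.involutive, neg_sub])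
  simp only [map_add, map_sub] at h1 h2
  have h3 : (2 : ℝ) • (θ (k x) - k (θ x)) = 0 := by
    linear_combination (norm := module) (1 : ℝ) • h1 + (1 : ℝ) • h2
  rw [smul_eq_zero, sub_eq_zero] at h3
  exact (h3.resolve_left two_ne_zero).symm

end Compact

/-! ### Eigenspace gradings and filtrations -/

section Weights

variable {L : Type*} [LieRing L] [LieAlgebra ℝ L]

/-- The eigenspace of `ad h` for the real eigenvalue `s`. -/
def weightSpace (h : L) (s : ℝ) : Submodule ℝ L := (LieAlgebra.ad ℝ L h).eigenspace s

theorem mem_weightSpace {h v : L} {s : ℝ} : v ∈ weightSpace h s ↔ ⁅h, v⁆ = s • v :=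
  Module.End.mem_eigenspace_iff

/-- The sum of the eigenspaces of `ad h` for eigenvalues in `S`. With `S = Set.Ici s` these form
the filtration attached to `h`. -/
def weightSup (h : L) (S : Set ℝ) : Submodule ℝ L := ⨆ s ∈ S, weightSpace h s

theorem weightSpace_le_weightSup (h : L) {S : Set ℝ} {s : ℝ} (hs : s ∈ S) :
    weightSpace h s ≤ weightSup h S :=
  le_iSup₂ (f := fun s (_ : s ∈ S) => weightSpace h s) s hs

theorem weightSup_le {h : L} {S : Set ℝ} {W : Submodule ℝ L} (hW : ∀ s ∈ S, weightSpace h s ≤ W) :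
    weightSup h S ≤ W :=
  iSup₂_le hW

theorem weightSup_mono (h : L) {S T : Set ℝ} (hST : S ⊆ T) : weightSup h S ≤ weightSup h T :=
  weightSup_le fun _ hs => weightSpace_le_weightSup h (hST hs)

theorem weightSup_Ici_eq (h : L) (s : ℝ) :
    weightSup h (Set.Ici s) = weightSpace h s ⊔ weightSup h (Set.Ioi s) := by
  refine le_antisymm (weightSup_le fun t ht => ?_)
    (sup_le (weightSpace_le_weightSup h Set.self_mem_Ici)
      (weightSup_mono h Set.Ioi_subset_Ici_self))
  obtain rfl | hst := (Set.mem_Ici.1 ht).eq_or_lt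
  · exact le_sup_left
  · exact (weightSpace_le_weightSup h hst).trans le_sup_right

theorem lie_mem_weightSup {h : L} {S T U : Set ℝ} (hU : ∀ s ∈ S, ∀ t ∈ T, s + t ∈ U) {x y : L}
    (hx : x ∈ weightSup h S) (hy : y ∈ weightSup h T) : ⁅x, y⁆ ∈ weightSup h U := by
  have h1 : ∀ s ∈ S, ∀ x ∈ weightSpace h s, ∀ y ∈ weightSup h T, ⁅x, y⁆ ∈ weightSup h U := by
    intro s hs x hx y hy
    have : weightSup h T ≤ (weightSup h U).comap (LieAlgebra.ad ℝ L x) := by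
      refine weightSup_le fun t ht y hy => ?_
      refine weightSpace_le_weightSup h (hU s hs t ht) ?_
      rw [mem_weightSpace] at hx hy ⊢
      rw [LieAlgebra.ad_apply, leibniz_lie, hx, hy, smul_lie, lie_smul, add_smul]
    exact this hy
  have h2 : weightSup h S ≤ (weightSup h U).comap (LieAlgebra.ad ℝ L y) := by
    refine weightSup_le fun s hs x hx => ?_
    rw [Submodule.mem_comap, LieAlgebra.ad_apply, ← lie_skew]
    exact neg_mem (h1 s hs x hx y hy)
  rw [← lie_skew]
  exact neg_mem (h2 hx)

theorem iSup_weightSpace_map {g : L ≃ₗ[ℝ] L} (hg : g ∈ autGroup L) {h : L}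
    (hh : ⨆ s, weightSpace h s = ⊤) : ⨆ s, weightSpace (g h) s = ⊤ := by
  refine eq_top_iff.2 fun x _ => ?_
  have h1 : ⨆ s, weightSpace h s ≤ (⨆ s, weightSpace (g h) s).comap (g : L →ₗ[ℝ] L) := by
    refine iSup_le fun s y hy => Submodule.mem_iSup_of_mem s ?_
    rw [mem_weightSpace] at hy ⊢
    change ⁅g h, g y⁆ = _
    rw [← hg h y, hy, map_smul]
    rfl
  rw [hh] at h1
  have h2 := h1 (x := g.symm x) Submodule.mem_top
  rwa [Submodule.mem_comap, LinearEquiv.coe_coe, g.apply_symm_apply] at h2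

theorem weightSpace_inf_weightSup_Ioi (h : L) {s : ℝ} {x : L} (hx : x ∈ weightSpace h s)
    (hx' : x ∈ weightSup h (Set.Ioi s)) : x = 0 := by
  have h1 := (LieAlgebra.ad ℝ L h).eigenspaces_iSupIndep s
  refine Submodule.disjoint_def.1 h1 x hx ?_
  have : weightSup h (Set.Ioi s) ≤ ⨆ j, ⨆ (_ : j ≠ s), (LieAlgebra.ad ℝ L h).eigenspace j :=
    weightSup_le fun t ht => le_iSup₂ (f := fun j (_ : j ≠ s) => (LieAlgebra.ad ℝ L h).eigenspace j)
      t (Set.mem_Ioi.1 ht).ne'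
  exact this hx'

theorem killingForm_weightSpace {h x y : L} {s t : ℝ} (hx : x ∈ weightSpace h s)
    (hy : y ∈ weightSpace h t) (hst : s + t ≠ 0) : killingForm ℝ L x y = 0 := by
  rw [mem_weightSpace] at hx hy
  have h1 := killingForm_lie h x y
  rw [hx, hy, map_smul, map_smul, LinearMap.smul_apply, smul_eq_mul, smul_eq_mul] at h1
  have h2 : (s + t) * killingForm ℝ L x y = 0 := by linear_combination h1
  exact (mul_eq_zero.1 h2).resolve_left hst

theorem killingForm_weightSup {h x y : L} {S T : Set ℝ} (hST : ∀ s ∈ S, ∀ t ∈ T, s + t ≠ 0)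
    (hx : x ∈ weightSup h S) (hy : y ∈ weightSup h T) : killingForm ℝ L x y = 0 := by
  have h1 : weightSup h S ≤ LinearMap.ker ((killingForm ℝ L).flip y) := by
    refine weightSup_le fun s hs x hx => ?_
    have h2 : weightSup h T ≤ LinearMap.ker (killingForm ℝ L x) :=
      weightSup_le fun t ht y hy => killingForm_weightSpace hx hy (hST s hs t ht)
    exact h2 hy
  exact h1 hx

variable {θ : L ≃ₗ⁅ℝ⁆ L}

/-- The Killing-orthogonal of a sum of weight spaces is the sum of the complementary ones. -/
theorem mem_weightSup_of_forall_killingForm [LieAlgebra.IsKilling ℝ L] {h : L}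
    (hh : ⨆ s, weightSpace h s = ⊤) {S T : Set ℝ} (hST : ∀ s, s ∉ S → -s ∈ T) {x : L}
    (hx : ∀ y ∈ weightSup h T, killingForm ℝ L x y = 0) : x ∈ weightSup h S := by
  obtain ⟨I, f, hf, hxI⟩ := exists_eq_sum_of_mem_iSup (hh ▸ Submodule.mem_top : x ∈ _)
  rw [hxI]
  refine Submodule.sum_mem _ fun c hc => ?_
  by_cases hcS : c ∈ S
  · exact weightSpace_le_weightSup h hcS (hf c)
  · have h0 : f c = 0 := by
      refine (LieAlgebra.IsKilling.killingForm_nondegenerate ℝ L).1 _ fun y => ?_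
      have h1 : ⨆ s, weightSpace h s ≤ LinearMap.ker (killingForm ℝ L (f c)) := by
        refine iSup_le fun d y hy => ?_
        rw [LinearMap.mem_ker]
        by_cases hd : c + d = 0
        · have h2 := hx y (weightSpace_le_weightSup h (hST c hcS)
            (by rwa [← eq_neg_of_add_eq_zero_right hd]))
          rw [hxI, map_sum, LinearMap.sum_apply, Finset.sum_eq_single_of_mem c hc] at h2
          · exact h2
          · intro b _ hbc
            refine killingForm_weightSpace (hf b) hy fun hb => hbc ?_
            linarith
        · exact killingForm_weightSpace (hf c) hy hd
      rw [hh] at h1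
      exact h1 Submodule.mem_top
    rw [h0]
    exact zero_mem _

/-- The degree `s` part of the grading compatible with `θ` that splits the filtration attached to
`h`: the orthogonal complement of `⨁_{t > s} 𝔤_t` in `⨁_{t ≥ s} 𝔤_t`, written without reference to
the inner product. -/
def thetaSplitting (θ : L ≃ₗ⁅ℝ⁆ L) (h : L) (s : ℝ) : Submodule ℝ L :=
  weightSup h (Set.Ici s) ⊓ (weightSup h (Set.Ici (-s))).comap (θ.toLinearEquiv : L →ₗ[ℝ] L)

theorem mem_thetaSplitting {h v : L} {s : ℝ} : v ∈ thetaSplitting θ h s ↔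
    v ∈ weightSup h (Set.Ici s) ∧ θ v ∈ weightSup h (Set.Ici (-s)) := Iff.rfl

theorem lie_mem_thetaSplitting {h x y : L} {s t : ℝ} (hx : x ∈ thetaSplitting θ h s)
    (hy : y ∈ thetaSplitting θ h t) : ⁅x, y⁆ ∈ thetaSplitting θ h (s + t) := by
  rw [mem_thetaSplitting] at hx hy ⊢
  rw [LieEquiv.map_lie]
  refine ⟨lie_mem_weightSup (fun a ha b hb => ?_) hx.1 hy.1,
    lie_mem_weightSup (fun a ha b hb => ?_) hx.2 hy.2⟩
  · rw [Set.mem_Ici] at *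
    linarith
  · rw [Set.mem_Ici] at *
    linarith

theorem theta_mem_thetaSplitting (hθ : IsCartanInvolution θ) {h x : L} {s : ℝ}
    (hx : x ∈ thetaSplitting θ h s) : θ x ∈ thetaSplitting θ h (-s) := by
  rw [mem_thetaSplitting] at hx ⊢
  rw [neg_neg, hθ.involutive]
  exact ⟨hx.2, hx.1⟩

variable [FiniteDimensional ℝ L]

/-- Orthogonal projection for a positive definite form. -/
theorem exists_mem_forall_sub_orthogonal {V : Type*} [AddCommGroup V] [Module ℝ V]
    [FiniteDimensional ℝ V] {β : LinearMap.BilinForm ℝ V} (hp : ∀ x, x ≠ 0 → 0 < β x x)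
    (W : Submodule ℝ V) (x : V) : ∃ b ∈ W, ∀ y ∈ W, β (x - b) y = 0 := by
  let Φ : W →ₗ[ℝ] Module.Dual ℝ W := β.domRestrict₁₂ W W
  have hinj : Function.Injective Φ := by
    rw [← LinearMap.ker_eq_bot, LinearMap.ker_eq_bot']
    intro w hw
    by_contra h
    have h1 : β w w = 0 := LinearMap.congr_fun hw w
    exact (hp w (fun h0 => h (Subtype.ext h0))).ne' h1
  obtain ⟨b, hb⟩ := (LinearMap.injective_iff_surjective_of_finrank_eq_finrank
    (Subspace.dual_finrank_eq (K := ℝ) (V := W)).symm).1 hinj (β x ∘ₗ W.subtype)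
  refine ⟨b, b.2, fun y hy => ?_⟩
  have h1 : β b y = β x y := LinearMap.congr_fun hb ⟨y, hy⟩
  rw [map_sub, LinearMap.sub_apply, h1, sub_self]

theorem iSupIndep_of_orthogonal {V : Type*} [AddCommGroup V] [Module ℝ V]
    {β : LinearMap.BilinForm ℝ V} (hp : ∀ x, x ≠ 0 → 0 < β x x) {ι : Type*}
    {p : ι → Submodule ℝ V} (h : ∀ i j, i ≠ j → ∀ x ∈ p i, ∀ y ∈ p j, β x y = 0) :
    iSupIndep p := by
  intro i
  refine Submodule.disjoint_def.2 fun x hx hx' => ?_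
  by_contra h0
  have h1 : ⨆ j, ⨆ (_ : j ≠ i), p j ≤ LinearMap.ker (β x) :=
    iSup₂_le fun j hj y hy => h i j hj.symm x hx y hy
  exact (hp x h0).ne' (h1 hx')

theorem eq_zero_of_forall_lie [LieAlgebra.IsKilling ℝ L] {x : L} (h : ∀ v : L, ⁅x, v⁆ = 0) :
    x = 0 :=
  (LieDerivation.IsKilling.ad_apply_eq_zero_iff ℝ L x).1 (LieDerivation.ext fun v => by
    rw [LieDerivation.ad_apply_apply, h]; rfl)

/-- A real grading of `L` which is reversed by `θ` is given by the eigenspaces of `ad x` for some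
`x` in the `(-1)`-eigenspace of `θ`. -/
theorem exists_grading_element (hθ : IsCartanInvolution θ) {V : ℝ → Submodule ℝ L}
    (htop : ⨆ s, V s = ⊤) (hind : iSupIndep V)
    (hlie : ∀ s t, ∀ x ∈ V s, ∀ y ∈ V t, ⁅x, y⁆ ∈ V (s + t))
    (hV : ∀ s, ∀ x ∈ V s, θ x ∈ V (-s)) :
    ∃ x, θ x = -x ∧ ∀ s, V s ≤ weightSpace x s := by
  have hkill := hθ.isKilling
  have hint := DirectSum.isInternal_submodule_of_iSupIndep_of_iSup_eq_top hind htop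
  let e := LinearEquiv.ofBijective (DirectSum.coeLinearMap V) hint
  let D : Module.End ℝ L := (DirectSum.toModule ℝ ℝ L fun s => s • (V s).subtype) ∘ₗ
    e.symm.toLinearMap
  have hD : ∀ s, ∀ v ∈ V s, D v = s • v := by
    intro s v hv
    have h1 : e (DirectSum.lof ℝ ℝ (fun s => V s) s ⟨v, hv⟩) = v :=
      DirectSum.coeLinearMap_lof V s ⟨v, hv⟩
    have h2 : e.symm v = DirectSum.lof ℝ ℝ (fun s => V s) s ⟨v, hv⟩ := by
      rw [LinearEquiv.symm_apply_eq, h1]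
    change (DirectSum.toModule ℝ ℝ L fun s => s • (V s).subtype) (e.symm v) = _
    rw [h2, DirectSum.toModule_lof]
    rfl
  have hext : ∀ T T' : Module.End ℝ L, (∀ s, ∀ v ∈ V s, T v = T' v) → ∀ v, T v = T' v := by
    intro T T' h v
    have h1 : ⨆ s, V s ≤ LinearMap.eqLocus T T' := iSup_le fun s v hv => h s v hv
    rw [htop] at h1
    exact h1 (x := v) Submodule.mem_top
  have hleib : ∀ a b : L, D ⁅a, b⁆ = ⁅a, D b⁆ - ⁅b, D a⁆ := by
    intro a b
    refine hext (D ∘ₗ LieAlgebra.ad ℝ L a)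
      (LieAlgebra.ad ℝ L a ∘ₗ D - LieAlgebra.ad ℝ L (-D a)) ?_ b |>.trans ?_
    · intro t b hb
      have h1 := hext (D ∘ₗ LieAlgebra.ad ℝ L b)
        (LieAlgebra.ad ℝ L b ∘ₗ D - LieAlgebra.ad ℝ L (-D b)) ?_ a
      · simp only [LinearMap.comp_apply, LinearMap.sub_apply, LieAlgebra.ad_apply, neg_lie] at h1 ⊢
        rw [← lie_skew, map_neg, h1, ← lie_skew b (D a), ← lie_skew (D b) a]
        abel
      · intro s a ha
        simp only [LinearMap.comp_apply, LinearMap.sub_apply, LieAlgebra.ad_apply, neg_lie]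
        rw [hD _ _ (hlie t s b hb a ha), hD t b hb, hD s a ha, lie_smul, smul_lie, add_smul]
        abel
    · simp only [LinearMap.comp_apply, LinearMap.sub_apply, LieAlgebra.ad_apply, neg_lie]
      rw [lie_skew]
  obtain ⟨x, hx⟩ := LieDerivation.IsKilling.exists_eq_ad
    (⟨D, hleib⟩ : LieDerivation ℝ L L)
  have hxD : ∀ v, ⁅x, v⁆ = D v := fun v => by
    rw [← LieDerivation.ad_apply_apply (R := ℝ), hx]; rfl
  refine ⟨x, ?_, fun s v hv => mem_weightSpace.2 (by rw [hxD, hD s v hv])⟩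
  rw [eq_neg_iff_add_eq_zero]
  refine eq_zero_of_forall_lie fun v => ?_
  refine hext (LieAlgebra.ad ℝ L (θ x + x)) 0 ?_ v
  intro s v hv
  rw [LieAlgebra.ad_apply, add_lie, hxD, hD s v hv]
  have h1 : ⁅θ x, v⁆ = θ ⁅x, θ v⁆ := by rw [LieEquiv.map_lie, hθ.involutive]
  rw [h1, hxD, hD _ _ (hV s v hv), map_smul, hθ.involutive, neg_smul, neg_add_cancel]
  rfl

end Weights

/-! ### The polar decomposition -/

section Polar

variable {L : Type*} [LieRing L] [LieAlgebra ℝ L] [FiniteDimensional ℝ L] {θ : L ≃ₗ⁅ℝ⁆ L}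

/-- The polar decomposition `g = k exp(ad x)`. If the positive part `exp(2 ad x) = θ g⁻¹ θ g`
fixes `v` then `x` commutes with `v`. -/
theorem exists_polar (hθ : IsCartanInvolution θ) {g : L ≃ₗ[ℝ] L} (hg : g ∈ adjointGroup L) :
    ∃ k ∈ thetaFixer θ, ∃ x, θ x = -x ∧ (∀ v, g v = k (expEquiv x v)) ∧
      ∀ v, θ (g v) = g (θ v) → ⁅x, v⁆ = 0 := by
  have hκ := hθ.isLooseKillingForm
  have haut := adjointGroup_subset hg
  let P : Module.End ℝ L := (θ.toLinearEquiv * g⁻¹ * θ.toLinearEquiv * g : L ≃ₗ[ℝ] L)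
  have hP : ∀ v, P v = θ (g.symm (θ (g v))) := fun _ => rfl
  have hginv : ∀ x y, g.symm ⁅x, y⁆ = ⁅g.symm x, g.symm y⁆ := (autGroup L).inv_mem haut
  have hPlie : ∀ x y, P ⁅x, y⁆ = ⁅P x, P y⁆ := by
    intro x y
    simp only [hP]
    rw [haut, LieEquiv.map_lie, hginv, LieEquiv.map_lie]
  have hPip : ∀ x y, ip θ (killingForm ℝ L) (P x) y = ip θ (killingForm ℝ L) (g x) (g y) := by
    intro x y
    rw [hP, ip, ip, hκ.theta_invariant, ← killingForm_autGroup haut, g.apply_symm_apply,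
      ← hκ.theta_invariant, hθ.involutive]
  have hPsymm : ∀ x y, ip θ (killingForm ℝ L) (P x) y = ip θ (killingForm ℝ L) x (P y) := by
    intro x y
    rw [hPip, ip_comm hθ.involutive hκ x, hPip, ip_comm hθ.involutive hκ]
  have hdiag := iSup_eigenspace_eq_top_of_symm (β := ipForm θ (killingForm ℝ L))
    (ip_comm hθ.involutive hκ) (fun x hx => ip_pos hθ hκ hx) hPsymm
  have hPpos : ∀ c : ℝ, c ≤ 0 → P.eigenspace c = ⊥ := by
    intro c hc
    refine (Submodule.eq_bot_iff _).2 fun v hv => ?_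
    rw [Module.End.mem_eigenspace_iff] at hv
    by_contra hv0
    have h1 := hPip v v
    have h2 : 0 < ip θ (killingForm ℝ L) (g v) (g v) :=
      ip_pos hθ hκ (by simpa using hv0)
    have h3 := ip_pos hθ hκ hv0
    rw [hv, ← ipForm_apply, map_smul, LinearMap.smul_apply, smul_eq_mul, ipForm_apply] at h1
    nlinarith
  have hPθ : ∀ v, P (θ (P v)) = θ v := by
    intro v
    rw [hP, hP, hθ.involutive, g.apply_symm_apply, hθ.involutive, g.symm_apply_apply]
  -- The grading whose degree `s` part is the eigenspace of `P` for `e ^ (2 s)`.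
  let V : ℝ → Submodule ℝ L := fun s => P.eigenspace (Real.exp (2 * s))
  have hVmem : ∀ s v, v ∈ V s ↔ P v = Real.exp (2 * s) • v := fun s v =>
    Module.End.mem_eigenspace_iff
  have htop : ⨆ s, V s = ⊤ := by
    rw [eq_top_iff, ← hdiag]
    refine iSup_le fun c => ?_
    obtain hc | hc := le_or_gt c 0
    · rw [hPpos c hc]
      exact bot_le
    · refine le_trans (le_of_eq ?_) (le_iSup V (Real.log c / 2))
      simp only [V]
      rw [mul_div_cancel₀ _ two_ne_zero, Real.exp_log hc]
  have hind : iSupIndep V := P.eigenspaces_iSupIndep.comp fun s t hst => by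
    have := Real.exp_injective hst
    linarith
  have hlie : ∀ s t, ∀ x ∈ V s, ∀ y ∈ V t, ⁅x, y⁆ ∈ V (s + t) := by
    intro s t x hx y hy
    rw [hVmem] at hx hy ⊢
    rw [hPlie, hx, hy, smul_lie, lie_smul, smul_smul, mul_add, Real.exp_add]
  have hVθ : ∀ s, ∀ x ∈ V s, θ x ∈ V (-s) := by
    intro s x hx
    rw [hVmem] at hx ⊢
    have h1 := hPθ x
    rw [hx, map_smul, map_smul] at h1
    conv_rhs => rw [← h1, smul_smul, ← Real.exp_add]
    simp
  obtain ⟨x, hxθ, hx⟩ := exists_grading_element hθ htop hind hlie hVθ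
  have hxV : ∀ s, ∀ v ∈ V s, ⁅x, v⁆ = s • v := fun s v hv => mem_weightSpace.1 (hx s hv)
  refine ⟨g * expEquiv (-x), ⟨mul_mem_adjointGroup hg (expEquiv_mem _), ?_⟩, x, hxθ, ?_, ?_⟩
  · have hk : ∀ s, ∀ v ∈ V s, g (expEquiv (-x) v) = Real.exp (-s) • g v := by
      intro s v hv
      rw [expEquiv_of_lie_eq_smul (c := -s) (by rw [neg_lie, hxV s v hv, neg_smul]), map_smul]
    intro v
    have h1 : ⨆ s, V s ≤ LinearMap.eqLocus
        ((g * expEquiv (-x) * θ.toLinearEquiv : L ≃ₗ[ℝ] L) : Module.End ℝ L)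
        ((θ.toLinearEquiv * (g * expEquiv (-x)) : L ≃ₗ[ℝ] L) : Module.End ℝ L) := by
      refine iSup_le fun s v hv => ?_
      change g (expEquiv (-x) (θ v)) = θ (g (expEquiv (-x) v))
      rw [hk (-s) (θ v) (hVθ s v hv), hk s v hv, map_smul]
      rw [hVmem, hP] at hv
      have h2 : θ (g v) = Real.exp (2 * s) • g (θ v) := by
        rw [← map_smul, ← map_smul, ← hv, hθ.involutive, g.apply_symm_apply]
      rw [h2, smul_smul, ← Real.exp_add]
      congr 2
      ring
    rw [htop] at h1
    exact h1 (x := v) Submodule.mem_top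
  · intro v
    rw [LinearEquiv.mul_apply, expEquiv_neg_apply_expEquiv]
  · intro v hv
    have h1 : v ∈ V 0 := by
      rw [hVmem, hP, hv, g.symm_apply_apply, hθ.involutive]
      simp
    rw [hxV 0 v h1, zero_smul]

end Polar

/-! ### Conjugation into the `(-1)`-eigenspace -/

section Filtration

variable {L : Type*} [LieRing L] [LieAlgebra ℝ L] [FiniteDimensional ℝ L] {θ : L ≃ₗ⁅ℝ⁆ L}

theorem finite_weights (h : L) : {s : ℝ | weightSpace h s ≠ ⊥}.Finite :=
  Module.End.finite_hasEigenvalue (LieAlgebra.ad ℝ L h)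

/-- Downward induction along the finite set of weights. -/
theorem weight_induction (h : L) {p : ℝ → Prop} (hbot : ∀ s, weightSpace h s = ⊥ → p s)
    (hstep : ∀ s, (∀ t, s < t → p t) → p s) (s : ℝ) : p s := by
  by_contra hs
  have hfin : {s : ℝ | ¬p s}.Finite := (finite_weights h).subset fun s hs h0 => hs (hbot s h0)
  obtain ⟨m, hm⟩ := hfin.exists_maximal ⟨s, hs⟩
  refine hm.prop (hstep m fun t ht => ?_)
  by_contra hpt
  exact absurd (hm.le_of_ge hpt ht.le) (not_le.2 ht)

theorem expEquiv_sub_mem {h y v : L} {s : ℝ} (hy : y ∈ weightSup h (Set.Ioi 0))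
    (hv : v ∈ weightSup h (Set.Ici s)) : expEquiv y v - v ∈ weightSup h (Set.Ioi s) := by
  have hlie : ∀ w ∈ weightSup h (Set.Ici s), ⁅y, w⁆ ∈ weightSup h (Set.Ioi s) := fun w hw =>
    lie_mem_weightSup (fun a ha b hb => by
      simp only [Set.mem_Ioi, Set.mem_Ici] at *
      linarith) hy hw
  exact expEnd_sub_mem (fun w hw => hlie w (weightSup_mono h Set.Ioi_subset_Ici_self hw))
    (hlie v hv)

/-- The unipotent group attached to `h` acts transitively on `h + ⨁_{s > 0} 𝔤_s`. -/
theorem exists_unipotent_conj (h : L) {u : L} (hu : u ∈ weightSup h (Set.Ioi 0)) :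
    ∃ n ∈ adjointGroup L, n h = h + u ∧ ∀ s, ∀ v ∈ weightSup h (Set.Ici s),
      n v - v ∈ weightSup h (Set.Ioi s) := by
  let T : Finset ℝ := (finite_weights h).toFinset
  have key : ∀ (N : ℕ) (c : ℝ), 0 ≤ c → (T.filter (c < ·)).card = N →
      ∀ u ∈ weightSup h (Set.Ioi c), ∃ n ∈ adjointGroup L, n h = h + u ∧
        ∀ s, ∀ v ∈ weightSup h (Set.Ici s), n v - v ∈ weightSup h (Set.Ioi s) := by
    intro N
    induction N using Nat.strong_induction_on with
    | _ N ih =>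
      intro c hc hN u hu
      obtain hemp | hne := (T.filter (c < ·)).eq_empty_or_nonempty
      · have h0 : weightSup h (Set.Ioi c) ≤ ⊥ := by
          refine weightSup_le fun t ht => ?_
          by_contra hbot
          have : t ∈ T.filter (c < ·) := by
            simpa [T] using ⟨fun h0 => hbot h0.le, ht⟩
          rw [hemp] at this
          simp at this
        have hu0 : u = 0 := by simpa using h0 hu
        exact ⟨1, one_mem_adjointGroup, by simp [hu0], fun s v _ => by simp⟩
      · set d := (T.filter (c < ·)).min' hne
        have hd : d ∈ T.filter (c < ·) := Finset.min'_mem _ _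
        have hcd : c < d := (Finset.mem_filter.1 hd).2
        have hd0 : 0 < d := hc.trans_lt hcd
        have h1 : weightSup h (Set.Ioi c) ≤ weightSup h (Set.Ici d) := by
          refine weightSup_le fun t ht => ?_
          by_cases hbot : weightSpace h t = ⊥
          · rw [hbot]
            exact bot_le
          · refine weightSpace_le_weightSup h (Set.mem_Ici.2 (Finset.min'_le _ _ ?_))
            simpa [T] using ⟨hbot, ht⟩
        have h2 := h1 hu
        rw [weightSup_Ici_eq, Submodule.mem_sup] at h2
        obtain ⟨a, ha, b, hb, rfl⟩ := h2
        -- `[y, h] = a` for `y` of weight `d`, and `exp(ad y) h = h + a`.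
        set y : L := -(d⁻¹ • a) with hy
        have hyd : y ∈ weightSpace h d := neg_mem (Submodule.smul_mem _ _ ha)
        have hyh : ⁅y, h⁆ = a := by
          rw [mem_weightSpace] at hyd
          rw [← lie_skew, hyd, hy, smul_neg, neg_neg, smul_smul, mul_inv_cancel₀ hd0.ne', one_smul]
        have hexp : expEquiv y h = h + a := by
          rw [expEquiv_of_lie_lie_eq_zero, hyh]
          rw [hyh, hy, neg_lie, smul_lie, lie_self, smul_zero, neg_zero]
        have hy0 : y ∈ weightSup h (Set.Ioi 0) := weightSpace_le_weightSup h hd0 hyd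
        have hb' : expEquiv (-y) b ∈ weightSup h (Set.Ioi d) := by
          refine expEnd_mem (fun w hw => ?_) hb
          refine lie_mem_weightSup (fun a ha b hb => ?_) (neg_mem hy0) hw
          simp only [Set.mem_Ioi] at *
          linarith
        obtain ⟨n, hn, hnh, hnv⟩ := ih _ (by
          rw [← hN]
          refine Finset.card_lt_card ⟨fun t ht => ?_, fun hsub => ?_⟩
          · simp only [Finset.mem_filter] at ht ⊢
            exact ⟨ht.1, hcd.trans ht.2⟩
          · exact lt_irrefl d (Finset.mem_filter.1 (hsub hd)).2) d hd0.le rfl _ hb'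
        refine ⟨expEquiv y * n, mul_mem_adjointGroup (expEquiv_mem y) hn, ?_, ?_⟩
        · rw [LinearEquiv.mul_apply, hnh, map_add, hexp]
          have := expEquiv_neg_apply_expEquiv (-y) b
          rw [neg_neg] at this
          rw [this, add_assoc]
        · intro s v hv
          have h3 := hnv s v hv
          have h4 := expEquiv_sub_mem hy0 hv
          have h5 := expEquiv_sub_mem hy0 (weightSup_mono h Set.Ioi_subset_Ici_self h3)
          have h6 := weightSup_mono h (Set.Ioi_subset_Ioi le_rfl) h5
          have h7 := add_mem (add_mem h6 h3) h4
          rw [LinearEquiv.mul_apply]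
          convert! h7 using 1
          rw [map_sub]
          abel
  exact key _ 0 le_rfl rfl u hu

/-- An element which strictly raises the filtration attached to `h` has positive weights. -/
theorem mem_weightSup_Ioi_of_forall_lie [LieAlgebra.IsKilling ℝ L] {h u : L}
    (hh : ⨆ s, weightSpace h s = ⊤)
    (hshift : ∀ s, ∀ v ∈ weightSpace h s, ⁅u, v⁆ ∈ weightSup h (Set.Ioi s)) :
    u ∈ weightSup h (Set.Ioi 0) := by
  have hu0 : u ∈ weightSup h (Set.Ici 0) := by
    refine mem_weightSup_of_forall_killingForm hh (T := Set.Ioi 0) (fun a ha => ?_) fun y hy => ?_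
    · simpa using ha
    · have h1 : weightSup h (Set.Ioi 0) ≤ LinearMap.ker (killingForm ℝ L u) := by
        refine weightSup_le fun t ht y hy => ?_
        have h2 : ⁅u, h⁆ ∈ weightSup h (Set.Ioi 0) :=
          hshift 0 h (mem_weightSpace.2 (by simp))
        have h3 : killingForm ℝ L ⁅u, h⁆ y = 0 := by
          refine killingForm_weightSup (T := Set.Ioi 0) (fun a ha b hb => ?_) h2
            (weightSpace_le_weightSup h ht hy)
          simp only [Set.mem_Ioi] at ha hb
          linarith
        rw [← lie_skew, map_neg, LinearMap.neg_apply, killingForm_lie, neg_neg,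
          mem_weightSpace.1 hy, map_smul, smul_eq_mul] at h3
        exact (mul_eq_zero.1 h3).resolve_left (Set.mem_Ioi.1 ht).ne'
      exact h1 hy
  rw [weightSup_Ici_eq, Submodule.mem_sup] at hu0
  obtain ⟨a, ha, b, hb, hab⟩ := hu0
  have ha0 : a = 0 := by
    refine eq_zero_of_forall_lie fun v => ?_
    have h1 : ⨆ s, weightSpace h s ≤ LinearMap.ker (LieAlgebra.ad ℝ L a) := by
      refine iSup_le fun s v hv => ?_
      refine weightSpace_inf_weightSup_Ioi h (s := s) ?_ ?_
      · rw [mem_weightSpace] at ha hv ⊢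
        rw [LieAlgebra.ad_apply, leibniz_lie, ha, hv, zero_smul, zero_lie, zero_add, lie_smul]
      · have h2 : ⁅a, v⁆ = ⁅u, v⁆ - ⁅b, v⁆ := by rw [← hab, add_lie, add_sub_cancel_right]
        rw [LieAlgebra.ad_apply, h2]
        have h3 : v ∈ weightSup h {s} := weightSpace_le_weightSup h (Set.mem_singleton s) hv
        have h4 : ⁅b, v⁆ ∈ weightSup h (Set.Ioi s) := by
          refine lie_mem_weightSup (fun a ha c hc => ?_) hb h3
          rw [Set.mem_singleton_iff] at hc
          rw [Set.mem_Ioi] at ha ⊢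
          linarith
        exact sub_mem (hshift s v hv) h4
    rw [hh] at h1
    exact h1 (x := v) Submodule.mem_top
  rw [← hab, ha0, zero_add]
  exact hb

theorem thetaSplitting_orthogonal (hθ : IsCartanInvolution θ) {h x y : L} {s t : ℝ} (hst : s ≠ t)
    (hx : x ∈ thetaSplitting θ h s) (hy : y ∈ thetaSplitting θ h t) :
    ipForm θ (killingForm ℝ L) x y = 0 := by
  rw [mem_thetaSplitting] at hx hy
  rw [ipForm_apply, ip, neg_eq_zero]
  obtain hlt | hlt := lt_or_gt_of_ne hst
  · rw [← hθ.isLooseKillingForm.theta_invariant, hθ.involutive]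
    refine killingForm_weightSup (fun a ha b hb => ?_) hx.2 hy.1
    simp only [Set.mem_Ici] at ha hb
    linarith
  · refine killingForm_weightSup (fun a ha b hb => ?_) hx.1 hy.2
    simp only [Set.mem_Ici] at ha hb
    linarith

/-- Subtracting from `x` its orthogonal projection to `⨁_{t > s} 𝔤_t` gives an element of the
splitting. -/
theorem weightSpace_le_thetaSplitting_sup (hθ : IsCartanInvolution θ) {h : L}
    (hh : ⨆ s, weightSpace h s = ⊤) (s : ℝ) :
    weightSpace h s ≤ thetaSplitting θ h s ⊔ weightSup h (Set.Ioi s) := by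
  have hκ := hθ.isLooseKillingForm
  have hkill := hθ.isKilling
  intro x hx
  obtain ⟨b, hb, hb'⟩ := exists_mem_forall_sub_orthogonal (β := ipForm θ (killingForm ℝ L))
    (fun x hx => ip_pos hθ hκ hx) (weightSup h (Set.Ioi s)) x
  have h1 : x - b ∈ thetaSplitting θ h s := by
    rw [mem_thetaSplitting]
    refine ⟨sub_mem (weightSpace_le_weightSup h Set.self_mem_Ici hx)
      (weightSup_mono h Set.Ioi_subset_Ici_self hb), ?_⟩
    refine mem_weightSup_of_forall_killingForm hh (T := Set.Ioi s) (fun a ha => ?_) fun y hy => ?_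
    · simp only [Set.mem_Ici, Set.mem_Ioi, not_le] at ha ⊢
      linarith
    · have h2 := hb' y hy
      rwa [ipForm_apply, ip, neg_eq_zero, ← hκ.theta_invariant, hθ.involutive] at h2
  exact Submodule.mem_sup.2 ⟨x - b, h1, b, hb, sub_add_cancel x b⟩

theorem weightSup_le_iSup_thetaSplitting (hθ : IsCartanInvolution θ) {h : L}
    (hh : ⨆ s, weightSpace h s = ⊤) {S : Set ℝ} (hS : ∀ s ∈ S, Set.Ici s ⊆ S) :
    weightSup h S ≤ ⨆ t ∈ S, thetaSplitting θ h t := by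
  have hle : ∀ s, weightSpace h s ≤ ⨆ t ∈ Set.Ici s, thetaSplitting θ h t := by
    refine weight_induction h (fun s hs => by rw [hs]; exact bot_le) fun s ih => ?_
    refine (weightSpace_le_thetaSplitting_sup hθ hh s).trans (sup_le (le_iSup₂ (f := fun t
      (_ : t ∈ Set.Ici s) => thetaSplitting θ h t) s Set.self_mem_Ici)
      (weightSup_le fun t ht => (ih t ht).trans ?_))
    exact biSup_mono fun u hu => (Set.mem_Ioi.1 ht).le.trans hu
  exact weightSup_le fun s hs => (hle s).trans (biSup_mono fun t ht => hS s hs ht)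

theorem Ici_subset_Ioi_of_mem {s t : ℝ} (ht : t ∈ Set.Ioi s) : Set.Ici t ⊆ Set.Ioi s :=
  fun _ hu => Set.mem_Ioi.2 ((Set.mem_Ioi.1 ht).trans_le (Set.mem_Ici.1 hu))

/-- The splitting of the filtration attached to `h` that is compatible with `θ` is the
eigenspace grading of an element `h'` with `θ h' = -h'`. -/
theorem exists_anti_splitting (hθ : IsCartanInvolution θ) {h : L}
    (hh : ⨆ s, weightSpace h s = ⊤) :
    ∃ h', θ h' = -h' ∧ ∀ s, thetaSplitting θ h s ≤ weightSpace h' s := by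
  refine exists_grading_element hθ ?_ (iSupIndep_of_orthogonal (β := ipForm θ (killingForm ℝ L))
    (fun x hx => ip_pos hθ hθ.isLooseKillingForm hx)
    fun s t hst x hx y hy => thetaSplitting_orthogonal hθ hst hx hy)
    (fun s t x hx y hy => lie_mem_thetaSplitting hx hy)
    fun s x hx => theta_mem_thetaSplitting hθ hx
  rw [eq_top_iff, ← hh]
  refine iSup_le fun s => ((weightSpace_le_weightSup h (Set.mem_univ s)).trans
    (weightSup_le_iSup_thetaSplitting hθ hh fun s _ => Set.subset_univ _)).trans
    (iSup₂_le fun t _ => le_iSup _ t)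

/-- Every real diagonalizable `h` is conjugate, by an element unipotent for the filtration attached
to `h`, to an element of the `(-1)`-eigenspace of `θ` defining the same filtration. -/
theorem exists_unipotent_conj_anti (hθ : IsCartanInvolution θ) {h : L}
    (hh : ⨆ s, weightSpace h s = ⊤) :
    ∃ n ∈ adjointGroup L, θ (n h) = -n h ∧ ∀ s, ∀ v ∈ weightSup h (Set.Ici s),
      v ∈ weightSup (n h) (Set.Ici s) ∧ n v - v ∈ weightSup (n h) (Set.Ioi s) := by
  have hκ := hθ.isLooseKillingForm
  have hkill := hθ.isKilling
  obtain ⟨h', hh'θ, hh'⟩ := exists_anti_splitting hθ hh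
  have hfilt' : ∀ S : Set ℝ, (∀ s ∈ S, Set.Ici s ⊆ S) → weightSup h S ≤ weightSup h' S :=
    fun S hS => (weightSup_le_iSup_thetaSplitting hθ hh hS).trans
      (iSup₂_le fun t ht => (hh' t).trans (weightSpace_le_weightSup h' ht))
  -- `h' - h` shifts the filtration of `h`, so it lies in `⨁_{s > 0} 𝔤_s`.
  have hshift : ∀ s, ∀ v ∈ weightSpace h s, ⁅h' - h, v⁆ ∈ weightSup h (Set.Ioi s) := by
    intro s v hv
    obtain ⟨a, ha, b, hb, hab⟩ :=
      Submodule.mem_sup.1 (weightSpace_le_thetaSplitting_sup hθ hh s hv)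
    have h1 : ⁅h' - h, v⁆ = ⁅h', b⁆ - s • b := by
      rw [sub_lie, mem_weightSpace.1 hv, ← hab, lie_add, mem_weightSpace.1 (hh' s ha), smul_add]
      abel
    rw [h1]
    refine sub_mem ?_ (Submodule.smul_mem _ _ hb)
    have h2 : ⨆ t ∈ Set.Ioi s, thetaSplitting θ h t ≤
        (weightSup h (Set.Ioi s)).comap (LieAlgebra.ad ℝ L h') := by
      refine iSup₂_le fun t ht w hw => ?_
      rw [Submodule.mem_comap, LieAlgebra.ad_apply, mem_weightSpace.1 (hh' t hw)]
      exact Submodule.smul_mem _ _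
        (weightSup_mono h (Ici_subset_Ioi_of_mem ht) (mem_thetaSplitting.1 hw).1)
    exact h2 (weightSup_le_iSup_thetaSplitting hθ hh (fun t ht => Ici_subset_Ioi_of_mem ht) hb)
  have hu1 := mem_weightSup_Ioi_of_forall_lie hh hshift
  obtain ⟨n, hn, hnh, hnv⟩ := exists_unipotent_conj h hu1
  have hnh' : n h = h' := by rw [hnh, add_sub_cancel]
  refine ⟨n, hn, by rw [hnh', hh'θ], fun s v hv => ?_⟩
  rw [hnh']
  exact ⟨hfilt' _ (fun t ht => Set.Ici_subset_Ici.2 ht) hv,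
    hfilt' _ (fun t ht => Ici_subset_Ioi_of_mem ht) (hnv s v hv)⟩

end Filtration

/-! ### `sl₂`-triples adapted to the Cartan involution -/

section Existence

attribute [local instance] basisNorm basisNormedSpace

variable {L : Type*} [LieRing L] [LieAlgebra ℝ L] [FiniteDimensional ℝ L] {θ : L ≃ₗ⁅ℝ⁆ L}

/-- `h, e, f` satisfy the commutation relations of `sl₂` and `e` is nilpotent (the zero triple
is allowed). -/
structure IsNilpotentTriple (h e f : L) : Prop where
  nilpotent : IsNilpotent (LieAlgebra.ad ℝ L e)
  lie_h_e : ⁅h, e⁆ = (2 : ℝ) • e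
  lie_h_f : ⁅h, f⁆ = -((2 : ℝ) • f)
  lie_e_f : ⁅e, f⁆ = h

namespace IsNilpotentTriple

variable {h e f : L}

theorem ad_h_e (t : IsNilpotentTriple h e f) (v : L) : LieAlgebra.ad ℝ L h (LieAlgebra.ad ℝ L e v) =
    LieAlgebra.ad ℝ L e (LieAlgebra.ad ℝ L h v) + (2 : ℝ) • LieAlgebra.ad ℝ L e v := by
  simp only [LieAlgebra.ad_apply]
  rw [leibniz_lie, t.lie_h_e, smul_lie, add_comm]

theorem ad_h_f (t : IsNilpotentTriple h e f) (v : L) : LieAlgebra.ad ℝ L h (LieAlgebra.ad ℝ L f v) =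
    LieAlgebra.ad ℝ L f (LieAlgebra.ad ℝ L h v) - (2 : ℝ) • LieAlgebra.ad ℝ L f v := by
  simp only [LieAlgebra.ad_apply]
  rw [leibniz_lie, t.lie_h_f, neg_lie, smul_lie]
  abel

theorem ad_e_f (t : IsNilpotentTriple h e f) (v : L) : LieAlgebra.ad ℝ L e (LieAlgebra.ad ℝ L f v) =
    LieAlgebra.ad ℝ L f (LieAlgebra.ad ℝ L e v) + LieAlgebra.ad ℝ L h v := by
  simp only [LieAlgebra.ad_apply]
  rw [leibniz_lie, t.lie_e_f, add_comm]

theorem iSup_weightSpace (t : IsNilpotentTriple h e f) : ⨆ s, weightSpace h s = ⊤ :=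
  iSup_eigenspace_weight_eq_top t.nilpotent t.ad_h_e t.ad_e_f t.ad_h_f

theorem exists_lie_eq (t : IsNilpotentTriple h e f) {w : L} (hw : ⁅h, w⁆ = (2 : ℝ) • w) :
    ∃ x : L, ⁅h, x⁆ = 0 ∧ ⁅x, e⁆ = w := by
  obtain ⟨x, hx, hxw⟩ := exists_weight_preimage_of_pos t.nilpotent t.ad_h_e t.ad_e_f t.ad_h_f
    (c := 2) two_pos (v := w) hw
  rw [sub_self, zero_smul, LieAlgebra.ad_apply] at hx
  rw [LieAlgebra.ad_apply] at hxw
  exact ⟨-x, by rw [lie_neg, hx, neg_zero], by rw [neg_lie, lie_skew, hxw]⟩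

theorem f_unique (t : IsNilpotentTriple h e f) {f' : L} (hf' : ⁅h, f'⁆ = -((2 : ℝ) • f'))
    (hef' : ⁅e, f'⁆ = h) : f' = f := by
  rw [← sub_eq_zero]
  refine eq_zero_of_neg_weight t.nilpotent t.ad_h_e t.ad_e_f (c := -2) (by norm_num) ?_ ?_
  · rw [LieAlgebra.ad_apply, lie_sub, hef', t.lie_e_f, sub_self]
  · rw [LieAlgebra.ad_apply, lie_sub, hf', t.lie_h_f]
    module

theorem map (t : IsNilpotentTriple h e f) {g : L ≃ₗ[ℝ] L} (hg : g ∈ autGroup L) :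
    IsNilpotentTriple (g h) (g e) (g f) where
  nilpotent := by
    obtain ⟨n, hn⟩ := t.nilpotent
    have h1 : ∀ (k : ℕ) (v : L),
        (LieAlgebra.ad ℝ L (g e) ^ k) (g v) = g ((LieAlgebra.ad ℝ L e ^ k) v) := by
      intro k
      induction k with
      | zero => simp
      | succ k ih =>
        intro v
        rw [pow_succ, pow_succ, Module.End.mul_apply, Module.End.mul_apply, LieAlgebra.ad_apply,
          LieAlgebra.ad_apply, ← hg, ih]
    refine ⟨n, LinearMap.ext fun v => ?_⟩
    rw [← g.apply_symm_apply v, h1, hn, LinearMap.zero_apply, LinearMap.zero_apply, map_zero]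
  lie_h_e := by rw [← hg, t.lie_h_e, map_smul]
  lie_h_f := by rw [← hg, t.lie_h_f, map_neg, map_smul]
  lie_e_f := by rw [← hg, t.lie_e_f]

/-- The orbit of `e` under the centralizer of `h` is open in the weight space of weight `2`. -/
theorem eventually_exists_expEquiv (t : IsNilpotentTriple h e f) :
    ∀ᶠ e' in nhds e, ⁅h, e'⁆ = (2 : ℝ) • e' → ∃ x, ⁅h, x⁆ = 0 ∧ expEquiv x e = e' := by
  obtain ⟨π, hπ⟩ := (weightSpace h 2).subtype.exists_leftInverse_of_injective
    (Submodule.ker_subtype _)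
  have hπ' : ∀ v : weightSpace h 2, π v = v := fun v => LinearMap.congr_fun hπ v
  let Φ : weightSpace h 0 → weightSpace h 2 := fun x => π (expEnd (LieAlgebra.ad ℝ L (x : L)) e)
  have hderiv := (LinearMap.toContinuousLinearMap π).hasStrictFDerivAt.comp (0 : weightSpace h 0)
    (HasStrictFDerivAt.comp (0 : weightSpace h 0)
      (hasStrictFDerivAt_expEnd_apply (LieAlgebra.ad ℝ L : L →ₗ[ℝ] Module.End ℝ L) e)
      (weightSpace h 0).subtypeL.hasStrictFDerivAt)
  have hopen := hderiv.map_nhds_eq_of_surj (by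
    rw [LinearMap.range_eq_top]
    intro w
    obtain ⟨x, hx, hxw⟩ := t.exists_lie_eq (mem_weightSpace.1 w.2)
    refine ⟨⟨x, mem_weightSpace.2 (by rw [hx, zero_smul])⟩, ?_⟩
    change π ⁅x, e⁆ = w
    rw [hxw, hπ'])
  have he : e ∈ weightSpace h 2 := mem_weightSpace.2 t.lie_h_e
  have h0 : Φ 0 = ⟨e, he⟩ := by
    change π (expEnd (LieAlgebra.ad ℝ L (0 : L)) e) = _
    rw [map_zero, expEnd_zero]
    exact hπ' ⟨e, he⟩
  have hrange : Set.range Φ ∈ nhds (⟨e, he⟩ : weightSpace h 2) := by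
    rw [← h0]
    have h1 : Filter.map Φ (nhds 0) = nhds (Φ 0) := hopen
    rw [← h1]
    exact Filter.range_mem_map
  rw [nhds_subtype_eq_comap, Filter.mem_comap] at hrange
  obtain ⟨U, hU, hUsub⟩ := hrange
  filter_upwards [hU] with e' he' hwe'
  obtain ⟨x, hx⟩ := hUsub (show (⟨e', mem_weightSpace.2 hwe'⟩ : weightSpace h 2) ∈ _ from he')
  have hxh : ⁅h, (x : L)⁆ = 0 := by
    have := mem_weightSpace.1 x.2
    rwa [zero_smul] at this
  refine ⟨x, hxh, ?_⟩
  have h1 : expEquiv (x : L) e ∈ weightSpace h 2 := by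
    refine expEnd_mem (fun w hw => ?_) he
    rw [mem_weightSpace] at hw ⊢
    rw [LieAlgebra.ad_apply, leibniz_lie, hxh, zero_lie, zero_add, hw, lie_smul]
  have h2 := hπ' ⟨_, h1⟩
  have h3 : π (expEquiv (x : L) e) = ⟨e', mem_weightSpace.2 hwe'⟩ := hx
  exact congrArg Subtype.val (h2.symm.trans h3)

end IsNilpotentTriple

/-- The orbit of the pair `(e, f)` under the stabilizer of `h` in `G_ℝ`. -/
def pairOrbit (h e f : L) : Set (L × L) :=
  {p | ∃ l ∈ adjointGroup L, l h = h ∧ p = (l e, l f)}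

theorem continuous_ad_pow_apply (N : ℕ) (v : L) :
    Continuous fun x : L => (LieAlgebra.ad ℝ L x ^ N) v := by
  induction N with
  | zero => simpa using continuous_const
  | succ N ih =>
    simp only [pow_succ', Module.End.mul_apply, LieAlgebra.ad_apply]
    exact continuous_lie'.comp (continuous_id.prodMk ih)

/-- The orbit is closed because a pair in its closure again completes `h` to a triple, so has an
open orbit meeting the given one. -/
theorem IsNilpotentTriple.isClosed_pairOrbit {h e f : L} (t : IsNilpotentTriple h e f) :
    IsClosed (pairOrbit h e f) := by
  refine isClosed_of_closure_subset fun p hp => ?_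
  -- The defining relations of a triple pass to the limit, so the limit has an open orbit.
  let C : Set (L × L) := {p | ⁅h, p.1⁆ = (2 : ℝ) • p.1} ∩ ({p | ⁅h, p.2⁆ = -((2 : ℝ) • p.2)} ∩
    ({p | ⁅p.1, p.2⁆ = h} ∩ {p | ∀ v, (LieAlgebra.ad ℝ L p.1 ^ finrank ℝ L) v = 0}))
  have hC : IsClosed C := by
    refine IsClosed.inter ?_ (IsClosed.inter ?_ (IsClosed.inter ?_ ?_))
    · exact isClosed_eq (continuous_lie'.comp (continuous_const.prodMk continuous_fst))
        (continuous_fst.const_smul _)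
    · exact isClosed_eq (continuous_lie'.comp (continuous_const.prodMk continuous_snd))
        (continuous_snd.const_smul _).neg
    · exact isClosed_eq continuous_lie' continuous_const
    · simp only [Set.ofPred_forall]
      exact isClosed_iInter fun v =>
        isClosed_eq ((continuous_ad_pow_apply _ v).comp continuous_fst) continuous_const
  have hsub : pairOrbit h e f ⊆ C := by
    rintro _ ⟨l, hl, hlh, rfl⟩
    have := t.map (adjointGroup_subset hl)
    rw [hlh] at this
    exact ⟨this.lie_h_e, this.lie_h_f, this.lie_e_f, fun v => by
      rw [isNilpotent_ad_pow this.nilpotent, LinearMap.zero_apply]⟩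
  obtain ⟨hp1, hp2, hp3, hp4⟩ := closure_minimal hsub hC hp
  have tp : IsNilpotentTriple h p.1 p.2 := ⟨⟨_, LinearMap.ext hp4⟩, hp1, hp2, hp3⟩
  have hev : ∀ᶠ q in nhds p, ⁅h, q.1⁆ = (2 : ℝ) • q.1 →
      ∃ x, ⁅h, x⁆ = 0 ∧ expEquiv x p.1 = q.1 :=
    continuous_fst.continuousAt.eventually tp.eventually_exists_expEquiv
  obtain ⟨_, ⟨l, hl, hlh, rfl⟩, hq⟩ :=
    ((mem_closure_iff_frequently.1 hp).and_eventually hev).exists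
  have tl := t.map (adjointGroup_subset hl)
  rw [hlh] at tl
  obtain ⟨x, hx, hxe⟩ := hq tl.lie_h_e
  have hxh : expEquiv (-x) h = h :=
    expEquiv_of_lie_eq_zero (by rw [neg_lie, lie_skew, hx])
  have hle : expEquiv (-x) (l e) = p.1 := by
    have hxe' : expEquiv x p.1 = l e := hxe
    rw [← hxe', expEquiv_neg_apply_expEquiv]
  refine ⟨expEquiv (-x) * l, mul_mem_adjointGroup (expEquiv_mem _) hl, ?_, ?_⟩
  · rw [LinearEquiv.mul_apply, hlh, hxh]
  · rw [LinearEquiv.mul_apply, LinearEquiv.mul_apply, hle]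
    refine Prod.ext rfl (tp.f_unique ?_ ?_).symm
    · have := (tl.map (adjointGroup_subset (expEquiv_mem (-x)))).lie_h_f
      rwa [hxh] at this
    · have := (tl.map (adjointGroup_subset (expEquiv_mem (-x)))).lie_e_f
      rwa [hxh, hle] at this

/-- A triple with `θ h = -h` for which `⁅e, θ e⁆ + ⁅f, θ f⁆ = 0` satisfies `θ f = -e`: for
`d = e + θ f` and `s = e - θ f` the relations `⁅d, θ d⁆ - ⁅s, θ s⁆ = 4 h` and `⁅θ s, d⁆ = 0` give
`8 ‖d‖² = -‖⁅d, θ d⁆‖² - ‖⁅s, d⁆‖²`. -/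
theorem IsNilpotentTriple.theta_eq_of_moment_eq_zero {h e f : L} (t : IsNilpotentTriple h e f)
    (hθ : IsCartanInvolution θ) (hh : θ h = -h) (hY : ⁅e, θ e⁆ + ⁅f, θ f⁆ = 0) : θ f = -e := by
  have hκ := hθ.isLooseKillingForm
  have h1 : ⁅θ e, θ f⁆ = -h := by rw [← LieEquiv.map_lie, t.lie_e_f, hh]
  have h2 : ⁅h, θ f⁆ = (2 : ℝ) • θ f := by
    have := congrArg θ t.lie_h_f
    rw [LieEquiv.map_lie, hh, map_neg, map_smul, neg_lie, neg_inj] at this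
    exact this
  set d := e + θ f with hd
  set s := e - θ f with hs
  have hθd : θ d = θ e + f := by rw [hd, map_add, hθ.involutive]
  have hθs : θ s = θ e - f := by rw [hs, map_sub, hθ.involutive]
  have h1' : ⁅θ f, θ e⁆ = h := by rw [← lie_skew, h1, neg_neg]
  have hff : ⁅θ f, f⁆ = ⁅e, θ e⁆ := by
    rw [← lie_skew]
    exact (eq_neg_of_add_eq_zero_left hY).symm
  have hdd : ⁅d, θ d⁆ - ⁅s, θ s⁆ = (4 : ℝ) • h := by
    rw [hθd, hθs, hd, hs]
    simp only [add_lie, lie_add, sub_lie, lie_sub, t.lie_e_f, h1', hff]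
    module
  have hds : ⁅θ s, d⁆ = 0 := by
    rw [← lie_skew, neg_eq_zero, hθs, hd]
    simp only [add_lie, lie_sub, t.lie_e_f, h1', hff]
    abel
  have hhd : ⁅h, d⁆ = (2 : ℝ) • d := by rw [hd, lie_add, t.lie_h_e, h2, smul_add]
  have h3 : (8 : ℝ) * ip θ (killingForm ℝ L) d d =
      ip θ (killingForm ℝ L) ⁅⁅d, θ d⁆, d⁆ d - ip θ (killingForm ℝ L) ⁅⁅s, θ s⁆, d⁆ d := by
    have h4 : ⁅⁅d, θ d⁆, d⁆ - ⁅⁅s, θ s⁆, d⁆ = (8 : ℝ) • d := by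
      rw [← sub_lie, hdd, smul_lie, hhd, smul_smul]
      norm_num
    rw [← ipForm_apply, ← ipForm_apply, ← ipForm_apply, ← LinearMap.map_sub₂, h4, map_smul,
      LinearMap.smul_apply, smul_eq_mul]
  have h5 : ip θ (killingForm ℝ L) ⁅⁅d, θ d⁆, d⁆ d = -ip θ (killingForm ℝ L) ⁅d, θ d⁆ ⁅d, θ d⁆ := by
    rw [← lie_skew, ← ipForm_apply, map_neg, LinearMap.neg_apply, ipForm_apply,
      ip_lie_left hθ.involutive hκ, neg_neg, ip_comm hθ.involutive hκ, ip, ip, LieEquiv.map_lie,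
      ← lie_skew (θ d) d, map_neg, LinearMap.neg_apply]
  have h6 : ip θ (killingForm ℝ L) ⁅⁅s, θ s⁆, d⁆ d = ip θ (killingForm ℝ L) ⁅s, d⁆ ⁅s, d⁆ := by
    have h7 : ⁅⁅s, θ s⁆, d⁆ = -⁅θ s, ⁅s, d⁆⁆ := by rw [lie_lie, hds, lie_zero, zero_sub]
    rw [h7, ← ipForm_apply, map_neg, LinearMap.neg_apply, ipForm_apply,
      ip_lie_left hθ.involutive hκ, neg_neg, hθ.involutive]
  have h8 := ip_self_nonneg hθ hκ ⁅d, θ d⁆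
  have h9 := ip_self_nonneg hθ hκ ⁅s, d⁆
  have h10 := ip_self_nonneg hθ hκ d
  have hd0 : d = 0 := ip_self_eq_zero hθ hκ (by rw [h5, h6] at h3; linarith)
  exact eq_neg_of_add_eq_zero_right hd0

/-- On a nonempty closed set of pairs the length attains its minimum. -/
theorem exists_minimal_pair (hθ : IsCartanInvolution θ) {S : Set (L × L)} (hS : IsClosed S)
    (hne : S.Nonempty) : ∃ p ∈ S, ∀ q ∈ S,
      ip θ (killingForm ℝ L) p.1 p.1 + ip θ (killingForm ℝ L) p.2 p.2 ≤
        ip θ (killingForm ℝ L) q.1 q.1 + ip θ (killingForm ℝ L) q.2 q.2 := by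
  have hκ := hθ.isLooseKillingForm
  have hproper : ProperSpace (L × L) := FiniteDimensional.proper ℝ (L × L)
  obtain ⟨c, hc, hcle⟩ := exists_norm_sq_le_ip hθ hκ
  obtain ⟨p₀, hp₀⟩ := hne
  obtain ⟨N, hN⟩ : ∃ N : L × L → ℝ, ∀ p, N p =
      ip θ (killingForm ℝ L) p.1 p.1 + ip θ (killingForm ℝ L) p.2 p.2 := ⟨_, fun _ => rfl⟩
  have hNcont : Continuous N := by
    rw [funext hN]
    exact (continuous_ip.comp (continuous_fst.prodMk continuous_fst)).add
      (continuous_ip.comp (continuous_snd.prodMk continuous_snd))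
  have hNle : ∀ p, c * ‖p‖ ^ 2 ≤ N p := by
    intro p
    rw [Prod.norm_def, hN]
    have h1 := hcle p.1
    have h2 := hcle p.2
    have h3 := ip_self_nonneg hθ hκ p.1
    have h4 := ip_self_nonneg hθ hκ p.2
    rcases max_choice ‖p.1‖ ‖p.2‖ with h5 | h5 <;> rw [h5] <;> linarith
  have hfar : ∀ᶠ p in Filter.cocompact (L × L), N p₀ ≤ N p := by
    filter_upwards [(isCompact_closedBall (0 : L × L) (√(N p₀ / c))).compl_mem_cocompact]
      with p hp
    rw [Set.mem_compl_iff, mem_closedBall_zero_iff, not_le] at hp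
    have h1 := Real.lt_sq_of_sqrt_lt hp
    rw [div_lt_iff₀ hc] at h1
    have := hNle p
    linarith
  obtain ⟨p, hp, hmin⟩ := hNcont.continuousOn.exists_isMinOn' hS hp₀
    (hfar.filter_mono inf_le_left)
  refine ⟨p, hp, fun q hq => ?_⟩
  rw [← hN, ← hN]
  exact hmin hq

/-- A pair of minimal length in the orbit under the centralizer of `h` exists. -/
theorem IsNilpotentTriple.exists_minimal {h e f : L} (t : IsNilpotentTriple h e f)
    (hθ : IsCartanInvolution θ) :
    ∃ l ∈ adjointGroup L, l h = h ∧ ∀ l' ∈ adjointGroup L, l' h = h →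
      ip θ (killingForm ℝ L) (l e) (l e) + ip θ (killingForm ℝ L) (l f) (l f) ≤
        ip θ (killingForm ℝ L) (l' e) (l' e) + ip θ (killingForm ℝ L) (l' f) (l' f) := by
  have hne : (pairOrbit h e f).Nonempty :=
    ⟨(e, f), 1, one_mem_adjointGroup, rfl, rfl⟩
  obtain ⟨p, ⟨l, hl, hlh, hp⟩, hmin⟩ := exists_minimal_pair hθ t.isClosed_pairOrbit hne
  refine ⟨l, hl, hlh, fun l' hl' hlh' => ?_⟩
  have := hmin (l' e, l' f) ⟨l', hl', hlh', rfl⟩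
  rwa [hp] at this

/-- Every nilpotent orbit contains an element `e` for which `(e, -⁅e, θ e⁆, -θ e)` is an
`sl₂`-triple. -/
theorem exists_adapted (hθ : IsCartanInvolution θ) {e₀ : L}
    (he₀ : IsNilpotent (LieAlgebra.ad ℝ L e₀)) :
    ∃ g ∈ adjointGroup L, ⁅⁅g e₀, θ (g e₀)⁆, g e₀⁆ = -((2 : ℝ) • g e₀) := by
  have hkill := hθ.isKilling
  have hκ := hθ.isLooseKillingForm
  obtain ⟨h₀, f₀, h1, h2, h3⟩ := exists_sl2_triple he₀
  have t₀ : IsNilpotentTriple h₀ e₀ f₀ := ⟨he₀, h1, h2, h3⟩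
  obtain ⟨n, hn, hnθ, -⟩ := exists_unipotent_conj_anti hθ t₀.iSup_weightSpace
  have t₁ := t₀.map (adjointGroup_subset hn)
  obtain ⟨l, hl, hlh, hmin⟩ := t₁.exists_minimal hθ
  have t := t₁.map (adjointGroup_subset hl)
  rw [hlh] at t
  set h := n h₀
  set e := l (n e₀) with he
  set f := l (n f₀) with hf
  refine ⟨l * n, mul_mem_adjointGroup hl hn, ?_⟩
  rw [LinearEquiv.mul_apply, ← he]
  set Y := ⁅e, θ e⁆ + ⁅f, θ f⁆ with hY
  -- Vanishing of the first variation along the centralizer of `h`.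
  have hvar : ∀ x, ⁅h, x⁆ = 0 → killingForm ℝ L x Y = 0 := by
    intro x hx
    have hd1 := hasDerivAt_bilin_expEnd (ipForm θ (killingForm ℝ L)) (LieAlgebra.ad ℝ L x)
      (LieAlgebra.ad ℝ L x) e e
    have hd2 := hasDerivAt_bilin_expEnd (ipForm θ (killingForm ℝ L)) (LieAlgebra.ad ℝ L x)
      (LieAlgebra.ad ℝ L x) f f
    have hd := hd1.add hd2
    have hlm : IsLocalMin ((fun t : ℝ => ipForm θ (killingForm ℝ L)
        (expEnd (t • LieAlgebra.ad ℝ L x) e) (expEnd (t • LieAlgebra.ad ℝ L x) e)) +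
        fun t : ℝ => ipForm θ (killingForm ℝ L)
        (expEnd (t • LieAlgebra.ad ℝ L x) f) (expEnd (t • LieAlgebra.ad ℝ L x) f)) 0 := by
      refine Filter.Eventually.of_forall fun t => ?_
      have hth : expEquiv (t • x) h = h :=
        expEquiv_of_lie_eq_zero (by rw [← lie_skew, lie_smul, hx, smul_zero, neg_zero])
      have := hmin (expEquiv (t • x) * l) (mul_mem_adjointGroup (expEquiv_mem _) hl)
        (by rw [LinearEquiv.mul_apply, hlh, hth])
      simp only [Pi.add_apply, zero_smul, expEnd_zero, Module.End.one_apply]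
      rw [← map_smul]
      exact this
    have h4 := hlm.hasDerivAt_eq_zero hd
    have h5 : ∀ v : L, ipForm θ (killingForm ℝ L) (LieAlgebra.ad ℝ L x v) v =
        -killingForm ℝ L x ⁅v, θ v⁆ := by
      intro v
      rw [ipForm_apply, ip, LieAlgebra.ad_apply, ← lie_skew, map_neg, LinearMap.neg_apply,
        killingForm_lie, neg_neg]
    have h6 : ∀ v : L, ipForm θ (killingForm ℝ L) v (LieAlgebra.ad ℝ L x v) =
        -killingForm ℝ L x ⁅v, θ v⁆ := by
      intro v
      rw [ipForm_apply, ip_comm hθ.involutive hκ, ← ipForm_apply, h5]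
    rw [h5, h6, h5, h6] at h4
    rw [hY, map_add]
    linarith
  have hhθf : ⁅h, θ f⁆ = (2 : ℝ) • θ f := by
    have := congrArg θ t.lie_h_f
    rw [LieEquiv.map_lie, hnθ, map_neg, map_smul, neg_lie, neg_inj] at this
    exact this
  have hhθe : ⁅h, θ e⁆ = -((2 : ℝ) • θ e) := by
    have := congrArg θ t.lie_h_e
    rw [LieEquiv.map_lie, hnθ, map_smul, neg_lie, neg_eq_iff_eq_neg] at this
    exact this
  have hYh : ⁅h, Y⁆ = 0 := by
    rw [hY, lie_add, leibniz_lie, leibniz_lie h f, t.lie_h_e, t.lie_h_f, hhθe, hhθf]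
    simp only [smul_lie, lie_smul, lie_neg, neg_lie]
    abel
  have hYθ : θ Y = -Y := by
    rw [hY, map_add, LieEquiv.map_lie, LieEquiv.map_lie, hθ.involutive, hθ.involutive,
      ← lie_skew e, ← lie_skew f]
    abel
  have hY0 : Y = 0 := by
    refine ip_self_eq_zero hθ hκ ?_
    rw [ip, hYθ, map_neg, hvar Y hYh, neg_zero, neg_zero]
  have hfe := t.theta_eq_of_moment_eq_zero hθ hnθ hY0
  have hef : θ e = -f := by
    rw [← neg_eq_iff_eq_neg, ← map_neg, ← hfe, hθ.involutive]
  rw [hef, lie_neg, t.lie_e_f, neg_lie, t.lie_h_e]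

end Existence

/-! ### The moment map and its critical points -/

section MomentMap

attribute [local instance] basisNorm basisNormedSpace

variable {L : Type*} [LieRing L] [LieAlgebra ℝ L] {θ : L ≃ₗ⁅ℝ⁆ L}
  {B : LinearMap.BilinForm ℝ L}

theorem theta_lie_theta (hθ : ∀ x, θ (θ x) = x) (ζ : L) : θ ⁅ζ, θ ζ⁆ = -⁅ζ, θ ζ⁆ := by
  rw [LieEquiv.map_lie, hθ, lie_skew]

theorem normSq_smul (c : ℝ) (v : L) : normSq θ B (c • v) = c ^ 2 * normSq θ B v := by
  rw [normSq, normSq, ← ipForm_apply, ← ipForm_apply, map_smul, map_smul, LinearMap.smul_apply,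
    smul_eq_mul, smul_eq_mul]
  ring

variable [FiniteDimensional ℝ L]

/-- The variation of `‖ζ‖² / 2` in the direction `⁅η, ζ⁆`. -/
theorem ip_lie_self (hB : IsLooseKillingForm θ B) (hθ : ∀ x, θ (θ x) = x) (η ζ : L) :
    ip θ B ⁅η, ζ⁆ ζ = -ip θ B ⁅ζ, θ ζ⁆ η := by
  rw [ip_comm hθ hB ⁅ζ, θ ζ⁆, ip, ip, theta_lie_theta hθ, map_neg, neg_neg, ← lie_skew, map_neg,
    LinearMap.neg_apply, hB.lie, neg_neg]

/-- The moment map is `m(ζ) = -⁅ζ, θ ζ⁆ / ‖ζ‖²`. -/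
theorem moment_eq (hθ : IsCartanInvolution θ) (hB : IsLooseKillingForm θ B) (ζ : L) :
    moment θ B ζ = -((normSq θ B ζ)⁻¹ • ⁅ζ, θ ζ⁆) := by
  have hderiv : ∀ η : L, deriv (fun t : ℝ => normSq θ B (adExp (t • η) ζ)) 0 =
      -(2 * ip θ B ⁅ζ, θ ζ⁆ η) := by
    intro η
    have h1 := hasDerivAt_bilin_expEnd (ipForm θ B) (LieAlgebra.ad ℝ L η) (LieAlgebra.ad ℝ L η)
      ζ ζ
    rw [ipForm_apply, ipForm_apply, ip_comm hθ.involutive hB ζ, LieAlgebra.ad_apply,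
      ip_lie_self hB hθ.involutive] at h1
    have h2 : (fun t : ℝ => normSq θ B (adExp (t • η) ζ)) = fun t : ℝ =>
        ipForm θ B (expEnd (t • LieAlgebra.ad ℝ L η) ζ)
          (expEnd (t • LieAlgebra.ad ℝ L η) ζ) := by
      funext t
      rw [adExp_eq, map_smul]
      rfl
    rw [h2, h1.deriv]
    ring
  have hspec : ∀ η : L, ip θ B (-((normSq θ B ζ)⁻¹ • ⁅ζ, θ ζ⁆)) η =
      1 / (2 * normSq θ B ζ) * deriv (fun t : ℝ => normSq θ B (adExp (t • η) ζ)) 0 := by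
    intro η
    rw [hderiv, ← ipForm_apply, ← ipForm_apply, map_neg, map_smul, LinearMap.neg_apply,
      LinearMap.smul_apply, smul_eq_mul, one_div, mul_inv]
    ring
  have hm := Classical.epsilon_spec (p := fun m : L => ∀ η : L, ip θ B m η =
    1 / (2 * normSq θ B ζ) * deriv (fun t : ℝ => normSq θ B (adExp (t • η) ζ)) 0) ⟨_, hspec⟩
  rw [← sub_eq_zero]
  refine ip_self_eq_zero hθ hB ?_
  rw [← ipForm_apply, LinearMap.map_sub₂, ipForm_apply, ipForm_apply, hspec, sub_eq_zero]
  exact hm _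

theorem momentSq_eq (hθ : IsCartanInvolution θ) (hB : IsLooseKillingForm θ B) (ζ : L) :
    momentSq θ B ζ = normSq θ B ⁅ζ, θ ζ⁆ / normSq θ B ζ ^ 2 := by
  rw [momentSq, moment_eq hθ hB, ← neg_smul, normSq_smul, neg_sq, inv_pow, div_eq_inv_mul]

theorem normSq_pos (hθ : IsCartanInvolution θ) (hB : IsLooseKillingForm θ B) {x : L}
    (hx : x ≠ 0) : 0 < normSq θ B x := ip_pos hθ hB hx

/-- The derivative of `‖m‖²` along a curve through `ζ`. -/
theorem hasDerivAt_momentSq (hθ : IsCartanInvolution θ) (hB : IsLooseKillingForm θ B)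
    {γ : ℝ → L} {ζ w : L} {t : ℝ} (hγ : HasDerivAt γ w t) (hζ : γ t = ζ) (h0 : ζ ≠ 0) :
    HasDerivAt (fun t => momentSq θ B (γ t))
      (4 * ip θ B (normSq θ B ζ • ⁅ζ, ⁅ζ, θ ζ⁆⁆ - normSq θ B ⁅ζ, θ ζ⁆ • ζ) w /
        normSq θ B ζ ^ 3) t := by
  have hθγ : HasDerivAt (fun t => θ (γ t)) (θ w) t :=
    (LinearMap.toContinuousLinearMap (θ.toLinearEquiv : L →ₗ[ℝ] L)).hasFDerivAt.comp_hasDerivAt t hγ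
  have hM : HasDerivAt (fun t => ⁅γ t, θ (γ t)⁆) (⁅w, θ (γ t)⁆ + ⁅γ t, θ w⁆) t :=
    hasDerivAt_bilin (LieAlgebra.ad ℝ L : L →ₗ[ℝ] Module.End ℝ L) hγ hθγ
  have hN := hasDerivAt_bilin (ipForm θ B) hγ hγ
  have hNM := hasDerivAt_bilin (ipForm θ B) hM hM
  rw [hζ] at hN hNM
  have hpos := normSq_pos hθ hB h0
  have hsw : ip θ B w ζ = ip θ B ζ w := ip_comm hθ.involutive hB _ _
  have hsM : ∀ y : L, ip θ B y ⁅ζ, θ ζ⁆ = ip θ B ⁅ζ, θ ζ⁆ y :=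
    fun y => ip_comm hθ.involutive hB _ _
  have h1 : ip θ B ⁅ζ, θ ζ⁆ ⁅w, θ ζ⁆ = ip θ B ⁅ζ, ⁅ζ, θ ζ⁆⁆ w := by
    rw [ip_lie_left hθ.involutive hB ζ ⁅ζ, θ ζ⁆, ← lie_skew w, ← ipForm_apply, map_neg]
    rfl
  have h2 : ip θ B ⁅ζ, θ ζ⁆ ⁅ζ, θ w⁆ = ip θ B ⁅ζ, ⁅ζ, θ ζ⁆⁆ w := by
    rw [← ip_theta hB, theta_lie_theta hθ.involutive, LieEquiv.map_lie, hθ.involutive,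
      ← ipForm_apply, LinearMap.map_neg₂, ip_lie_left hθ.involutive hB ζ ⁅ζ, θ ζ⁆]
    rfl
  have hder := hNM.div (hN.pow 2) (by
    change ipForm θ B (γ t) (γ t) ^ 2 ≠ 0
    rw [hζ]
    exact pow_ne_zero 2 hpos.ne')
  have hfun : (fun t => momentSq θ B (γ t)) = (fun t => ipForm θ B ⁅γ t, θ (γ t)⁆
      ⁅γ t, θ (γ t)⁆) / ((fun t => ipForm θ B (γ t) (γ t)) ^ 2) :=
    funext fun t => momentSq_eq hθ hB _
  rw [hfun]
  refine hder.congr_deriv (Eq.symm ?_)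
  simp only [Pi.pow_apply, hζ]
  rw [← ipForm_apply, map_sub, map_smul, map_smul, LinearMap.sub_apply, LinearMap.smul_apply,
    LinearMap.smul_apply, smul_eq_mul, smul_eq_mul, map_add, LinearMap.add_apply, map_add]
  simp only [ipForm_apply, hsM, h1, h2, hsw]
  have h3 : ip θ B ζ ζ = normSq θ B ζ := rfl
  have h4 : ip θ B ⁅ζ, θ ζ⁆ ⁅ζ, θ ζ⁆ = normSq θ B ⁅ζ, θ ζ⁆ := rfl
  rw [h3, h4]
  field_simp
  ring

/-- A curve all of whose linear coordinates are smooth is differentiable. -/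
theorem exists_hasDerivAt_of_dual {γ : ℝ → L}
    (hγ : ∀ φ : Module.Dual ℝ L, ContDiff ℝ ∞ fun t => φ (γ t)) (t : ℝ) :
    ∃ w, HasDerivAt γ w t := by
  let b := Module.finBasis ℝ L
  have h1 : γ = fun t => ∑ i, b.coord i (γ t) • b i := funext fun t => (b.sum_repr (γ t)).symm
  have h2 : DifferentiableAt ℝ (fun t => ∑ i, b.coord i (γ t) • b i) t :=
    DifferentiableAt.fun_sum fun i _ =>
      ((hγ (b.coord i)).differentiable (by simp)).differentiableAt.smul_const (b i)
  rw [← h1] at h2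
  exact ⟨_, h2.hasDerivAt⟩

/-- A minimum of `‖m‖²` on an orbit avoiding `0` is a critical point. -/
theorem isCriticalOn_of_forall_le (hθ : IsCartanInvolution θ) (hB : IsLooseKillingForm θ B)
    {O : Set L} {ζ : L} (hζ : ζ ∈ O) (h0 : ζ ≠ 0)
    (hmin : ∀ ξ ∈ O, momentSq θ B ζ ≤ momentSq θ B ξ) : IsCriticalOn (momentSq θ B) O ζ := by
  refine ⟨hζ, fun γ hγ hγO hγ0 => ?_⟩
  obtain ⟨w, hw⟩ := exists_hasDerivAt_of_dual hγ 0
  have h1 := hasDerivAt_momentSq hθ hB hw hγ0 h0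
  have h2 : IsLocalMin (fun t => momentSq θ B (γ t)) 0 :=
    Filter.Eventually.of_forall fun t => by
      change momentSq θ B (γ 0) ≤ _
      rw [hγ0]
      exact hmin _ (hγO t)
  rwa [h2.hasDerivAt_eq_zero h1] at h1

/-- At a critical point `⁅⁅ζ, θ ζ⁆, ζ⁆` is a negative multiple of `ζ`: the gradient of
`‖m‖²` is orthogonal to the tangent space `[L, ζ]` of the orbit, but also lies in it, because
`ζ ∈ [L, ζ]`. -/
theorem exists_eq_smul_of_isCriticalOn (hθ : IsCartanInvolution θ) (hB : IsLooseKillingForm θ B)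
    {O : Set L} (hO : ∀ g ∈ adjointGroup L, ∀ ζ ∈ O, g ζ ∈ O) {ζ : L} (h0 : ζ ≠ 0)
    (hnil : IsNilpotent (LieAlgebra.ad ℝ L ζ)) (hcrit : IsCriticalOn (momentSq θ B) O ζ) :
    ∃ a : ℝ, a < 0 ∧ ⁅⁅ζ, θ ζ⁆, ζ⁆ = a • ζ := by
  have hkill := hθ.isKilling
  have hpos := normSq_pos hθ hB h0
  obtain ⟨h, -, hh, -, -⟩ := exists_sl2_triple hnil
  set u := normSq θ B ζ • ⁅ζ, ⁅ζ, θ ζ⁆⁆ - normSq θ B ⁅ζ, θ ζ⁆ • ζ with hu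
  have horth : ∀ η : L, ip θ B u ⁅η, ζ⁆ = 0 := by
    intro η
    have hγ0 : expEnd ((0 : ℝ) • LieAlgebra.ad ℝ L η) ζ = ζ := by
      rw [zero_smul, expEnd_zero, Module.End.one_apply]
    have hd := hasDerivAt_expEnd_smul_apply (LieAlgebra.ad ℝ L η) ζ 0
    rw [zero_smul, expEnd_zero, Module.End.one_apply, LieAlgebra.ad_apply] at hd
    have h1 := hasDerivAt_momentSq hθ hB hd hγ0 h0
    have h2 := hcrit.2 (fun t : ℝ => expEnd (t • LieAlgebra.ad ℝ L η) ζ)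
      (fun φ => (LinearMap.toContinuousLinearMap φ).contDiff.comp
        (contDiff_expEnd_smul_apply (LieAlgebra.ad ℝ L η) ζ))
      (fun t => by
        rw [← map_smul]
        exact hO _ (expEquiv_mem (t • η)) ζ hcrit.1) hγ0
    have h3 := h1.unique h2
    rw [div_eq_zero_iff, or_iff_left (pow_ne_zero 3 hpos.ne')] at h3
    exact (mul_eq_zero.1 h3).resolve_left four_ne_zero
  have hu0 : u = 0 := by
    have h1 : u = ⁅-(normSq θ B ζ • ⁅ζ, θ ζ⁆) - (normSq θ B ⁅ζ, θ ζ⁆ / 2) • h, ζ⁆ := by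
      rw [hu, sub_lie, neg_lie, smul_lie, smul_lie, hh, ← lie_skew ζ]
      module
    refine ip_self_eq_zero hθ hB ?_
    have h2 := horth (-(normSq θ B ζ • ⁅ζ, θ ζ⁆) - (normSq θ B ⁅ζ, θ ζ⁆ / 2) • h)
    rwa [← h1] at h2
  have hM : ⁅ζ, θ ζ⁆ ≠ 0 := by
    intro hM
    have h1 := ip_lie_self hB hθ.involutive h ζ
    rw [hM, hh, ← ipForm_apply, ← ipForm_apply, map_smul, map_zero, LinearMap.smul_apply,
      smul_eq_mul, LinearMap.zero_apply, neg_zero, mul_eq_zero, or_iff_right two_ne_zero] at h1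
    exact hpos.ne' h1
  refine ⟨-(normSq θ B ⁅ζ, θ ζ⁆ / normSq θ B ζ),
    neg_neg_of_pos (div_pos (normSq_pos hθ hB hM) hpos), ?_⟩
  rw [hu, sub_eq_zero] at hu0
  rw [← lie_skew, neg_smul, neg_inj, div_eq_inv_mul, mul_smul, ← hu0, smul_smul,
    inv_mul_cancel₀ hpos.ne', one_smul]

end MomentMap

/-! ### The minimum of the squared norm of the moment map -/

section Minimum

variable {L : Type*} [LieRing L] [LieAlgebra ℝ L] {θ : L ≃ₗ⁅ℝ⁆ L}
  {B : LinearMap.BilinForm ℝ L}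

/-- The length of an element of the `(-1)`-eigenspace of `θ` is determined by its conjugacy
class. -/
theorem normSq_eq_of_anti (hB : IsLooseKillingForm θ B) {h : L} (hh : θ h = -h) {g : L ≃ₗ[ℝ] L}
    (hg : g ∈ adjointGroup L) (hgh : θ (g h) = -g h) : normSq θ B (g h) = normSq θ B h := by
  rw [normSq, normSq, ip, ip, hh, hgh, map_neg, map_neg, hB.invariant g hg]

/-- `e` is a nonzero solution of the critical equation `⁅⁅e, θ e⁆, e⁆ = a e` with `a < 0`. The
equation for `θ e` follows by applying `θ`. -/
structure IsSolution (θ : L ≃ₗ⁅ℝ⁆ L) (e : L) (a : ℝ) : Prop where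
  ne_zero : e ≠ 0
  neg : a < 0
  lie_eq : ⁅⁅e, θ e⁆, e⁆ = a • e

/-- The semisimple element `2 ⁅e, θ e⁆ / a`, the neutral element of an `sl₂`-triple containing the
solution `e` of the critical equation. -/
noncomputable def neutral (θ : L ≃ₗ⁅ℝ⁆ L) (e : L) (a : ℝ) : L := (2 / a) • ⁅e, θ e⁆

namespace IsSolution

variable {e : L} {a : ℝ}

theorem theta_neutral (hθ : ∀ x, θ (θ x) = x) : θ (neutral θ e a) = -neutral θ e a := by
  rw [neutral, map_smul, theta_lie_theta hθ, smul_neg]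

theorem lie_neutral (he : IsSolution θ e a) : ⁅neutral θ e a, e⁆ = (2 : ℝ) • e := by
  rw [neutral, smul_lie, he.lie_eq, smul_smul, div_mul_cancel₀ _ he.neg.ne]

theorem lie_theta_eq_smul_neutral (he : IsSolution θ e a) :
    ⁅e, θ e⁆ = (a / 2) • neutral θ e a := by
  rw [neutral, smul_smul, div_mul_div_cancel₀ two_ne_zero, div_self he.neg.ne, one_smul]

end IsSolution

variable [FiniteDimensional ℝ L]

/-- Eigenvectors of `ad x` with distinct eigenvalues are orthogonal if `θ x = -x`. -/
theorem ip_weightSpace (hθ : ∀ x, θ (θ x) = x) (hB : IsLooseKillingForm θ B) {x v w : L}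
    (hx : θ x = -x) {s t : ℝ} (hv : ⁅x, v⁆ = s • v) (hw : ⁅x, w⁆ = t • w) (hst : s ≠ t) :
    ipForm θ B v w = 0 := by
  have h1 : ipForm θ B ⁅x, v⁆ w = ipForm θ B v ⁅x, w⁆ := ip_lie_symm hθ hB hx v w
  rw [hv, hw, map_smul, map_smul, LinearMap.smul_apply, smul_eq_mul, smul_eq_mul, ← sub_eq_zero,
    ← sub_mul, mul_eq_zero] at h1
  exact h1.resolve_left (sub_ne_zero.2 hst)

/-- On the sum of the eigenspaces of `ad h` for eigenvalues at least `c`, the symmetric operator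
`ad h` is bounded below by `c`, with equality only on the eigenspace of `c`. -/
theorem mul_normSq_le_ip_lie (hθ : IsCartanInvolution θ) (hB : IsLooseKillingForm θ B) {h ζ : L}
    (hh : θ h = -h) {c : ℝ} (hζ : ζ ∈ weightSup h (Set.Ici c)) :
    c * normSq θ B ζ ≤ ip θ B ⁅h, ζ⁆ ζ ∧
      (ip θ B ⁅h, ζ⁆ ζ = c * normSq θ B ζ → ⁅h, ζ⁆ = c • ζ) := by
  obtain ⟨I, f, hf, rfl⟩ := exists_eq_sum_of_mem_iSup hζ
  have hf' : ∀ s, ⁅h, f s⁆ = s • f s ∧ (f s ≠ 0 → c ≤ s) := by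
    intro s
    have h1 := hf s
    by_cases hs : s ∈ Set.Ici c
    · simp only [hs, iSup_pos] at h1
      exact ⟨mem_weightSpace.1 h1, fun _ => hs⟩
    · simp only [hs, iSup_neg, not_false_eq_true, Submodule.mem_bot] at h1
      exact ⟨by rw [h1, lie_zero, smul_zero], fun h0 => absurd h1 h0⟩
  have hlie : ⁅h, ∑ s ∈ I, f s⁆ - c • ∑ s ∈ I, f s = ∑ s ∈ I, (s - c) • f s := by
    rw [lie_sum, Finset.smul_sum, ← Finset.sum_sub_distrib]
    exact Finset.sum_congr rfl fun s _ => by rw [(hf' s).1, sub_smul]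
  have hsum : ip θ B ⁅h, ∑ s ∈ I, f s⁆ (∑ s ∈ I, f s) - c * normSq θ B (∑ s ∈ I, f s) =
      ∑ s ∈ I, (s - c) * normSq θ B (f s) := by
    have h1 : ipForm θ B (⁅h, ∑ s ∈ I, f s⁆ - c • ∑ s ∈ I, f s) (∑ s ∈ I, f s) =
        ∑ s ∈ I, ipForm θ B ((s - c) • f s) (f s) := by
      rw [hlie]
      refine bilin_sum_sum_of_orthogonal _ _ _ _ fun s t hst => ?_
      rw [map_smul, LinearMap.smul_apply,
        ip_weightSpace hθ.involutive hB hh (hf' s).1 (hf' t).1 hst, smul_zero]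
    simp only [map_sub, LinearMap.sub_apply, map_smul, LinearMap.smul_apply, smul_eq_mul] at h1
    exact h1
  have hterm : ∀ s ∈ I, 0 ≤ (s - c) * normSq θ B (f s) := by
    intro s _
    by_cases h0 : f s = 0
    · rw [h0, normSq, ← ipForm_apply, map_zero, mul_zero]
    · exact mul_nonneg (sub_nonneg.2 ((hf' s).2 h0)) (ip_self_nonneg hθ hB _)
  refine ⟨sub_nonneg.1 (hsum ▸ Finset.sum_nonneg hterm), fun heq => ?_⟩
  rw [heq, sub_self] at hsum
  have h1 := (Finset.sum_eq_zero_iff_of_nonneg hterm).1 hsum.symm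
  rw [← sub_eq_zero, hlie]
  refine Finset.sum_eq_zero fun s hs => ?_
  obtain h2 | h2 := mul_eq_zero.1 (h1 s hs)
  · rw [h2, zero_smul]
  · rw [ip_self_eq_zero hθ hB h2, smul_zero]

/-- If `θ x = -x`, the function `t ↦ ‖exp(t ad x) e‖²` is convex, and strictly so unless `x`
commutes with `e`; hence its derivative cannot vanish at both `0` and `1`. -/
theorem lie_eq_zero_of_ip_lie (hθ : IsCartanInvolution θ) (hB : IsLooseKillingForm θ B) {x e : L}
    (hx : θ x = -x) (h0 : ip θ B ⁅x, e⁆ e = 0)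
    (h1 : ip θ B ⁅x, expEquiv x e⁆ (expEquiv x e) = 0) : ⁅x, e⁆ = 0 := by
  have htop := iSup_eigenspace_eq_top_of_symm (β := ipForm θ B) (T := LieAlgebra.ad ℝ L x)
    (ip_comm hθ.involutive hB) (fun y hy => ip_pos hθ hB hy)
    (fun y z => ip_lie_symm hθ.involutive hB hx y z)
  obtain ⟨I, f, hf, rfl⟩ := exists_eq_sum_of_mem_iSup (htop ▸ Submodule.mem_top : e ∈ _)
  have hf' : ∀ s, ⁅x, f s⁆ = s • f s := fun s => mem_weightSpace.1 (hf s)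
  have hlie : ⁅x, ∑ s ∈ I, f s⁆ = ∑ s ∈ I, s • f s := by
    rw [lie_sum]
    exact Finset.sum_congr rfl fun s _ => hf' s
  have hexp : expEquiv x (∑ s ∈ I, f s) = ∑ s ∈ I, Real.exp s • f s := by
    rw [map_sum]
    exact Finset.sum_congr rfl fun s _ => expEquiv_of_lie_eq_smul (hf' s)
  have hlie' : ⁅x, ∑ s ∈ I, Real.exp s • f s⁆ = ∑ s ∈ I, (Real.exp s * s) • f s := by
    rw [lie_sum]
    exact Finset.sum_congr rfl fun s _ => by rw [lie_smul, hf' s, smul_smul]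
  have hsum : ∀ p q : ℝ → ℝ, ipForm θ B (∑ s ∈ I, p s • f s) (∑ s ∈ I, q s • f s) =
      ∑ s ∈ I, p s * q s * normSq θ B (f s) := by
    intro p q
    rw [bilin_sum_sum_of_orthogonal (ipForm θ B) I (fun s => p s • f s) (fun s => q s • f s)]
    · refine Finset.sum_congr rfl fun s _ => ?_
      have h1 : ipForm θ B (f s) (f s) = normSq θ B (f s) := rfl
      rw [map_smul, map_smul, LinearMap.smul_apply, smul_eq_mul, smul_eq_mul, h1]
      ring
    · intro s t hst
      rw [map_smul, map_smul, LinearMap.smul_apply,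
        ip_weightSpace hθ.involutive hB hx (hf' s) (hf' t) hst, smul_zero, smul_zero]
  have h2 := hsum (fun s => s) (fun _ => 1)
  simp only [one_smul, mul_one, ← hlie] at h2
  have h3 := hsum (fun s => Real.exp s * s) Real.exp
  rw [← hlie', ← hexp, ipForm_apply, h1] at h3
  rw [ipForm_apply, h0] at h2
  have h4 : ∑ s ∈ I, s * (Real.exp s * Real.exp s - 1) * normSq θ B (f s) = 0 := by
    rw [← sub_self (0 : ℝ)]
    nth_rewrite 1 [h3]
    rw [h2, ← Finset.sum_sub_distrib]
    exact Finset.sum_congr rfl fun s _ => by ring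
  have h5 : ∀ s : ℝ, s ≠ 0 → 0 < s * (Real.exp s * Real.exp s - 1) := by
    intro s hs
    obtain hs | hs := hs.lt_or_gt
    · have := Real.exp_lt_one_iff.2 hs
      have := Real.exp_pos s
      exact mul_pos_of_neg_of_neg hs (by nlinarith)
    · have := Real.one_lt_exp_iff.2 hs
      exact mul_pos hs (by nlinarith)
  have hterm : ∀ s ∈ I, 0 ≤ s * (Real.exp s * Real.exp s - 1) * normSq θ B (f s) := by
    intro s _
    by_cases hs : s = 0
    · rw [hs, zero_mul, zero_mul]
    · exact mul_nonneg (h5 s hs).le (ip_self_nonneg hθ hB _)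
  rw [hlie]
  refine Finset.sum_eq_zero fun s hs => ?_
  by_cases hs0 : s = 0
  · rw [hs0, zero_smul]
  · have h6 := (Finset.sum_eq_zero_iff_of_nonneg hterm).1 h4 s hs
    rw [ip_self_eq_zero hθ hB ((mul_eq_zero.1 h6).resolve_left (h5 s hs0).ne'), smul_zero]

namespace IsSolution

variable {e : L} {a : ℝ}

theorem normSq_lie_theta (he : IsSolution θ e a) (hθ : IsCartanInvolution θ)
    (hB : IsLooseKillingForm θ B) : normSq θ B ⁅e, θ e⁆ = -a * normSq θ B e := by
  have h1 := ip_lie_self hB hθ.involutive ⁅e, θ e⁆ e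
  rw [he.lie_eq, ← ipForm_apply, map_smul, LinearMap.smul_apply, smul_eq_mul] at h1
  have h2 : a * normSq θ B e = -normSq θ B ⁅e, θ e⁆ := h1
  linarith

theorem normSq_neutral (he : IsSolution θ e a) (hθ : IsCartanInvolution θ)
    (hB : IsLooseKillingForm θ B) : normSq θ B (neutral θ e a) = 4 * normSq θ B e / -a := by
  rw [neutral, normSq_smul, he.normSq_lie_theta hθ hB]
  have := he.neg.ne
  field_simp
  ring

theorem normSq_neutral_pos (he : IsSolution θ e a) (hθ : IsCartanInvolution θ)
    (hB : IsLooseKillingForm θ B) : 0 < normSq θ B (neutral θ e a) := by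
  rw [he.normSq_neutral hθ hB]
  exact div_pos (mul_pos four_pos (normSq_pos hθ hB he.ne_zero)) (neg_pos.2 he.neg)

theorem momentSq_eq (he : IsSolution θ e a) (hθ : IsCartanInvolution θ)
    (hB : IsLooseKillingForm θ B) : momentSq θ B e = 4 / normSq θ B (neutral θ e a) := by
  rw [NilpotentOrbit.momentSq_eq hθ hB, he.normSq_neutral hθ hB, he.normSq_lie_theta hθ hB]
  have := he.neg.ne
  have := (normSq_pos hθ hB he.ne_zero).ne'
  field_simp

theorem iSup_weightSpace_neutral (hθ : IsCartanInvolution θ) :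
    ⨆ s, weightSpace (neutral θ e a) s = ⊤ :=
  iSup_eigenspace_eq_top_of_symm (β := ipForm θ (killingForm ℝ L))
    (T := LieAlgebra.ad ℝ L (neutral θ e a))
    (ip_comm hθ.involutive hθ.isLooseKillingForm)
    (fun _ hy => ip_pos hθ hθ.isLooseKillingForm hy)
    (fun y z => ip_lie_symm hθ.involutive hθ.isLooseKillingForm (theta_neutral hθ.involutive) y z)

/-- A solution of the critical equation minimizes `‖m‖²` on its orbit. If the minimum is
also attained at `g e`, the conjugating element can be chosen so that it moves the neutral element
of `e` to a multiple of `⁅g e, θ (g e)⁆`. -/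
theorem momentSq_le (he : IsSolution θ e a) (hθ : IsCartanInvolution θ)
    (hB : IsLooseKillingForm θ B) {g : L ≃ₗ[ℝ] L} (hg : g ∈ adjointGroup L) :
    momentSq θ B e ≤ momentSq θ B (g e) ∧ (momentSq θ B (g e) = momentSq θ B e →
      ∃ g' ∈ adjointGroup L, g' e = g e ∧ θ (g' (neutral θ e a)) = -g' (neutral θ e a) ∧
        ∃ c : ℝ, ⁅g e, θ (g e)⁆ = c • g' (neutral θ e a)) := by
  have haut := adjointGroup_subset hg
  obtain ⟨n, hn, hnθ, hfil⟩ := exists_unipotent_conj_anti hθ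
    (iSup_weightSpace_map haut (iSup_weightSpace_neutral (e := e) (a := a) hθ))
  have hng := mul_mem_adjointGroup hn hg
  have hζ0 : g e ≠ 0 := fun h => he.ne_zero (g.map_eq_zero_iff.1 h)
  have hζpos := normSq_pos hθ hB hζ0
  have hgh : ⁅g (neutral θ e a), g e⁆ = (2 : ℝ) • g e := by
    rw [← haut, he.lie_neutral, map_smul]
  obtain ⟨hζ, hζ'⟩ := hfil 2 (g e)
    (weightSpace_le_weightSup _ Set.self_mem_Ici (mem_weightSpace.2 hgh))
  have hnorm : normSq θ B (n (g (neutral θ e a))) = normSq θ B (neutral θ e a) :=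
    normSq_eq_of_anti hB (theta_neutral hθ.involutive) hng hnθ
  obtain ⟨hle, heq⟩ := mul_normSq_le_ip_lie hθ hB hnθ hζ
  have hnh : ⁅n (g (neutral θ e a)), n (g e)⁆ = (2 : ℝ) • n (g e) := by
    rw [← adjointGroup_subset hn, hgh, map_smul]
  have hrw : ∀ v, n (g v) = (n * g) v := fun _ => rfl
  set h' := n (g (neutral θ e a)) with hh'
  set H := normSq θ B (neutral θ e a) with hH
  have hHpos : 0 < H := he.normSq_neutral_pos hθ hB
  have hm : ip θ B (moment θ B (g e)) h' * normSq θ B (g e) = ip θ B ⁅h', g e⁆ (g e) := by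
    rw [moment_eq hθ hB, ip_lie_self hB hθ.involutive, ← ipForm_apply, map_neg, map_smul,
      LinearMap.neg_apply, LinearMap.smul_apply, smul_eq_mul, ipForm_apply]
    field_simp
  -- Expand `‖m - (2 / H) h'‖²`; the pairing of `m` with `h'` is at least `2`.
  have hexpand : normSq θ B (moment θ B (g e) - (2 / H) • h') =
      momentSq θ B (g e) - 4 / H * ip θ B (moment θ B (g e)) h' + 4 / H := by
    have h1 : normSq θ B h' = H := hnorm
    rw [normSq, ← ipForm_apply] at h1
    rw [normSq, ← ipForm_apply, map_sub, map_sub, LinearMap.sub_apply, LinearMap.sub_apply,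
      map_smul, map_smul, LinearMap.smul_apply, LinearMap.smul_apply, map_smul, h1,
      ipForm_apply, ipForm_apply, ipForm_apply, ip_comm hθ.involutive hB h', momentSq, normSq]
    simp only [smul_eq_mul]
    field_simp
    ring
  have hpair : 2 ≤ ip θ B (moment θ B (g e)) h' := by
    refine le_of_mul_le_mul_right ?_ hζpos
    rwa [hm]
  have hnn : 0 ≤ normSq θ B (moment θ B (g e) - (2 / H) • h') := ip_self_nonneg hθ hB _
  have h4H : 0 < 4 / H := div_pos four_pos hHpos
  rw [he.momentSq_eq hθ hB]
  refine ⟨by nlinarith, fun hmin => ?_⟩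
  have hpair' : ip θ B (moment θ B (g e)) h' = 2 := by
    rw [hexpand, hmin] at hnn
    have h1 : 0 ≤ 4 / H * (2 - ip θ B (moment θ B (g e)) h') := by linarith
    have h2 := nonneg_of_mul_nonneg_right h1 h4H
    linarith
  have hzero : moment θ B (g e) - (2 / H) • h' = 0 := by
    refine ip_self_eq_zero hθ hB ?_
    change normSq θ B _ = 0
    rw [hexpand, hmin, hpair']
    ring
  have hwt : ⁅h', g e⁆ = (2 : ℝ) • g e := heq (by rw [← hm, hpair'])
  have hfix : n (g e) = g e := by
    rw [← sub_eq_zero]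
    refine weightSpace_inf_weightSup_Ioi h' (mem_weightSpace.2 ?_) hζ'
    rw [lie_sub, hnh, hwt, smul_sub]
  refine ⟨n * g, hng, hfix, hnθ, -(normSq θ B (g e) * (2 / H)), ?_⟩
  rw [moment_eq hθ hB, sub_eq_zero] at hzero
  rw [← hrw, ← hh', neg_smul, mul_smul, ← hzero, smul_neg, neg_neg, smul_smul,
    mul_inv_cancel₀ hζpos.ne', one_smul]

/-- Uniqueness up to `K_ℝ` and scaling of the points where the minimum is attained. The polar
decomposition `g = k exp(ad x)` has `x` commuting with the neutral element, and the convexity of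
`t ↦ ‖exp(t ad x) e‖²`, after removing the scaling part of `x`, shows that `x` commutes with `e`. -/
theorem exists_smul_eq (he : IsSolution θ e a) (hθ : IsCartanInvolution θ)
    (hB : IsLooseKillingForm θ B) {g : L ≃ₗ[ℝ] L} (hg : g ∈ adjointGroup L)
    (hgθ : θ (g (neutral θ e a)) = -g (neutral θ e a)) {c : ℝ}
    (hgc : ⁅g e, θ (g e)⁆ = c • g (neutral θ e a)) :
    ∃ k ∈ thetaFixer θ, ∃ r : ℝ, 0 < r ∧ g e = r • k e := by
  have hhθ : θ (neutral θ e a) = -neutral θ e a := theta_neutral hθ.involutive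
  have hHpos := he.normSq_neutral_pos hθ hB
  have hM := he.lie_theta_eq_smul_neutral
  have hhe := he.lie_neutral
  set h := neutral θ e a
  obtain ⟨k, hk, x, hx, hgk, hcomm⟩ := exists_polar hθ hg
  have hkaut := adjointGroup_subset hk.1
  have hxh : ⁅x, h⁆ = 0 := hcomm h (by rw [hgθ, hhθ, map_neg])
  -- Remove from `x` its component along `h`, which only rescales `e`.
  set s := ip θ B x h / normSq θ B h with hs
  set y := x - s • h with hy
  have hyθ : θ y = -y := by
    rw [hy, map_sub, map_smul, hx, hhθ]
    module
  have hyh : ip θ B h y = 0 := by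
    have h1 : ip θ B h h = normSq θ B h := rfl
    rw [hy, ← ipForm_apply, map_sub, map_smul, ipForm_apply, ipForm_apply, h1, smul_eq_mul, hs,
      div_mul_cancel₀ _ hHpos.ne', ip_comm hθ.involutive hB, sub_self]
  have hyh' : ⁅y, s • h⁆ = 0 := by
    rw [hy, sub_lie, lie_smul, smul_lie, lie_smul, hxh, lie_self, smul_zero, smul_zero,
      sub_self]
  have hexp : expEquiv x e = Real.exp (s * 2) • expEquiv y e := by
    have h1 : x = y + s • h := by rw [hy, sub_add_cancel]
    have h2 : ⁅s • h, e⁆ = (s * 2) • e := by rw [smul_lie, hhe, smul_smul]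
    rw [h1, expEquiv_add_of_lie_eq_zero hyh', expEquiv_of_lie_eq_smul h2, map_smul]
  have hr : 0 < Real.exp (s * 2) := Real.exp_pos _
  set r := Real.exp (s * 2)
  have hge : g e = r • k (expEquiv y e) := by rw [hgk, hexp, map_smul]
  have hgh : g h = k h := by rw [hgk, expEquiv_of_lie_eq_zero hxh]
  have hM' : (r * r) • ⁅expEquiv y e, θ (expEquiv y e)⁆ = c • h := by
    rw [hge, hgh, map_smul, smul_lie, lie_smul, ← hk.2, ← hkaut, smul_smul, ← map_smul,
      ← map_smul] at hgc
    exact k.injective hgc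
  have hye : ⁅y, e⁆ = 0 := by
    refine lie_eq_zero_of_ip_lie hθ hB hyθ ?_ ?_
    · rw [ip_lie_self hB hθ.involutive, hM, ← ipForm_apply, map_smul, LinearMap.smul_apply,
        ipForm_apply, hyh, smul_zero, neg_zero]
    · rw [ip_lie_self hB hθ.involutive, neg_eq_zero]
      have h1 : r * r * ip θ B ⁅expEquiv y e, θ (expEquiv y e)⁆ y = 0 := by
        rw [← ipForm_apply, ← smul_eq_mul, ← LinearMap.smul_apply, ← map_smul, hM', map_smul,
          LinearMap.smul_apply, ipForm_apply, hyh, smul_zero]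
      exact (mul_eq_zero.1 h1).resolve_left (mul_pos hr hr).ne'
  refine ⟨k, hk, r, hr, ?_⟩
  rw [hge, expEquiv_of_lie_eq_zero hye]

/-- The group `K_ℝ × ℝ⁺` acts on the solutions of the critical equation, inside the orbit. -/
theorem smul_apply (he : IsSolution θ e a) {k : L ≃ₗ[ℝ] L} (hk : k ∈ thetaFixer θ) {c : ℝ}
    (hc : 0 < c) : IsSolution θ (c • k e) (c * c * a) ∧ ∃ g ∈ adjointGroup L, c • k e = g e := by
  have hkaut := adjointGroup_subset hk.1
  refine ⟨⟨smul_ne_zero hc.ne' fun h => he.ne_zero (k.map_eq_zero_iff.1 h),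
    mul_neg_of_pos_of_neg (mul_pos hc hc) he.neg, ?_⟩,
    k * expEquiv ((Real.log c / 2) • neutral θ e a), mul_mem_adjointGroup hk.1 (expEquiv_mem _), ?_⟩
  · rw [map_smul, ← hk.2]
    simp only [smul_lie, lie_smul]
    rw [← hkaut, ← hkaut, he.lie_eq, map_smul]
    module
  · rw [LinearEquiv.mul_apply, expEquiv_of_lie_eq_smul (c := Real.log c), Real.exp_log hc, map_smul]
    rw [smul_lie, he.lie_neutral, smul_smul, div_mul_cancel₀ _ two_ne_zero]

end IsSolution

end Minimum

/-! ### Critical points on a nilpotent orbit -/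

section Orbit

variable {L : Type*} [LieRing L] [LieAlgebra ℝ L] {θ : L ≃ₗ⁅ℝ⁆ L}
  {B : LinearMap.BilinForm ℝ L} {O : Set L}

namespace IsNonzeroNilpotentOrbit

theorem ne_zero (hO : IsNonzeroNilpotentOrbit O) {ζ : L} (hζ : ζ ∈ O) : ζ ≠ 0 := by
  obtain ⟨ζ₀, h0, -, rfl⟩ := hO
  obtain ⟨h, -, rfl⟩ := hζ
  exact fun h1 => h0 (h.map_eq_zero_iff.1 h1)

variable [FiniteDimensional ℝ L]

theorem apply_mem (hO : IsNonzeroNilpotentOrbit O) {g : L ≃ₗ[ℝ] L} (hg : g ∈ adjointGroup L)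
    {ζ : L} (hζ : ζ ∈ O) : g ζ ∈ O := by
  obtain ⟨ζ₀, -, -, rfl⟩ := hO
  obtain ⟨h, hh, rfl⟩ := hζ
  exact ⟨g * h, mul_mem_adjointGroup hg hh, rfl⟩

theorem exists_apply_eq (hO : IsNonzeroNilpotentOrbit O) {ζ ξ : L} (hζ : ζ ∈ O) (hξ : ξ ∈ O) :
    ∃ g ∈ adjointGroup L, ξ = g ζ := by
  obtain ⟨ζ₀, -, -, rfl⟩ := hO
  obtain ⟨h, hh, rfl⟩ := hζ
  obtain ⟨g, hg, rfl⟩ := hξ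
  refine ⟨g * h⁻¹, mul_mem_adjointGroup hg (inv_mem_adjointGroup hh), ?_⟩
  exact congrArg g (h.symm_apply_apply ζ₀).symm

theorem isNilpotent (hθ : IsCartanInvolution θ) (hO : IsNonzeroNilpotentOrbit O) {ζ : L}
    (hζ : ζ ∈ O) : IsNilpotent (LieAlgebra.ad ℝ L ζ) := by
  have hkill := hθ.isKilling
  obtain ⟨ζ₀, -, hnil, rfl⟩ := hO
  obtain ⟨g, hg, rfl⟩ := hζ
  obtain ⟨h, f, h1, h2, h3⟩ := exists_sl2_triple hnil
  exact (IsNilpotentTriple.map ⟨hnil, h1, h2, h3⟩ (adjointGroup_subset hg)).nilpotent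

theorem exists_isSolution (hθ : IsCartanInvolution θ) (hO : IsNonzeroNilpotentOrbit O) :
    ∃ e ∈ O, ∃ a, IsSolution θ e a := by
  have hO' := hO
  obtain ⟨ζ₀, -, hnil, rfl⟩ := hO'
  obtain ⟨g, hg, h⟩ := exists_adapted hθ hnil
  exact ⟨g ζ₀, ⟨g, hg, rfl⟩, -2, hO.ne_zero ⟨g, hg, rfl⟩, by norm_num, by rw [h, neg_smul]⟩

theorem momentSq_le (hθ : IsCartanInvolution θ) (hB : IsLooseKillingForm θ B)
    (hO : IsNonzeroNilpotentOrbit O) {e : L} {a : ℝ} (he : IsSolution θ e a) (heO : e ∈ O) {ξ : L}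
    (hξ : ξ ∈ O) : momentSq θ B e ≤ momentSq θ B ξ := by
  obtain ⟨g, hg, rfl⟩ := hO.exists_apply_eq heO hξ
  exact (he.momentSq_le hθ hB hg).1

theorem isCriticalOn_iff_exists_isSolution (hθ : IsCartanInvolution θ)
    (hB : IsLooseKillingForm θ B) (hO : IsNonzeroNilpotentOrbit O) {ζ : L} (hζ : ζ ∈ O) :
    IsCriticalOn (momentSq θ B) O ζ ↔ ∃ a, IsSolution θ ζ a := by
  constructor
  · intro h
    obtain ⟨a, ha, hza⟩ := exists_eq_smul_of_isCriticalOn hθ hB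
      (fun g hg ξ hξ => hO.apply_mem hg hξ) (hO.ne_zero hζ) (hO.isNilpotent hθ hζ) h
    exact ⟨a, hO.ne_zero hζ, ha, hza⟩
  · rintro ⟨a, ha⟩
    exact isCriticalOn_of_forall_le hθ hB hζ (hO.ne_zero hζ)
      fun ξ hξ => hO.momentSq_le hθ hB ha hζ hξ

theorem isCriticalOn_iff_forall_le (hθ : IsCartanInvolution θ) (hB : IsLooseKillingForm θ B)
    (hO : IsNonzeroNilpotentOrbit O) {ζ : L} (hζ : ζ ∈ O) :
    IsCriticalOn (momentSq θ B) O ζ ↔ ∀ ξ ∈ O, momentSq θ B ζ ≤ momentSq θ B ξ := by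
  refine ⟨fun h => ?_, isCriticalOn_of_forall_le hθ hB hζ (hO.ne_zero hζ)⟩
  obtain ⟨a, ha⟩ := (hO.isCriticalOn_iff_exists_isSolution hθ hB hζ).1 h
  exact fun ξ hξ => hO.momentSq_le hθ hB ha hζ hξ

/-- The solutions in an orbit form a single orbit of `K_ℝ × ℝ⁺`. -/
theorem exists_isSolution_iff (hθ : IsCartanInvolution θ) (hB : IsLooseKillingForm θ B)
    (hO : IsNonzeroNilpotentOrbit O) {e : L} {a : ℝ} (he : IsSolution θ e a) (heO : e ∈ O)
    {ζ : L} : (ζ ∈ O ∧ ∃ b, IsSolution θ ζ b) ↔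
      ∃ k ∈ thetaFixer θ, ∃ c : ℝ, 0 < c ∧ ζ = c • k e := by
  constructor
  · rintro ⟨hζ, b, hb⟩
    obtain ⟨g, hg, rfl⟩ := hO.exists_apply_eq heO hζ
    obtain ⟨g', hg', hge, hgθ, c, hc⟩ := (he.momentSq_le hθ hB hg).2
      (le_antisymm (hO.momentSq_le hθ hB hb hζ heO) (hO.momentSq_le hθ hB he heO hζ))
    rw [← hge] at hc ⊢
    exact he.exists_smul_eq hθ hB hg' hgθ hc
  · rintro ⟨k, hk, c, hc, rfl⟩
    obtain ⟨hsol, g, hg, hgeq⟩ := he.smul_apply hk hc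
    exact ⟨hgeq ▸ hO.apply_mem hg heO, _, hsol⟩

end IsNonzeroNilpotentOrbit

end Orbit

end NilpotentOrbit

theorem lemma2p11 {L : Type*} [LieRing L] [LieAlgebra ℝ L] [FiniteDimensional ℝ L]
    [LieAlgebra.IsSemisimple ℝ L]
    (K : Subgroup (L ≃ₗ[ℝ] L)) (hK : NilpotentOrbit.IsMaximalCompact K)
    (θ : L ≃ₗ⁅ℝ⁆ L) (hθ : NilpotentOrbit.IsCartanInvolution θ)
    (hKθ : NilpotentOrbit.lieAlgebraOf K = {x : L | θ x = x})
    (B : LinearMap.BilinForm ℝ L) (hB : NilpotentOrbit.IsLooseKillingForm θ B)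
    (O : Set L) (hO : NilpotentOrbit.IsNonzeroNilpotentOrbit O) :
    (∀ ζ ∈ O, NilpotentOrbit.IsCriticalOn (NilpotentOrbit.momentSq θ B) O ζ ↔
      ∃ a : ℝ, a < 0 ∧ ⁅⁅ζ, θ ζ⁆, ζ⁆ = a • ζ ∧ ⁅⁅ζ, θ ζ⁆, θ ζ⁆ = -(a • θ ζ)) ∧
    {ζ | NilpotentOrbit.IsCriticalOn (NilpotentOrbit.momentSq θ B) O ζ}.Nonempty ∧
    (∃ ζ₀ : L, {ζ | NilpotentOrbit.IsCriticalOn (NilpotentOrbit.momentSq θ B) O ζ} =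
      {ζ | ∃ k ∈ K, ∃ c : ℝ, 0 < c ∧ ζ = c • k ζ₀}) ∧
    {ζ | NilpotentOrbit.IsCriticalOn (NilpotentOrbit.momentSq θ B) O ζ} =
      {ζ | ζ ∈ O ∧ ∀ ξ ∈ O, NilpotentOrbit.momentSq θ B ζ ≤ NilpotentOrbit.momentSq θ B ξ} := by
  obtain rfl := NilpotentOrbit.eq_thetaFixer hθ hK hKθ
  obtain ⟨e, heO, a, he⟩ := hO.exists_isSolution hθ
  refine ⟨fun ζ hζ => ?_, ⟨e, (hO.isCriticalOn_iff_exists_isSolution hθ hB heO).2 ⟨a, he⟩⟩,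
    ⟨e, Set.ext fun ζ => ?_⟩, Set.ext fun ζ => ?_⟩
  · rw [hO.isCriticalOn_iff_exists_isSolution hθ hB hζ]
    refine ⟨fun ⟨b, hb⟩ => ⟨b, hb.neg, hb.lie_eq, ?_⟩,
      fun ⟨b, hb, hζb, _⟩ => ⟨b, hO.ne_zero hζ, hb, hζb⟩⟩
    -- The second equation is the image of the first under `θ`.
    have h1 := congrArg θ hb.lie_eq
    rw [LieEquiv.map_lie, NilpotentOrbit.theta_lie_theta hθ.involutive, map_smul, neg_lie] at h1
    rw [← h1, neg_neg]
  · refine Iff.trans ⟨fun h => ?_, fun h => ?_⟩ (hO.exists_isSolution_iff hθ hB he heO)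
    · exact ⟨h.1, (hO.isCriticalOn_iff_exists_isSolution hθ hB h.1).1 h⟩
    · exact (hO.isCriticalOn_iff_exists_isSolution hθ hB h.1).2 h.2
  · exact ⟨fun h => ⟨h.1, (hO.isCriticalOn_iff_forall_le hθ hB h.1).1 h⟩,
      fun h => (hO.isCriticalOn_iff_forall_le hθ hB h.1).2 h.2⟩
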